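/- Let $\alpha,\beta,\gamma$ be fixed real numbers with $\alpha(\alpha-1)\beta\gamma\neq 0$, and let $\varepsilon>0$ and $c>0$ be fixed. Let $H,N,M,Q\ge 1$ and $X\ge cHN$ be real numbers. For integers $h,n,m$ with $H<h\le 2H$, $N<n\le 2N$, $M<m\le 2M$, integers $1\le q\le Q$ and Dirichlet characters $\chi$ modulo $q$, let $a(h,n,q,\chi)$ and $b(m)$ be complex numbers with $|a(h,n,q,\chi)|\le 1$ and $|b(m)|\le 1$. Write $e(x)=e^{2\pi i x}$ and \[ S_0(\chi)=\sum_{H<h\le 2H}\ \sum_{N<n\le 2N} a(h,n,q,\chi)\sum_{M<m\le 2M} b(m)\chi(m)\,e\!\left(\frac{X h^{\beta}n^{\gamma}m^{\alpha}}{H^{\beta}N^{\gamma}M^{\alpha}}\right). \] Then \[ \sum_{q\le Q}\ \sum_{\chi\,(\mathrm{mod}\ q)}|S_0(\chi)|\ \le\ C\,(HMN)^{\varepsilon}\left(Q^2HNM^{1/2}+Q^{3/2}HNM\left(\frac{X^{1/4}}{(HN)^{1/4}M^{1/2}}+\frac{1}{(HN)^{1/4}}\right)\right), \] where the constant $C>0$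 depends only on $\alpha,\beta,\gamma,\varepsilon$ and $c$; the sum is over all Dirichlet characters $\chi$ modulo $q$, for all integers $1\le q\le Q$. -/

import Mathlib

/-- The positive integers `h` with `H < h ≤ 2H`, for a real number `H ≥ 0`. -/
noncomputable def dyadic (H : ℝ) : Finset ℕ := Finset.Ioc ⌊H⌋₊ ⌊2 * H⌋₊

theorem mem_dyadic {H : ℝ} (hH : 0 ≤ H) (h : ℕ) :
    h ∈ dyadic H ↔ H < (h : ℝ) ∧ (h : ℝ) ≤ 2 * H := by
  rw [dyadic, Finset.mem_Ioc, Nat.floor_lt hH, Nat.le_floor_iff (by positivity)]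

/-- The additive character `e(x) = exp(2πix)`. -/
noncomputable def expTwoPiI (x : ℝ) : ℂ := Complex.exp (2 * (Real.pi : ℂ) * Complex.I * (x : ℂ))

/-- The trilinear sum twisted by the Dirichlet character `χ` modulo `q`,
`∑_{H < h ≤ 2H} ∑_{N < n ≤ 2N} a(h, n, q, χ)
  ∑_{M < m ≤ 2M} b(m) χ(m) e(X h^β n^γ m^α / (H^β N^γ M^α))`. -/
noncomputable def trilinearSum (α β γ H N M X : ℝ)
    (a : ℕ → ℕ → (q : ℕ) → DirichletCharacter ℂ q → ℂ) (b : ℕ → ℂ)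
    (q : ℕ) (χ : DirichletCharacter ℂ q) : ℂ :=
  ∑ h ∈ dyadic H, ∑ n ∈ dyadic N, a h n q χ *
    ∑ m ∈ dyadic M, b m * χ (m : ZMod q) *
      expTwoPiI (X * (h : ℝ) ^ β * (n : ℝ) ^ γ * (m : ℝ) ^ α / (H ^ β * N ^ γ * M ^ α))

/-- There are finitely many Dirichlet characters modulo `q`, so that the finite sum
`∑ᶠ χ : DirichletCharacter ℂ q` is the sum over all of them. -/
theorem finite_dirichletCharacter (q : ℕ) : Finite (DirichletCharacter ℂ q) := by
  rcases q with _ | q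
  · have : Finite (ZMod 0)ˣ := inferInstanceAs (Finite ℤˣ)
    infer_instance
  · infer_instance

/-!
The inner sum over `m` is the exponential sum `∑ b(m) χ(m) e(t (m / M) ^ α)`, taken at the points
`t = X (h / H) ^ β (n / N) ^ γ`. By the Cauchy–Schwarz inequality and orthogonality of characters,
the sum over `q`, `χ`, `h`, `n` is controlled by a diagonal part, which gives the first term of the
bound, and by the off-diagonal sum `∑ θ(m, m') e(t ((m / M) ^ α - (m' / M) ^ α))`, whose
coefficients are at most `Q` times a divisor function of `m - m'` (`norm_sum_charsUpTo_le`,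
`exists_card_divisors_le`). Gallagher's inequality (`sq_sum_norm_le`) passes from the discrete
points to an integral over `|t| ≪ X`, at the cost of the number of pairs of points at distance at
most one; sorting by greatest common divisors shows that this number is `O((H N) ^ (1 + ε))`
(`exists_card_spacing_le`). The majorant principle (`integral_norm_sq_expSum_le_long`) removes the
coefficients and reduces everything to the bound of Robert and Sargos
`∫ |∑ e(t (m / M) ^ α)|⁴ dt ≪ M ^ (4 + ε)`, the integral being over `|t| ≤ M ^ 2`
(`fourthMomentBound`).

That bound is proved by bootstrapping. Suppose it holds with `M ^ (4 + η)` for all exponents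
`α ≠ 0, 1`. By the majorant principle the range `|t| ≤ M ^ 2` may be cut into `K` pieces, each
replaced by `|t| ≤ M ^ 2 / K`, and the sum may be smoothed. For `t` of size `T ≤ M ^ 2 / K`, Poisson
summation and stationary phase (`exists_smoothSum_dual`) turn the smooth sum into `M T ^ (-1 / 2)`
times a sum of length `T / M` with the dual exponent `α / (α - 1)`, to which the hypothesis applies
(`FourthMomentBound.dual_sum`). The outcome is `K (M ^ 4 + M ^ 4 (M / K) ^ η / K)`, and
`K = M ^ (η / (1 + η))` replaces `η` by `η / (1 + η)` (`FourthMomentBound.step`). Since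
`1 / η` grows by one at each step, `η` tends to zero from the trivial start `η = 2`.
-/

open MeasureTheory intervalIntegral Set
open scoped FourierTransform ContDiff

/-! ### Exponential sums and the majorant principle -/

theorem expTwoPiI_eq (x : ℝ) : expTwoPiI x = Complex.exp ((2 * Real.pi * x : ℝ) * Complex.I) := by
  rw [expTwoPiI]; congr 1; push_cast; ring

@[simp] theorem norm_expTwoPiI (x : ℝ) : ‖expTwoPiI x‖ = 1 := by
  rw [expTwoPiI_eq]; exact Complex.norm_exp_ofReal_mul_I _

theorem expTwoPiI_add (x y : ℝ) : expTwoPiI (x + y) = expTwoPiI x * expTwoPiI y := by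
  simp only [expTwoPiI, ← Complex.exp_add]; congr 1; push_cast; ring

@[simp] theorem expTwoPiI_zero : expTwoPiI 0 = 1 := by simp [expTwoPiI]

theorem conj_expTwoPiI (x : ℝ) : starRingEnd ℂ (expTwoPiI x) = expTwoPiI (-x) := by
  rw [expTwoPiI_eq, expTwoPiI_eq, ← Complex.exp_conj]; congr 1
  rw [map_mul, Complex.conj_ofReal, Complex.conj_I]; push_cast; ring

@[fun_prop] theorem continuous_expTwoPiI : Continuous expTwoPiI := by
  unfold expTwoPiI; fun_prop

theorem hasDerivAt_expTwoPiI_comp {f : ℝ → ℝ} {f' x : ℝ} (hf : HasDerivAt f f' x) :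
    HasDerivAt (fun y ↦ expTwoPiI (f y)) (2 * Real.pi * Complex.I * f' * expTwoPiI (f x)) x := by
  have h1 : HasDerivAt (fun y ↦ (2 * (Real.pi : ℂ) * Complex.I * (f y : ℂ)))
      (2 * Real.pi * Complex.I * f') x := (hf.ofReal_comp).const_mul _
  have := h1.cexp
  unfold expTwoPiI
  convert this using 1
  ring

/-- The exponential sum `∑ i ∈ s, θ i * e(t φ i)` with coefficients `θ` and frequencies `φ`, as a
function of `t`. -/
noncomputable def expSum {ι : Type*} (s : Finset ι) (θ : ι → ℂ) (φ : ι → ℝ) (t : ℝ) : ℂ :=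
  ∑ i ∈ s, θ i * expTwoPiI (t * φ i)

section expSum

variable {ι : Type*} (s : Finset ι) (θ : ι → ℂ) (φ : ι → ℝ)

@[fun_prop] theorem continuous_expSum : Continuous (expSum s θ φ) := by
  unfold expSum; fun_prop

theorem expSum_add (a t : ℝ) :
    expSum s θ φ (a + t) = expSum s (fun i ↦ θ i * expTwoPiI (a * φ i)) φ t := by
  unfold expSum
  refine Finset.sum_congr rfl fun i _ ↦ ?_
  rw [add_mul, expTwoPiI_add]; ring

theorem norm_expSum_le {w : ι → ℝ} (h : ∀ i ∈ s, ‖θ i‖ ≤ w i) (t : ℝ) :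
    ‖expSum s θ φ t‖ ≤ ∑ i ∈ s, w i := by
  refine (norm_sum_le _ _).trans (Finset.sum_le_sum fun i hi ↦ ?_)
  simpa using h i hi

theorem expSum_mul {κ : Type*} (s' : Finset κ) (θ' : κ → ℂ) (φ' : κ → ℝ) (t : ℝ) :
    expSum s θ φ t * expSum s' θ' φ' t =
      expSum (s ×ˢ s') (fun p ↦ θ p.1 * θ' p.2) (fun p ↦ φ p.1 + φ' p.2) t := by
  simp only [expSum, Finset.sum_mul_sum, Finset.sum_product, mul_add, expTwoPiI_add]
  refine Finset.sum_congr rfl fun i _ ↦ Finset.sum_congr rfl fun j _ ↦ by ring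

theorem conj_expSum (t : ℝ) :
    starRingEnd ℂ (expSum s θ φ t) = expSum s (fun i ↦ starRingEnd ℂ (θ i)) (fun i ↦ -φ i) t := by
  simp [expSum, map_sum, conj_expTwoPiI]

/-- The mean square of an exponential sum over the differences of two points of `[0, R]`: the
weights `‖∫ e(u(φ i - φ j))‖²` that appear are nonnegative, which is the positive definiteness
behind the majorant principle. -/
theorem integral_integral_norm_sq_expSum (R : ℝ) :
    ((∫ v in (0 : ℝ)..R, ∫ u in (0 : ℝ)..R, ‖expSum s θ φ (u - v)‖ ^ 2 : ℝ) : ℂ) =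
      ∑ i ∈ s, ∑ j ∈ s, θ i * starRingEnd ℂ (θ j) *
        ((‖∫ u in (0 : ℝ)..R, expTwoPiI (u * (φ i - φ j))‖ ^ 2 : ℝ) : ℂ) := by
  have hpt : ∀ u v : ℝ, ((‖expSum s θ φ (u - v)‖ ^ 2 : ℝ) : ℂ) =
      ∑ i ∈ s, ∑ j ∈ s, θ i * starRingEnd ℂ (θ j) *
        (expTwoPiI (u * (φ i - φ j)) * starRingEnd ℂ (expTwoPiI (v * (φ i - φ j)))) := by
    intro u v
    have : ((‖expSum s θ φ (u - v)‖ ^ 2 : ℝ) : ℂ) =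
        expSum s θ φ (u - v) * starRingEnd ℂ (expSum s θ φ (u - v)) := by
      rw [Complex.mul_conj, Complex.normSq_eq_norm_sq]
    rw [this, expSum, map_sum, Finset.sum_mul_sum]
    refine Finset.sum_congr rfl fun i _ ↦ Finset.sum_congr rfl fun j _ ↦ ?_
    rw [map_mul, conj_expTwoPiI, conj_expTwoPiI, ← expTwoPiI_add]
    have : u * (φ i - φ j) + -(v * (φ i - φ j)) = (u - v) * φ i + -((u - v) * φ j) := by ring
    rw [this, expTwoPiI_add]; ring
  rw [← intervalIntegral.integral_ofReal]
  simp_rw [← intervalIntegral.integral_ofReal, hpt]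
  have hint : ∀ v : ℝ, ∫ u in (0 : ℝ)..R, (∑ i ∈ s, ∑ j ∈ s, θ i * starRingEnd ℂ (θ j) *
        (expTwoPiI (u * (φ i - φ j)) * starRingEnd ℂ (expTwoPiI (v * (φ i - φ j))))) =
      ∑ i ∈ s, ∑ j ∈ s, θ i * starRingEnd ℂ (θ j) *
        ((∫ u in (0 : ℝ)..R, expTwoPiI (u * (φ i - φ j))) *
          starRingEnd ℂ (expTwoPiI (v * (φ i - φ j)))) := by
    intro v
    rw [intervalIntegral.integral_finsetSum
      fun i _ ↦ (by fun_prop : Continuous _).intervalIntegrable _ _]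
    refine Finset.sum_congr rfl fun i _ ↦ ?_
    rw [intervalIntegral.integral_finsetSum
      fun i _ ↦ (by fun_prop : Continuous _).intervalIntegrable _ _]
    refine Finset.sum_congr rfl fun j _ ↦ ?_
    rw [intervalIntegral.integral_const_mul, intervalIntegral.integral_mul_const]
  simp_rw [hint]
  have hc : ∀ d : ℝ, Continuous fun v : ℝ ↦ starRingEnd ℂ (expTwoPiI (v * d)) := fun d ↦
    Complex.continuous_conj.comp (by fun_prop)
  have hcij : ∀ i j, Continuous fun v : ℝ ↦ θ i * starRingEnd ℂ (θ j) *
        ((∫ u in (0 : ℝ)..R, expTwoPiI (u * (φ i - φ j))) *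
          starRingEnd ℂ (expTwoPiI (v * (φ i - φ j)))) := fun i j ↦
    continuous_const.mul (continuous_const.mul (hc _))
  rw [intervalIntegral.integral_finsetSum
    fun i _ ↦ (continuous_finsetSum _ fun j _ ↦ hcij i j).intervalIntegrable _ _]
  refine Finset.sum_congr rfl fun i _ ↦ ?_
  rw [intervalIntegral.integral_finsetSum fun j _ ↦ (hcij i j).intervalIntegrable _ _]
  refine Finset.sum_congr rfl fun j _ ↦ ?_
  rw [intervalIntegral.integral_const_mul, intervalIntegral.integral_const_mul]
  have hconj : ∫ v in (0 : ℝ)..R, starRingEnd ℂ (expTwoPiI (v * (φ i - φ j))) =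
      starRingEnd ℂ (∫ v in (0 : ℝ)..R, expTwoPiI (v * (φ i - φ j))) :=
    intervalIntegral_conj
  rw [hconj, Complex.mul_conj, Complex.normSq_eq_norm_sq]

end expSum

/-- For `F ≥ 0` an average over differences of points of `[0, 3T]` dominates the average over
`[-T, T]`. -/
theorem mul_integral_le_integral_integral_sub {F : ℝ → ℝ} (hF : Continuous F) (h0 : ∀ x, 0 ≤ F x)
    {T : ℝ} (hT : 0 ≤ T) :
    T * ∫ x in (-T)..T, F x ≤ ∫ v in (0 : ℝ)..(3 * T), ∫ u in (0 : ℝ)..(3 * T), F (u - v) := by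
  have hii : ∀ a b, IntervalIntegrable F volume a b := fun a b ↦ hF.intervalIntegrable a b
  have hG : Continuous fun v : ℝ ↦ ∫ u in (0 : ℝ)..(3 * T), F (u - v) :=
    intervalIntegral.continuous_parametric_intervalIntegral_of_continuous' (by fun_prop) _ _
  have hG0 : ∀ v : ℝ, 0 ≤ ∫ u in (0 : ℝ)..(3 * T), F (u - v) := fun v ↦
    intervalIntegral.integral_nonneg (by linarith) fun u _ ↦ h0 _
  calc T * ∫ x in (-T)..T, F x = ∫ v in T..(2 * T), ∫ x in (-T)..T, F x := by
        rw [intervalIntegral.integral_const, smul_eq_mul]; ring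
    _ ≤ ∫ v in T..(2 * T), ∫ u in (0 : ℝ)..(3 * T), F (u - v) := by
        refine intervalIntegral.integral_mono_on (by linarith) (by simp)
          (hG.intervalIntegrable _ _) fun v hv ↦ ?_
        rw [intervalIntegral.integral_comp_sub_right (fun x ↦ F x) v]
        exact intervalIntegral.integral_mono_interval (by linarith [hv.1]) (by linarith)
          (by linarith [hv.2]) (Filter.Eventually.of_forall fun x ↦ h0 x) (hii _ _)
    _ ≤ _ := intervalIntegral.integral_mono_interval (by linarith) (by linarith) (by linarith)
          (Filter.Eventually.of_forall fun x ↦ hG0 x) (hG.intervalIntegrable _ _)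

theorem integral_integral_sub_le {F : ℝ → ℝ} (hF : Continuous F) (h0 : ∀ x, 0 ≤ F x)
    {R : ℝ} (hR : 0 ≤ R) :
    ∫ v in (0 : ℝ)..R, ∫ u in (0 : ℝ)..R, F (u - v) ≤ R * ∫ x in (-R)..R, F x := by
  have hG : Continuous fun v : ℝ ↦ ∫ u in (0 : ℝ)..R, F (u - v) :=
    intervalIntegral.continuous_parametric_intervalIntegral_of_continuous' (by fun_prop) _ _
  calc ∫ v in (0 : ℝ)..R, ∫ u in (0 : ℝ)..R, F (u - v)
      ≤ ∫ v in (0 : ℝ)..R, ∫ x in (-R)..R, F x := by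
        refine intervalIntegral.integral_mono_on hR (hG.intervalIntegrable _ _) (by simp)
          fun v hv ↦ ?_
        rw [intervalIntegral.integral_comp_sub_right (fun x ↦ F x) v]
        exact intervalIntegral.integral_mono_interval (by linarith [hv.2]) (by linarith [hv.2])
          (by linarith [hv.1]) (Filter.Eventually.of_forall fun x ↦ h0 x)
          (hF.intervalIntegrable _ _)
    _ = _ := by rw [intervalIntegral.integral_const, smul_eq_mul]; ring

section majorant

variable {ι : Type*} (s : Finset ι) {θ : ι → ℂ} (φ : ι → ℝ) {w : ι → ℝ}

/-- **Majorant principle** in mean square: replacing the coefficients by upper bounds for their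
absolute values costs only a constant factor in the mean square and in the length of the
interval. -/
theorem integral_norm_sq_expSum_le (h : ∀ i ∈ s, ‖θ i‖ ≤ w i) {T : ℝ} (hT : 0 < T) :
    ∫ t in (-T)..T, ‖expSum s θ φ t‖ ^ 2 ≤
      3 * ∫ t in (-(3 * T))..(3 * T), ‖expSum s (fun i ↦ (w i : ℂ)) φ t‖ ^ 2 := by
  have hw : ∀ i ∈ s, 0 ≤ w i := fun i hi ↦ (norm_nonneg _).trans (h i hi)
  have h1 := mul_integral_le_integral_integral_sub
    (F := fun t ↦ ‖expSum s θ φ t‖ ^ 2) (by fun_prop) (fun x ↦ by positivity) hT.le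
  have h2 := integral_integral_sub_le
    (F := fun t ↦ ‖expSum s (fun i ↦ (w i : ℂ)) φ t‖ ^ 2) (by fun_prop) (fun x ↦ by positivity)
    (R := 3 * T) (by positivity)
  have h3 : ∫ v in (0 : ℝ)..(3 * T), ∫ u in (0 : ℝ)..(3 * T), ‖expSum s θ φ (u - v)‖ ^ 2 ≤
      ∫ v in (0 : ℝ)..(3 * T), ∫ u in (0 : ℝ)..(3 * T),
        ‖expSum s (fun i ↦ (w i : ℂ)) φ (u - v)‖ ^ 2 := by
    have e1 := integral_integral_norm_sq_expSum s θ φ (3 * T)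
    have e2 := integral_integral_norm_sq_expSum s (fun i ↦ (w i : ℂ)) φ (3 * T)
    set E : ι → ι → ℝ := fun i j ↦ ‖∫ u in (0 : ℝ)..(3 * T), expTwoPiI (u * (φ i - φ j))‖ ^ 2
      with hE
    set A := ∫ v in (0 : ℝ)..(3 * T), ∫ u in (0 : ℝ)..(3 * T), ‖expSum s θ φ (u - v)‖ ^ 2
    set B := ∫ v in (0 : ℝ)..(3 * T), ∫ u in (0 : ℝ)..(3 * T),
        ‖expSum s (fun i ↦ (w i : ℂ)) φ (u - v)‖ ^ 2
    have e3 : B = ∑ i ∈ s, ∑ j ∈ s, w i * w j * E i j := by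
      have : (B : ℂ) = ((∑ i ∈ s, ∑ j ∈ s, w i * w j * E i j : ℝ) : ℂ) := by
        rw [e2]; push_cast; simp [hE]
      exact_mod_cast this
    calc A ≤ ‖(A : ℂ)‖ := by rw [Complex.norm_real]; exact le_abs_self A
      _ ≤ ∑ i ∈ s, ∑ j ∈ s, w i * w j * E i j := by
          rw [e1]
          refine (norm_sum_le _ _).trans (Finset.sum_le_sum fun i hi ↦
            (norm_sum_le _ _).trans (Finset.sum_le_sum fun j hj ↦ ?_))
          rw [norm_mul, norm_mul, RCLike.norm_conj, Complex.norm_real, Real.norm_eq_abs,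
            abs_of_nonneg (by positivity : (0 : ℝ) ≤ _ ^ 2)]
          have := hw i hi
          have := mul_le_mul (h i hi) (h j hj) (norm_nonneg _) (hw i hi)
          exact mul_le_mul_of_nonneg_right this (by positivity)
      _ = B := e3.symm
  have h4 : T * ∫ t in (-T)..T, ‖expSum s θ φ t‖ ^ 2 ≤
      T * (3 * ∫ t in (-(3 * T))..(3 * T), ‖expSum s (fun i ↦ (w i : ℂ)) φ t‖ ^ 2) := by
    refine h1.trans (h3.trans (h2.trans (le_of_eq ?_))); ring
  exact le_of_mul_le_mul_left h4 hT

/-- The majorant principle on an interval of arbitrary length, bounded through one of length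
`6T`. -/
theorem integral_norm_sq_expSum_le_long (h : ∀ i ∈ s, ‖θ i‖ ≤ w i) {T R : ℝ} (hT : 0 < T)
    (hR : 0 ≤ R) :
    ∫ t in (-R)..R, ‖expSum s θ φ t‖ ^ 2 ≤
      (R / T + 1) * (3 * ∫ t in (-(3 * T))..(3 * T), ‖expSum s (fun i ↦ (w i : ℂ)) φ t‖ ^ 2) := by
  set B := 3 * ∫ t in (-(3 * T))..(3 * T), ‖expSum s (fun i ↦ (w i : ℂ)) φ t‖ ^ 2 with hB
  have hB0 : 0 ≤ B := by
    have : 0 ≤ ∫ t in (-(3 * T))..(3 * T), ‖expSum s (fun i ↦ (w i : ℂ)) φ t‖ ^ 2 :=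
      intervalIntegral.integral_nonneg (by linarith) fun t _ ↦ by positivity
    positivity
  have hii : ∀ a b, IntervalIntegrable (fun t ↦ ‖expSum s θ φ t‖ ^ 2) volume a b := fun a b ↦
    (by fun_prop : Continuous fun t ↦ ‖expSum s θ φ t‖ ^ 2).intervalIntegrable a b
  -- translating the interval multiplies the coefficients by numbers of absolute value one
  have hshift : ∀ a, ∫ t in a..(a + 2 * T), ‖expSum s θ φ t‖ ^ 2 ≤ B := by
    intro a
    have := integral_norm_sq_expSum_le s (θ := fun i ↦ θ i * expTwoPiI ((a + T) * φ i)) φ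
      (w := w) (fun i hi ↦ by simpa using h i hi) hT
    refine le_trans (le_of_eq ?_) this
    simp_rw [← expSum_add]
    rw [intervalIntegral.integral_comp_add_left (fun t ↦ ‖expSum s θ φ t‖ ^ 2) (a + T)]
    congr 1 <;> ring
  have hn : ∀ n : ℕ, ∫ t in (-R)..(-R + n * (2 * T)), ‖expSum s θ φ t‖ ^ 2 ≤ n * B := by
    intro n
    induction n with
    | zero => simp
    | succ n ih =>
      rw [← intervalIntegral.integral_add_adjacent_intervals (hii _ (-R + n * (2 * T))) (hii _ _)]
      have h1 := hshift (-R + n * (2 * T))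
      have h2 : -R + ((n + 1 : ℕ) : ℝ) * (2 * T) = -R + n * (2 * T) + 2 * T := by push_cast; ring
      rw [h2]; push_cast; linarith
  have hceil : R / T ≤ ⌈R / T⌉₊ := Nat.le_ceil _
  have hceil' : (⌈R / T⌉₊ : ℝ) < R / T + 1 := Nat.ceil_lt_add_one (by positivity)
  calc ∫ t in (-R)..R, ‖expSum s θ φ t‖ ^ 2
      ≤ ∫ t in (-R)..(-R + ⌈R / T⌉₊ * (2 * T)), ‖expSum s θ φ t‖ ^ 2 := by
        refine intervalIntegral.integral_mono_interval le_rfl (by linarith) ?_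
          (Filter.Eventually.of_forall fun x ↦ by positivity) (hii _ _)
        have : R ≤ ⌈R / T⌉₊ * T := (div_le_iff₀ hT).1 hceil
        linarith
    _ ≤ ⌈R / T⌉₊ * B := hn _
    _ ≤ _ := by gcongr

/-- The majorant principle for fourth moments. -/
theorem integral_norm_pow_four_expSum_le_long (h : ∀ i ∈ s, ‖θ i‖ ≤ w i) {T R : ℝ} (hT : 0 < T)
    (hR : 0 ≤ R) :
    ∫ t in (-R)..R, ‖expSum s θ φ t‖ ^ 4 ≤
      (R / T + 1) * (3 * ∫ t in (-(3 * T))..(3 * T), ‖expSum s (fun i ↦ (w i : ℂ)) φ t‖ ^ 4) := by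
  have key : ∀ θ : ι → ℂ, ∀ t, ‖expSum s θ φ t‖ ^ 4 =
      ‖expSum (s ×ˢ s) (fun p ↦ θ p.1 * θ p.2) (fun p ↦ φ p.1 + φ p.2) t‖ ^ 2 := by
    intro θ t
    rw [← expSum_mul, norm_mul]; ring
  simp_rw [key]
  have := integral_norm_sq_expSum_le_long (s ×ˢ s) (θ := fun p ↦ θ p.1 * θ p.2)
    (fun p ↦ φ p.1 + φ p.2) (w := fun p ↦ w p.1 * w p.2) (fun p hp ↦ by
      rw [Finset.mem_product] at hp
      rw [norm_mul]
      exact mul_le_mul (h _ hp.1) (h _ hp.2) (norm_nonneg _) ((norm_nonneg _).trans (h _ hp.1)))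
    hT hR
  simpa using this

end majorant

/-! ### Oscillatory integrals -/

/-- The first derivative test: integration by parts against `h' e(lam h)`. -/
theorem norm_integral_mul_deriv_expTwoPiI_le {a b : ℝ} (hab : a ≤ b) {f f' h h' : ℝ → ℝ}
    (hf : ∀ x ∈ Icc a b, HasDerivAt f (f' x) x) (hf' : ContinuousOn f' (Icc a b))
    (hh : ∀ x ∈ Icc a b, HasDerivAt h (h' x) x) (hh' : ContinuousOn h' (Icc a b))
    {lam : ℝ} (hl : 0 < lam) :
    ‖∫ x in a..b, ((f x * h' x : ℝ) : ℂ) * expTwoPiI (lam * h x)‖ ≤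
      (|f a| + |f b| + ∫ x in a..b, |f' x|) / lam := by
  have hpi := Real.pi_gt_three
  set c : ℂ := 2 * Real.pi * Complex.I * lam with hc
  have hc0 : c ≠ 0 := by
    simp [hc, hl.ne', Real.pi_ne_zero]
  have hcn : ‖c‖ = 2 * Real.pi * lam := by
    simp [hc, abs_of_pos hl, abs_of_pos Real.pi_pos]
  rw [← uIcc_of_le hab] at hf hf' hh hh'
  have hhc : ContinuousOn h (uIcc a b) := fun x hx ↦ (hh x hx).continuousAt.continuousWithinAt
  have hec : ContinuousOn (fun x ↦ expTwoPiI (lam * h x)) (uIcc a b) :=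
    continuous_expTwoPiI.comp_continuousOn (continuousOn_const.mul hhc)
  have hv : ∀ x ∈ uIcc a b, HasDerivAt (fun x ↦ c⁻¹ * expTwoPiI (lam * h x))
      ((h' x : ℂ) * expTwoPiI (lam * h x)) x := by
    intro x hx
    have := (hasDerivAt_expTwoPiI_comp ((hh x hx).const_mul lam)).const_mul c⁻¹
    convert! this using 1
    push_cast
    have : c⁻¹ * (2 * Real.pi * Complex.I * (lam * h' x) * expTwoPiI (lam * h x)) =
      (c⁻¹ * c) * (h' x * expTwoPiI (lam * h x)) := by rw [hc]; ring
    rw [this, inv_mul_cancel₀ hc0, one_mul]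
  have key := intervalIntegral.integral_mul_deriv_eq_deriv_mul (a := a) (b := b)
    (u := fun x ↦ (f x : ℂ)) (u' := fun x ↦ (f' x : ℂ))
    (v := fun x ↦ c⁻¹ * expTwoPiI (lam * h x))
    (v' := fun x ↦ (h' x : ℂ) * expTwoPiI (lam * h x))
    (fun x hx ↦ (hf x hx).ofReal_comp) hv
    (Complex.continuous_ofReal.comp_continuousOn hf').intervalIntegrable
    ((Complex.continuous_ofReal.comp_continuousOn hh').mul hec).intervalIntegrable
  have e1 : ∫ x in a..b, ((f x * h' x : ℝ) : ℂ) * expTwoPiI (lam * h x) =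
      ∫ x in a..b, (f x : ℂ) * ((h' x : ℂ) * expTwoPiI (lam * h x)) := by
    congr 1; ext x; push_cast; ring
  rw [e1, key]
  have n1 : ∀ x, ‖c⁻¹ * expTwoPiI (lam * h x)‖ ≤ 1 / lam := by
    intro x
    rw [norm_mul, norm_expTwoPiI, norm_inv, hcn, mul_one, ← one_div]
    apply one_div_le_one_div_of_le hl
    nlinarith
  have n2 : ‖∫ x in a..b, (f' x : ℂ) * (c⁻¹ * expTwoPiI (lam * h x))‖ ≤
      ∫ x in a..b, |f' x| * (1 / lam) := by
    refine intervalIntegral.norm_integral_le_of_norm_le hab ?_ ?_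
    · refine Filter.Eventually.of_forall fun x _ ↦ ?_
      rw [norm_mul, Complex.norm_real, Real.norm_eq_abs]
      exact mul_le_mul_of_nonneg_left (n1 x) (abs_nonneg _)
    · exact (hf'.abs.mul continuousOn_const).intervalIntegrable
  rw [intervalIntegral.integral_mul_const] at n2
  have n3 : ∀ x, ‖(f x : ℂ) * (c⁻¹ * expTwoPiI (lam * h x))‖ ≤ |f x| * (1 / lam) := by
    intro x
    rw [norm_mul, Complex.norm_real, Real.norm_eq_abs]
    exact mul_le_mul_of_nonneg_left (n1 x) (abs_nonneg _)
  refine (norm_sub_le _ _).trans ?_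
  have := norm_sub_le ((f b : ℂ) * (c⁻¹ * expTwoPiI (lam * h b)))
    ((f a : ℂ) * (c⁻¹ * expTwoPiI (lam * h a)))
  have h3a := n3 a
  have h3b := n3 b
  calc _ ≤ |f b| * (1 / lam) + |f a| * (1 / lam) + (∫ x in a..b, |f' x|) * (1 / lam) := by linarith
    _ = _ := by ring

/-- The tail of the Fresnel integral, by the first derivative test. -/
theorem norm_integral_expTwoPiI_sq_le {σ : ℝ} (hσ : σ = 1 ∨ σ = -1) {a b : ℝ} (ha : 0 < a)
    (hab : a ≤ b) : ‖∫ u in a..b, expTwoPiI (σ * u ^ 2)‖ ≤ 1 / a := by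
  have hσ2 : σ * σ = 1 := by rcases hσ with rfl | rfl <;> norm_num
  have hσa : |σ| = 1 := by rcases hσ with rfl | rfl <;> norm_num
  have hb : 0 < b := ha.trans_le hab
  have hpos : ∀ x ∈ Icc a b, 0 < x := fun x hx ↦ ha.trans_le hx.1
  have := norm_integral_mul_deriv_expTwoPiI_le hab (f := fun u ↦ σ / 2 * u⁻¹)
    (f' := fun u ↦ σ / 2 * (-(u ^ 2)⁻¹)) (h := fun u ↦ σ * u ^ 2) (h' := fun u ↦ σ * (2 * u))
    (fun x hx ↦ (hasDerivAt_inv (hpos x hx).ne').const_mul _)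
    (by
      refine continuousOn_const.mul (ContinuousOn.neg (ContinuousOn.inv₀ (by fun_prop) ?_))
      exact fun x hx ↦ (pow_pos (hpos x hx) 2).ne')
    (fun x hx ↦ by simpa using (hasDerivAt_pow 2 x).const_mul σ) (by fun_prop) one_pos
  have e1 : ∫ u in a..b, expTwoPiI (σ * u ^ 2) =
      ∫ x in a..b, ((σ / 2 * x⁻¹ * (σ * (2 * x)) : ℝ) : ℂ) * expTwoPiI (1 * (σ * x ^ 2)) := by
    refine intervalIntegral.integral_congr fun x hx ↦ ?_
    rw [uIcc_of_le hab] at hx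
    have hx0 := hpos x hx
    have : σ / 2 * x⁻¹ * (σ * (2 * x)) = 1 := by
      field_simp; linarith
    simp only [this, one_mul, Complex.ofReal_one]
  have e2 : ∫ x in a..b, |σ / 2 * (-(x ^ 2)⁻¹)| = 1 / 2 * (a⁻¹ - b⁻¹) := by
    have : ∫ x in a..b, |σ / 2 * (-(x ^ 2)⁻¹)| = ∫ x in a..b, (-(1/2)) * (-(x ^ 2)⁻¹) := by
      refine intervalIntegral.integral_congr fun x hx ↦ ?_
      rw [uIcc_of_le hab] at hx
      have hx0 := pow_pos (hpos x hx) 2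
      simp only [abs_mul, abs_neg, abs_div, hσa, abs_inv, abs_of_pos hx0]
      norm_num
    rw [this, intervalIntegral.integral_const_mul,
      intervalIntegral.integral_eq_sub_of_hasDerivAt (f := fun x ↦ x⁻¹)]
    · ring
    · intro x hx
      rw [uIcc_of_le hab] at hx
      exact hasDerivAt_inv (hpos x hx).ne'
    · refine ContinuousOn.intervalIntegrable ?_
      rw [uIcc_of_le hab]
      exact ContinuousOn.neg
        (ContinuousOn.inv₀ (by fun_prop) fun x hx ↦ (pow_pos (hpos x hx) 2).ne')
  rw [e1]
  refine this.trans (le_of_eq ?_)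
  rw [e2]
  simp only [abs_mul, abs_div, hσa, abs_inv, abs_of_pos ha, abs_of_pos hb]
  norm_num
  ring

/-- The Fresnel integral converges, with an error `O(1 / R)` for its truncation at `R`. -/
theorem exists_fresnel {σ : ℝ} (hσ : σ = 1 ∨ σ = -1) :
    ∃ κ : ℂ, ∀ R : ℝ, 0 < R → ‖(∫ u in (0 : ℝ)..R, expTwoPiI (σ * u ^ 2)) - κ‖ ≤ 1 / R := by
  set Φ : ℝ → ℂ := fun R ↦ ∫ u in (0 : ℝ)..R, expTwoPiI (σ * u ^ 2) with hΦ
  have hii : ∀ a b, IntervalIntegrable (fun u ↦ expTwoPiI (σ * u ^ 2)) volume a b := fun a b ↦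
    (by fun_prop : Continuous fun u ↦ expTwoPiI (σ * u ^ 2)).intervalIntegrable a b
  have hd : ∀ a b, 0 < a → a ≤ b → ‖Φ b - Φ a‖ ≤ 1 / a := by
    intro a b ha hab
    rw [hΦ]
    simp only
    rw [intervalIntegral.integral_interval_sub_left (hii _ _) (hii _ _)]
    exact norm_integral_expTwoPiI_sq_le hσ ha hab
  have hcau : CauchySeq fun n : ℕ ↦ Φ (n + 1) := by
    refine cauchySeq_of_le_tendsto_0 (fun N : ℕ ↦ 2 / ((N : ℝ) + 1)) ?_ ?_
    · intro n m N hn hm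
      have h1 := hd (N + 1) (n + 1) (by positivity) (by exact_mod_cast Nat.succ_le_succ hn)
      have h2 := hd (N + 1) (m + 1) (by positivity) (by exact_mod_cast Nat.succ_le_succ hm)
      rw [dist_eq_norm]
      have : Φ (n + 1) - Φ (m + 1) = (Φ (n + 1) - Φ (N + 1)) - (Φ (m + 1) - Φ (N + 1)) := by ring
      rw [this]
      refine (norm_sub_le _ _).trans ((add_le_add h1 h2).trans (le_of_eq ?_))
      ring
    · have := tendsto_one_div_add_atTop_nhds_zero_nat (𝕜 := ℝ)
      have := this.const_mul 2
      simpa [div_eq_mul_inv] using this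
  obtain ⟨κ, hκ⟩ := cauchySeq_tendsto_of_complete hcau
  refine ⟨κ, fun R hR ↦ ?_⟩
  have h1 : Filter.Tendsto (fun n : ℕ ↦ ‖Φ R - Φ (n + 1)‖) Filter.atTop (nhds ‖Φ R - κ‖) :=
    (tendsto_const_nhds.sub hκ).norm
  refine le_of_tendsto h1 ?_
  filter_upwards [Filter.eventually_ge_atTop ⌈R⌉₊] with n hn
  rw [norm_sub_rev]
  refine hd R (n + 1) hR ?_
  have := Nat.le_ceil R
  have : (⌈R⌉₊ : ℝ) ≤ n := by exact_mod_cast hn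
  linarith

/-- The truncated Fresnel integral on an interval around `0`, with large parameter `lam`. -/
theorem exists_fresnel_scaled {σ : ℝ} (hσ : σ = 1 ∨ σ = -1) :
    ∃ κ : ℂ, ∀ a b lam : ℝ, 0 < a → 0 < b → 0 < lam →
      ‖(∫ u in (-a)..b, expTwoPiI (lam * (σ * u ^ 2))) - κ * ((lam ^ (-(1 / 2) : ℝ) : ℝ) : ℂ)‖ ≤
        (1 / a + 1 / b) / lam := by
  obtain ⟨κ, hκ⟩ := exists_fresnel hσ
  refine ⟨2 * κ, fun a b lam ha hb hl ↦ ?_⟩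
  have hii : ∀ a b, IntervalIntegrable (fun u ↦ expTwoPiI (lam * (σ * u ^ 2))) volume a b :=
    fun a b ↦ (by fun_prop : Continuous _).intervalIntegrable a b
  have half : ∀ b, 0 < b → ‖(∫ u in (0 : ℝ)..b, expTwoPiI (lam * (σ * u ^ 2))) -
      κ * ((lam ^ (-(1 / 2) : ℝ) : ℝ) : ℂ)‖ ≤ 1 / b / lam := by
    intro b hb
    have hs : 0 < Real.sqrt lam := Real.sqrt_pos.2 hl
    have e0 : lam ^ (-(1 / 2) : ℝ) = (Real.sqrt lam)⁻¹ := by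
      rw [Real.rpow_neg hl.le, Real.sqrt_eq_rpow]
    have e1 : ∫ u in (0 : ℝ)..b, expTwoPiI (lam * (σ * u ^ 2)) =
        ((Real.sqrt lam)⁻¹ : ℝ) * ∫ u in (0 : ℝ)..(Real.sqrt lam * b), expTwoPiI (σ * u ^ 2) := by
      have := intervalIntegral.integral_comp_mul_left (a := 0) (b := b)
        (fun u ↦ expTwoPiI (σ * u ^ 2)) hs.ne'
      rw [mul_zero, Complex.real_smul] at this
      rw [← this]
      congr 1; ext u; congr 1
      rw [mul_pow, Real.sq_sqrt hl.le]; ring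
    rw [e0, e1, mul_comm κ, ← mul_sub, norm_mul, Complex.norm_real, Real.norm_eq_abs,
      abs_of_pos (inv_pos.2 hs)]
    calc _ ≤ (Real.sqrt lam)⁻¹ * (1 / (Real.sqrt lam * b)) := by
          gcongr; exact hκ _ (by positivity)
      _ = 1 / b / (Real.sqrt lam * Real.sqrt lam) := by field_simp
      _ = _ := by rw [Real.mul_self_sqrt hl.le]
  have e2 : ∫ u in (-a)..(0 : ℝ), expTwoPiI (lam * (σ * u ^ 2)) =
      ∫ u in (0 : ℝ)..a, expTwoPiI (lam * (σ * u ^ 2)) := by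
    have := intervalIntegral.integral_comp_neg (a := 0) (b := a)
      (fun u ↦ expTwoPiI (lam * (σ * u ^ 2)))
    simpa using this.symm
  rw [← intervalIntegral.integral_add_adjacent_intervals (hii _ 0) (hii _ _), e2]
  have h1 := half a ha
  have h2 := half b hb
  have : ∀ x y z : ℂ, x + y - 2 * κ * z = (x - κ * z) + (y - κ * z) := fun x y z ↦ by ring
  rw [this]
  refine (norm_add_le _ _).trans ((add_le_add h1 h2).trans (le_of_eq ?_))
  ring

/-! ### Stationary phase -/

theorem abs_le_mul_abs_sub_one {A B : ℝ} (hA : A ≤ 1) (hB : 1 ≤ B) {k k' : ℝ → ℝ} {K : ℝ}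
    (hk : ∀ x ∈ Icc A B, HasDerivAt k (k' x) x) (hK : ∀ x ∈ Icc A B, |k' x| ≤ K) (h1 : k 1 = 0)
    {x : ℝ} (hx : x ∈ Icc A B) : |k x| ≤ K * |x - 1| := by
  have := (convex_Icc A B).norm_image_sub_le_of_norm_hasDerivWithin_le (f := k) (f' := k') (C := K)
    (fun y hy ↦ (hk y hy).hasDerivWithinAt) (fun y hy ↦ by simpa using hK y hy)
    (x := 1) (y := x) ⟨hA, hB⟩ hx
  simpa [h1] using this

/-- The second order Taylor bound behind the differentiability of `k x / (x - 1)` at `1`. -/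
theorem abs_deriv_mul_sub_one_sub_le {A B : ℝ} (hA : A ≤ 1) (hB : 1 ≤ B) {k k' k'' : ℝ → ℝ} {K : ℝ}
    (hk : ∀ x ∈ Icc A B, HasDerivAt k (k' x) x) (hk' : ∀ x ∈ Icc A B, HasDerivAt k' (k'' x) x)
    (hK : ∀ x ∈ Icc A B, |k'' x| ≤ K) (h1 : k 1 = 0) {x : ℝ} (hx : x ∈ Icc A B) :
    |k' x * (x - 1) - k x| ≤ K * (x - 1) ^ 2 := by
  have hK0 : 0 ≤ K := (abs_nonneg _).trans (hK x hx)
  have hsub : uIcc 1 x ⊆ Icc A B := by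
    rw [← uIcc_of_le (hA.trans hB)]
    exact uIcc_subset_uIcc (by rw [uIcc_of_le (hA.trans hB)]; exact ⟨hA, hB⟩)
      (by rw [uIcc_of_le (hA.trans hB)]; exact hx)
  have := (convex_uIcc (1 : ℝ) x).norm_image_sub_le_of_norm_hasDerivWithin_le
    (f := fun y ↦ k' y * (y - 1) - k y) (f' := fun y ↦ k'' y * (y - 1)) (C := K * |x - 1|)
    (fun y hy ↦ by
      have h2 := ((hk' y (hsub hy)).mul ((hasDerivAt_id y).sub_const 1)).sub (hk y (hsub hy))
      refine HasDerivAt.hasDerivWithinAt ?_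
      convert! h2 using 1
      simp)
    (fun y hy ↦ by
      rw [Real.norm_eq_abs, abs_mul]
      have h3 : |y - 1| ≤ |x - 1| := abs_sub_left_of_mem_uIcc hy
      exact mul_le_mul (hK y (hsub hy)) h3 (abs_nonneg _) hK0)
    (x := 1) (y := x) left_mem_uIcc right_mem_uIcc
  simp only [h1, sub_self, mul_zero, sub_zero, Real.norm_eq_abs] at this
  refine this.trans (le_of_eq ?_)
  rw [mul_assoc, ← sq, sq_abs]

section vanishing

variable {A B : ℝ} (hA : A < 1) (hB : 1 < B) {h h1 h1' : ℝ → ℝ} {c D : ℝ} (hc : 0 < c)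
  (hh : ∀ x ∈ Icc A B, HasDerivAt h ((x - 1) * h1 x) x)
  (hh1 : ∀ x ∈ Icc A B, HasDerivAt h1 (h1' x) x) (hh1' : ContinuousOn h1' (Icc A B))
  (hc1 : ∀ x ∈ Icc A B, c ≤ |h1 x|) (hD : ∀ x ∈ Icc A B, |h1' x| ≤ D)
  {k k' k'' : ℝ → ℝ} {K : ℝ} (hk : ∀ x ∈ Icc A B, HasDerivAt k (k' x) x)
  (hk' : ∀ x ∈ Icc A B, HasDerivAt k' (k'' x) x) (hK : ∀ x ∈ Icc A B, |k' x| ≤ K)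
  (hK' : ∀ x ∈ Icc A B, |k'' x| ≤ K) (k1 : k 1 = 0)
include hA hB hc hh hh1 hh1' hc1 hD hk hk' hK hK' k1

/-- An oscillatory integral whose amplitude `k` vanishes at the stationary point `1` of the phase,
over an interval that does not contain `1`: the bound is uniform in the distance to `1`. -/
theorem norm_integral_vanishing_le_aux {a b : ℝ} (hab : a ≤ b) (hAa : A ≤ a) (hbB : b ≤ B)
    (h1ab : ∀ x ∈ Icc a b, x ≠ 1) {lam : ℝ} (hl : 0 < lam) :
    ‖∫ x in a..b, (k x : ℂ) * expTwoPiI (lam * h x)‖ ≤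
      (2 * (K / c) + (B - A) * (K / c + K * D / c ^ 2)) / lam := by
  have hsub : Icc a b ⊆ Icc A B := Icc_subset_Icc hAa hbB
  have haI : a ∈ Icc a b := ⟨le_rfl, hab⟩
  have hK0 : 0 ≤ K := (abs_nonneg _).trans (hK a (hsub haI))
  have hD0 : 0 ≤ D := (abs_nonneg _).trans (hD a (hsub haI))
  have hh0 : ∀ x ∈ Icc A B, h1 x ≠ 0 := fun x hx h0 ↦ by
    have := hc1 x hx; rw [h0, abs_zero] at this; linarith
  have hx1 : ∀ x ∈ Icc a b, x - 1 ≠ 0 := fun x hx ↦ sub_ne_zero.2 (h1ab x hx)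
  have hkc : ContinuousOn k (Icc A B) := fun x hx ↦ (hk x hx).continuousAt.continuousWithinAt
  have hkc' : ContinuousOn k' (Icc A B) := fun x hx ↦ (hk' x hx).continuousAt.continuousWithinAt
  have hh1c : ContinuousOn h1 (Icc A B) := fun x hx ↦ (hh1 x hx).continuousAt.continuousWithinAt
  -- the quotient of the amplitude by `h'`: the zero of `k` at `1` keeps it and `f'` bounded
  set f : ℝ → ℝ := fun x ↦ k x / (x - 1) / h1 x with hf
  set f' : ℝ → ℝ := fun x ↦ (k' x * (x - 1) - k x) / (x - 1) ^ 2 / h1 x -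
    k x / (x - 1) * h1' x / h1 x ^ 2 with hf'
  have hfb : ∀ x ∈ Icc a b, |f x| ≤ K / c := by
    intro x hx
    rw [hf, abs_div, abs_div]
    have h2 := abs_le_mul_abs_sub_one hA.le hB.le hk hK k1 (hsub hx)
    have h3 : |k x| / |x - 1| ≤ K := by
      rw [div_le_iff₀ (abs_pos.2 (hx1 x hx))]; exact h2
    exact div_le_div₀ hK0 h3 hc (hc1 x (hsub hx))
  have hfb' : ∀ x ∈ Icc a b, |f' x| ≤ K / c + K * D / c ^ 2 := by
    intro x hx
    rw [hf']
    refine (abs_sub _ _).trans (add_le_add ?_ ?_)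
    · rw [abs_div, abs_div]
      have h2 := abs_deriv_mul_sub_one_sub_le hA.le hB.le hk hk' hK' k1 (hsub hx)
      have hp : 0 < (x - 1) ^ 2 := by have := hx1 x hx; positivity
      have h3 : |k' x * (x - 1) - k x| / |(x - 1) ^ 2| ≤ K := by
        rw [abs_of_pos hp, div_le_iff₀ hp]; exact h2
      exact div_le_div₀ hK0 h3 hc (hc1 x (hsub hx))
    · rw [abs_div, abs_mul, abs_div, abs_pow]
      have h2 := abs_le_mul_abs_sub_one hA.le hB.le hk hK k1 (hsub hx)
      have h3 : |k x| / |x - 1| ≤ K := by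
        rw [div_le_iff₀ (abs_pos.2 (hx1 x hx))]; exact h2
      have h4 := mul_le_mul h3 (hD x (hsub hx)) (abs_nonneg _) hK0
      exact div_le_div₀ (by positivity) h4 (by positivity)
        (pow_le_pow_left₀ hc.le (hc1 x (hsub hx)) 2)
  have hfc' : ContinuousOn f' (Icc a b) := by
    have i1 : ContinuousOn (fun x : ℝ ↦ x - 1) (Icc a b) := by fun_prop
    have k1 := hkc.mono hsub
    have k2 := hkc'.mono hsub
    have h2 := hh1c.mono hsub
    have h3 := hh1'.mono hsub
    refine ContinuousOn.sub ?_ ?_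
    · refine (ContinuousOn.div ((k2.mul i1).sub k1) (i1.pow 2) ?_).div h2
        fun x hx ↦ hh0 x (hsub hx)
      exact fun x hx ↦ pow_ne_zero 2 (hx1 x hx)
    · refine ((k1.div i1 hx1).mul h3).div (h2.pow 2) fun x hx ↦ pow_ne_zero 2 (hh0 x (hsub hx))
  have hfd : ∀ x ∈ Icc a b, HasDerivAt f (f' x) x := by
    intro x hx
    have d1 := ((hk x (hsub hx)).div ((hasDerivAt_id x).sub_const 1) (hx1 x hx)).div
      (hh1 x (hsub hx)) (hh0 x (hsub hx))
    convert! d1 using 1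
    have := hx1 x hx
    have := hh0 x (hsub hx)
    simp only [hf', id, Pi.div_apply]
    field_simp
  have main := norm_integral_mul_deriv_expTwoPiI_le hab hfd hfc' (fun x hx ↦ hh x (hsub hx))
    (((by fun_prop : ContinuousOn (fun x : ℝ ↦ x - 1) (Icc A B)).mul hh1c).mono hsub) hl
  have e1 : ∫ x in a..b, (k x : ℂ) * expTwoPiI (lam * h x) =
      ∫ x in a..b, ((f x * ((x - 1) * h1 x) : ℝ) : ℂ) * expTwoPiI (lam * h x) := by
    refine intervalIntegral.integral_congr fun x hx ↦ ?_
    rw [uIcc_of_le hab] at hx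
    have := hx1 x hx
    have := hh0 x (hsub hx)
    have e : f x * ((x - 1) * h1 x) = k x := by simp only [hf]; field_simp
    simp only [e]
  rw [e1]
  refine main.trans (div_le_div_of_nonneg_right ?_ hl.le)
  have i1 : ∫ x in a..b, |f' x| ≤ (B - A) * (K / c + K * D / c ^ 2) := by
    have : ∫ x in a..b, |f' x| ≤ ∫ x in a..b, (K / c + K * D / c ^ 2) := by
      refine intervalIntegral.integral_mono_on hab ?_ (by simp) hfb'
      refine ContinuousOn.intervalIntegrable ?_
      rw [uIcc_of_le hab]; exact hfc'.abs
    rw [intervalIntegral.integral_const, smul_eq_mul] at this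
    refine this.trans (mul_le_mul_of_nonneg_right (by linarith) (by positivity))
  have := hfb a haI
  have := hfb b ⟨hab, le_rfl⟩
  linarith

/-- An oscillatory integral whose amplitude vanishes at the stationary point is `O(1 / lam)`. -/
theorem norm_integral_vanishing_le {lam : ℝ} (hl : 0 < lam) :
    ‖∫ x in A..B, (k x : ℂ) * expTwoPiI (lam * h x)‖ ≤
      (2 * (2 * (K / c) + (B - A) * (K / c + K * D / c ^ 2)) + 2 * (K * (B - A))) / lam := by
  have h1I : (1 : ℝ) ∈ Icc A B := ⟨hA.le, hB.le⟩
  have hK0 : 0 ≤ K := (abs_nonneg _).trans (hK 1 h1I)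
  set ε : ℝ := min (1 / lam) (min (1 - A) (B - 1)) with hε
  have hε0 : 0 < ε := by
    rw [hε]; exact lt_min (by positivity) (lt_min (by linarith) (by linarith))
  have hε1 : ε ≤ 1 / lam := min_le_left _ _
  have hεA : ε ≤ 1 - A := (min_le_right _ _).trans (min_le_left _ _)
  have hεB : ε ≤ B - 1 := (min_le_right _ _).trans (min_le_right _ _)
  have hkc : ContinuousOn k (Icc A B) := fun x hx ↦ (hk x hx).continuousAt.continuousWithinAt
  have hhc : ContinuousOn h (Icc A B) := fun x hx ↦ (hh x hx).continuousAt.continuousWithinAt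
  have hcont : ContinuousOn (fun x ↦ (k x : ℂ) * expTwoPiI (lam * h x)) (Icc A B) :=
    (Complex.continuous_ofReal.comp_continuousOn hkc).mul
      (continuous_expTwoPiI.comp_continuousOn (continuousOn_const.mul hhc))
  have hii : ∀ a b, A ≤ a → a ≤ b → b ≤ B →
      IntervalIntegrable (fun x ↦ (k x : ℂ) * expTwoPiI (lam * h x)) volume a b := by
    intro a b ha hab hb
    refine ContinuousOn.intervalIntegrable ?_
    rw [uIcc_of_le hab]; exact hcont.mono (Icc_subset_Icc ha hb)
  rw [← intervalIntegral.integral_add_adjacent_intervals (b := 1 - ε)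
      (hii A (1 - ε) le_rfl (by linarith) (by linarith))
      (hii _ _ (by linarith) (by linarith) le_rfl),
    ← intervalIntegral.integral_add_adjacent_intervals (a := 1 - ε) (b := 1 + ε)
      (hii (1 - ε) (1 + ε) (by linarith) (by linarith) (by linarith))
      (hii _ _ (by linarith) (by linarith) le_rfl)]
  have b1 := norm_integral_vanishing_le_aux hA hB hc hh hh1 hh1' hc1 hD hk hk' hK hK' k1
    (a := A) (b := 1 - ε) (by linarith) le_rfl (by linarith)
    (fun x hx ↦ by have := hx.2; intro h; linarith) hl
  have b3 := norm_integral_vanishing_le_aux hA hB hc hh hh1 hh1' hc1 hD hk hk' hK hK' k1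
    (a := 1 + ε) (b := B) (by linarith) (by linarith) le_rfl
    (fun x hx ↦ by have := hx.1; intro h; linarith) hl
  have b2 : ‖∫ x in (1 - ε)..(1 + ε), (k x : ℂ) * expTwoPiI (lam * h x)‖ ≤
      2 * (K * (B - A)) / lam := by
    have := intervalIntegral.norm_integral_le_of_norm_le_const (a := 1 - ε) (b := 1 + ε)
      (f := fun x ↦ (k x : ℂ) * expTwoPiI (lam * h x)) (C := K * (B - A)) (fun x hx ↦ by
        rw [uIoc_of_le (by linarith)] at hx
        have hx' : x ∈ Icc A B := ⟨by linarith [hx.1], by linarith [hx.2]⟩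
        rw [norm_mul, norm_expTwoPiI, mul_one, Complex.norm_real, Real.norm_eq_abs]
        refine (abs_le_mul_abs_sub_one hA.le hB.le hk hK k1 hx').trans ?_
        refine mul_le_mul_of_nonneg_left ?_ hK0
        rw [abs_le]; constructor <;> linarith [hx'.1, hx'.2])
    refine this.trans ?_
    rw [show 1 + ε - (1 - ε) = 2 * ε by ring, abs_of_pos (by linarith)]
    have hKB : 0 ≤ K * (B - A) := mul_nonneg hK0 (by linarith)
    calc K * (B - A) * (2 * ε) ≤ K * (B - A) * (2 * (1 / lam)) := by gcongr
      _ = _ := by ring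
  refine (norm_add_le _ _).trans ((add_le_add b1 ((norm_add_le _ _).trans
    (add_le_add b2 b3))).trans (le_of_eq ?_))
  ring

end vanishing

/-- **Stationary phase** for the phase `σ s²`, `s x = (x - 1) ρ x`, with an error term that depends
on the amplitude only through the size of its first two derivatives. -/
theorem exists_stationary_phase {A B : ℝ} (hA : A < 1) (hB : 1 < B)
    {s s1 s2 s3 ρ ρ1 : ℝ → ℝ} (hs : ∀ x ∈ Icc A B, HasDerivAt s (s1 x) x)
    (hs1 : ∀ x ∈ Icc A B, HasDerivAt s1 (s2 x) x) (hs2 : ∀ x ∈ Icc A B, HasDerivAt s2 (s3 x) x)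
    (hs3 : ContinuousOn s3 (Icc A B)) (hρ : ∀ x ∈ Icc A B, HasDerivAt ρ (ρ1 x) x)
    (hρ1 : ContinuousOn ρ1 (Icc A B)) (hρ0 : ∀ x ∈ Icc A B, 0 < ρ x)
    (hs0 : ∀ x ∈ Icc A B, 0 < s1 x) (hsρ : ∀ x, s x = (x - 1) * ρ x)
    {σ : ℝ} (hσ : σ = 1 ∨ σ = -1) :
    ∃ κ : ℂ, ∃ C : ℝ, 0 < C ∧ ∀ (lam K : ℝ) (W W' W'' : ℝ → ℝ), 0 < lam →
      (∀ x ∈ Icc A B, HasDerivAt W (W' x) x) → (∀ x ∈ Icc A B, HasDerivAt W' (W'' x) x) →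
      (∀ x ∈ Icc A B, |W x| ≤ K) →
      (∀ x ∈ Icc A B, |W' x| ≤ K) → (∀ x ∈ Icc A B, |W'' x| ≤ K) →
      ‖(∫ x in A..B, (W x : ℂ) * expTwoPiI (lam * (σ * s x ^ 2))) -
        κ * W 1 * ((lam ^ (-(1 / 2) : ℝ) : ℝ) : ℂ)‖ ≤ C * K / lam := by
  have h1I : (1 : ℝ) ∈ Icc A B := ⟨hA.le, hB.le⟩
  have hσa : |σ| = 1 := by rcases hσ with rfl | rfl <;> norm_num
  have cont : ∀ {f f' : ℝ → ℝ}, (∀ x ∈ Icc A B, HasDerivAt f (f' x) x) →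
      ContinuousOn f (Icc A B) := fun h x hx ↦ (h x hx).continuousAt.continuousWithinAt
  have bdd : ∀ {f : ℝ → ℝ}, ContinuousOn f (Icc A B) →
      ∃ C : ℝ, 0 ≤ C ∧ ∀ x ∈ Icc A B, |f x| ≤ C := by
    intro f hf
    obtain ⟨C, hC⟩ := isCompact_Icc.exists_bound_of_continuousOn hf
    exact ⟨C, (norm_nonneg _).trans (hC 1 h1I), hC⟩
  obtain ⟨κ, hκ⟩ := exists_fresnel_scaled hσ
  -- the phase is `h = σ s²`, with `h' = (x - 1) h1`
  set h1 : ℝ → ℝ := fun x ↦ 2 * σ * (ρ x * s1 x) with hh1def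
  set h1' : ℝ → ℝ := fun x ↦ 2 * σ * (ρ1 x * s1 x + ρ x * s2 x) with hh1'def
  have hh : ∀ x ∈ Icc A B, HasDerivAt (fun x ↦ σ * s x ^ 2) ((x - 1) * h1 x) x := by
    intro x hx
    have := ((hs x hx).pow 2).const_mul σ
    convert! this using 1
    simp only [hh1def, hsρ x]; push_cast; ring
  have hh1 : ∀ x ∈ Icc A B, HasDerivAt h1 (h1' x) x := fun x hx ↦
    ((hρ x hx).mul (hs1 x hx)).const_mul _
  have hh1' : ContinuousOn h1' (Icc A B) :=
    continuousOn_const.mul ((hρ1.mul (cont hs1)).add ((cont hρ).mul (cont hs2)))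
  obtain ⟨D, hD0, hD⟩ := bdd hh1'
  obtain ⟨x0, hx0, hmin⟩ := isCompact_Icc.exists_isMinOn ⟨1, h1I⟩ ((cont hρ).mul (cont hs1))
  set c : ℝ := 2 * (ρ x0 * s1 x0) with hcdef
  have hc : 0 < c := by have := hρ0 x0 hx0; have := hs0 x0 hx0; positivity
  have hc1 : ∀ x ∈ Icc A B, c ≤ |h1 x| := by
    intro x hx
    have h2 : ρ x0 * s1 x0 ≤ ρ x * s1 x := hmin hx
    have h3 : 0 < ρ x * s1 x := mul_pos (hρ0 x hx) (hs0 x hx)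
    rw [hh1def, abs_mul, abs_mul, hσa, abs_of_pos h3, hcdef]
    norm_num; exact h2
  obtain ⟨D2, hD20, hD2⟩ := bdd (cont hs2)
  obtain ⟨D3, hD30, hD3⟩ := bdd hs3
  set d := s1 1 with hd
  have hd0 : 0 < d := hs0 1 h1I
  set E : ℝ := 1 + D2 / d + D3 / d with hE
  have hE0 : 0 < E := by positivity
  have hsA : 0 < -s A := by
    rw [hsρ A]; have := hρ0 A ⟨le_rfl, (hA.trans hB).le⟩; nlinarith
  have hsB : 0 < s B := by
    rw [hsρ B]; have := hρ0 B ⟨(hA.trans hB).le, le_rfl⟩; nlinarith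
  set C1 : ℝ := 2 * (2 * (E / c) + (B - A) * (E / c + E * D / c ^ 2)) + 2 * (E * (B - A)) with hC1
  have hBA : 0 < B - A := by linarith
  refine ⟨κ / d, (1 / (-s A) + 1 / s B) / d + C1, by positivity,
    fun lam K W W' W'' hl hW hW' hW0 hW1 hW2 ↦ ?_⟩
  have hK0 : 0 ≤ K := (abs_nonneg _).trans (hW0 1 h1I)
  -- subtracting a multiple of `s'` makes the amplitude vanish at the stationary point, and the
  -- subtracted part turns into a Fresnel integral under the substitution `u = s x`
  set k : ℝ → ℝ := fun x ↦ W x - W 1 / d * s1 x with hkdef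
  have hWd : |W 1 / d| ≤ K / d := by
    rw [abs_div, abs_of_pos hd0]; exact div_le_div_of_nonneg_right (hW0 1 h1I) hd0.le
  have hk : ∀ x ∈ Icc A B, HasDerivAt k (W' x - W 1 / d * s2 x) x := fun x hx ↦
    (hW x hx).sub ((hs1 x hx).const_mul _)
  have hk' : ∀ x ∈ Icc A B, HasDerivAt (fun x ↦ W' x - W 1 / d * s2 x)
      (W'' x - W 1 / d * s3 x) x := fun x hx ↦ (hW' x hx).sub ((hs2 x hx).const_mul _)
  have hKk : ∀ x ∈ Icc A B, |W' x - W 1 / d * s2 x| ≤ K * E := by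
    intro x hx
    refine (abs_sub _ _).trans ?_
    rw [abs_mul]
    have := mul_le_mul hWd (hD2 x hx) (abs_nonneg _) (by positivity)
    have := hW1 x hx
    have : 0 ≤ K * (D3 / d) := by positivity
    rw [hE]
    calc _ ≤ K + K / d * D2 := by linarith
      _ ≤ _ := by ring_nf; ring_nf at this; linarith
  have hKk' : ∀ x ∈ Icc A B, |W'' x - W 1 / d * s3 x| ≤ K * E := by
    intro x hx
    refine (abs_sub _ _).trans ?_
    rw [abs_mul]
    have := mul_le_mul hWd (hD3 x hx) (abs_nonneg _) (by positivity)
    have := hW2 x hx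
    have : 0 ≤ K * (D2 / d) := by positivity
    rw [hE]
    calc _ ≤ K + K / d * D3 := by linarith
      _ ≤ _ := by ring_nf; ring_nf at this; linarith
  have k1 : k 1 = 0 := by simp only [hkdef, ← hd]; field_simp; ring
  have v1 := norm_integral_vanishing_le hA hB hc hh hh1 hh1' hc1 hD hk hk' hKk hKk' k1 hl
  have hIcc : uIcc A B = Icc A B := uIcc_of_le (hA.trans hB).le
  have hec : ContinuousOn (fun x ↦ expTwoPiI (lam * (σ * s x ^ 2))) (uIcc A B) := by
    rw [hIcc]
    exact continuous_expTwoPiI.comp_continuousOn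
      (continuousOn_const.mul (continuousOn_const.mul ((cont hs).pow 2)))
  have sub : ∫ x in A..B, (s1 x : ℂ) * expTwoPiI (lam * (σ * s x ^ 2)) =
      ∫ u in (-(-s A))..(s B), expTwoPiI (lam * (σ * u ^ 2)) := by
    rw [neg_neg]
    have := intervalIntegral.integral_deriv_smul_comp (a := A) (b := B) (f := s) (f' := s1)
      (g := fun u ↦ expTwoPiI (lam * (σ * u ^ 2))) (fun x hx ↦ hs x (hIcc ▸ hx))
      (hIcc ▸ cont hs1) (by fun_prop)
    rw [← this]
    congr 1
  have split : ∫ x in A..B, (W x : ℂ) * expTwoPiI (lam * (σ * s x ^ 2)) =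
      (W 1 / d : ℝ) * (∫ u in (-(-s A))..(s B), expTwoPiI (lam * (σ * u ^ 2))) +
        ∫ x in A..B, (k x : ℂ) * expTwoPiI (lam * (σ * s x ^ 2)) := by
    rw [← sub, ← intervalIntegral.integral_const_mul, ← intervalIntegral.integral_add]
    · congr 1; ext x; simp only [hkdef]; push_cast; ring
    · exact (continuousOn_const.mul ((Complex.continuous_ofReal.comp_continuousOn
        (hIcc ▸ cont hs1)).mul hec)).intervalIntegrable
    · exact ((Complex.continuous_ofReal.comp_continuousOn (hIcc ▸ cont hk)).mul
        hec).intervalIntegrable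
  have f1 := hκ (-s A) (s B) lam hsA hsB hl
  rw [split]
  have alg : ∀ I J L : ℂ, ((W 1 / d : ℝ) : ℂ) * I + J - κ / d * W 1 * L =
      ((W 1 / d : ℝ) : ℂ) * (I - κ * L) + J := by
    intro I J L; push_cast; ring
  rw [alg]
  refine (norm_add_le _ _).trans ?_
  rw [norm_mul, Complex.norm_real, Real.norm_eq_abs]
  refine (add_le_add (mul_le_mul hWd f1 (norm_nonneg _) (by positivity)) v1).trans (le_of_eq ?_)
  rw [hC1]
  ring

/-- The phase `v ^ α - α v + α - 1`, normalised so that it vanishes to second order at its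
stationary point `1`. -/
noncomputable def powPhase (α v : ℝ) : ℝ := v ^ α - α * v + α - 1

theorem hasDerivAt_powPhase (α : ℝ) {v : ℝ} (hv : 0 < v) :
    HasDerivAt (powPhase α) (α * (v ^ (α - 1) - 1)) v := by
  have h1 := Real.hasDerivAt_rpow_const (x := v) (p := α) (Or.inl hv.ne')
  have h2 := ((h1.sub ((hasDerivAt_id v).const_mul α)).add_const α).sub_const 1
  unfold powPhase
  convert! h2 using 1
  ring

theorem analyticAt_powPhase (α : ℝ) {v : ℝ} (hv : 0 < v) : AnalyticAt ℝ (powPhase α) v := by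
  have h1 : AnalyticAt ℝ (fun v : ℝ ↦ v ^ α) v :=
    (Real.contDiffAt_rpow_const_of_ne (n := ⊤) hv.ne').analyticAt
  unfold powPhase
  exact ((h1.sub (analyticAt_const.mul analyticAt_id)).add analyticAt_const).sub analyticAt_const

@[simp] theorem powPhase_one (α : ℝ) : powPhase α 1 = 0 := by simp [powPhase]

/-- Up to the sign `σ` of `α (α - 1)`, the phase decreases to the left of `1` and increases to the
right of `1`. -/
theorem mul_powPhase_deriv_pos {α σ : ℝ} (hσ : 0 < σ * (α * (α - 1))) {v : ℝ} (hv : 0 < v)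
    (h1 : v ≠ 1) : 0 < σ * (α * (v ^ (α - 1) - 1)) * (v - 1) := by
  have key : 0 < (α - 1) * ((v ^ (α - 1) - 1) * (v - 1)) := by
    rcases lt_trichotomy (α - 1) 0 with ha | ha | ha
    · rcases lt_or_gt_of_ne h1 with hv1 | hv1
      · have := Real.one_lt_rpow_of_pos_of_lt_one_of_neg hv hv1 ha
        nlinarith [mul_pos (sub_pos.2 this) (sub_pos.2 hv1)]
      · have := Real.rpow_lt_one_of_one_lt_of_neg hv1 ha
        nlinarith [mul_pos (sub_pos.2 this) (sub_pos.2 hv1)]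
    · rw [ha] at hσ; simp at hσ
    · rcases lt_or_gt_of_ne h1 with hv1 | hv1
      · have := Real.rpow_lt_one hv.le hv1 ha
        nlinarith [mul_pos (sub_pos.2 this) (sub_pos.2 hv1)]
      · have := Real.one_lt_rpow hv1 ha
        nlinarith [mul_pos (sub_pos.2 this) (sub_pos.2 hv1)]
  have ha2 : 0 < (α - 1) ^ 2 := by
    have : α - 1 ≠ 0 := by rintro h; rw [h] at hσ; simp at hσ
    positivity
  have : 0 < (α - 1) ^ 2 * (σ * (α * (v ^ (α - 1) - 1)) * (v - 1)) := by
    have := mul_pos hσ key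
    linarith
  exact pos_of_mul_pos_right this ha2.le

theorem mul_powPhase_pos {α σ : ℝ} (hσ : 0 < σ * (α * (α - 1))) {v : ℝ} (hv : 0 < v)
    (h1 : v ≠ 1) : 0 < σ * powPhase α v := by
  have hd : ∀ x, 0 < x → HasDerivAt (powPhase α) (α * (x ^ (α - 1) - 1)) x :=
    fun x hx ↦ hasDerivAt_powPhase α hx
  rcases lt_or_gt_of_ne h1 with hv1 | hv1
  · obtain ⟨ξ, hξ, h⟩ := exists_hasDerivAt_eq_slope (powPhase α) _ hv1
      (fun x hx ↦ (hd x (hv.trans_le hx.1)).continuousAt.continuousWithinAt)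
      (fun x hx ↦ hd x (hv.trans hx.1))
    have := mul_powPhase_deriv_pos hσ (hv.trans hξ.1) hξ.2.ne
    have hξ1 : ξ - 1 < 0 := by linarith [hξ.2]
    rw [h, powPhase_one, zero_sub] at this
    have h3 : 0 < 1 - v := by linarith
    have h4 : σ * (-powPhase α v / (1 - v)) < 0 := by nlinarith
    rw [mul_div_assoc', div_lt_iff₀ h3] at h4
    linarith
  · obtain ⟨ξ, hξ, h⟩ := exists_hasDerivAt_eq_slope (powPhase α) _ hv1
      (fun x hx ↦ (hd x (one_pos.trans_le hx.1)).continuousAt.continuousWithinAt)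
      (fun x hx ↦ hd x (one_pos.trans hx.1))
    have := mul_powPhase_deriv_pos hσ (one_pos.trans hξ.1) hξ.1.ne'
    have hξ1 : 0 < ξ - 1 := by linarith [hξ.1]
    rw [h, powPhase_one, sub_zero] at this
    have h3 : 0 < v - 1 := by linarith
    have h4 : 0 < σ * (powPhase α v / (v - 1)) := by
      by_contra hcon; push Not at hcon; nlinarith
    rw [mul_div_assoc', lt_div_iff₀ h3] at h4
    linarith

/-- The quotient of the phase by `(v - 1)²`, as a smooth function. -/
noncomputable def powPhaseQuot (α : ℝ) : ℝ → ℝ := dslope (dslope (powPhase α) 1) 1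

theorem deriv_powPhase_one (α : ℝ) : deriv (powPhase α) 1 = 0 := by
  simpa using (hasDerivAt_powPhase α one_pos).deriv

theorem powPhase_eq (α v : ℝ) : powPhase α v = (v - 1) ^ 2 * powPhaseQuot α v := by
  have h1 := sub_smul_dslope (powPhase α) 1 v
  have h2 := sub_smul_dslope (dslope (powPhase α) 1) 1 v
  rw [dslope_same, deriv_powPhase_one, sub_zero] at h2
  rw [powPhase_one, sub_zero] at h1
  simp only [smul_eq_mul] at h1 h2
  rw [← h1, ← h2, powPhaseQuot]; ring

theorem powPhaseQuot_one (α : ℝ) : powPhaseQuot α 1 = α * (α - 1) / 2 := by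
  have hp := (analyticAt_powPhase α one_pos).hasFPowerSeriesAt
  have h2 := (hp.has_fpower_series_dslope_fslope).has_fpower_series_dslope_fslope
  have h3 := h2.coeff_zero 1
  have h4 := FormalMultilinearSeries.coeff_iterate_fslope (p := FormalMultilinearSeries.ofScalars ℝ
    fun n ↦ iteratedDeriv n (powPhase α) 1 / n.factorial) 2 0
  have h5 : deriv (deriv (powPhase α)) 1 = α * (α - 1) := by
    have : deriv (powPhase α) =ᶠ[nhds 1] fun v ↦ α * (v ^ (α - 1) - 1) := by
      filter_upwards [lt_mem_nhds (one_pos : (0 : ℝ) < 1)] with v hv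
      exact (hasDerivAt_powPhase α hv).deriv
    rw [this.deriv_eq]
    have := ((Real.hasDerivAt_rpow_const (x := 1) (p := α - 1) (Or.inl one_ne_zero)).sub_const
      1).const_mul α
    simp [this.deriv]
  have h6 : (FormalMultilinearSeries.fslope^[2] (FormalMultilinearSeries.ofScalars ℝ
    fun n ↦ iteratedDeriv n (powPhase α) 1 / n.factorial)).coeff 0 = powPhaseQuot α 1 := h3
  rw [← h6, h4, FormalMultilinearSeries.coeff_ofScalars]
  simp [iteratedDeriv_succ, h5]

theorem contDiffAt_powPhaseQuot (α : ℝ) {v : ℝ} (hv : 0 < v) :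
    ContDiffAt ℝ 3 (powPhaseQuot α) v := by
  rcases eq_or_ne v 1 with rfl | h1
  · have hp := (analyticAt_powPhase α one_pos).hasFPowerSeriesAt
    exact (hp.has_fpower_series_dslope_fslope).has_fpower_series_dslope_fslope.analyticAt.contDiffAt
  · have hp : ContDiffAt ℝ 3 (fun v ↦ powPhase α v / (v - 1) ^ 2) v := by
      refine (analyticAt_powPhase α hv).contDiffAt.div (by fun_prop) ?_
      exact pow_ne_zero 2 (sub_ne_zero.2 h1)
    refine hp.congr_of_eventuallyEq ?_
    filter_upwards [isOpen_ne.mem_nhds h1] with x hx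
    have : x - 1 ≠ 0 := sub_ne_zero.2 hx
    rw [powPhase_eq]; field_simp

/-- Stationary phase for the phase `lam (v ^ α - α v + α - 1)` on `[1/10, 10]`. -/
theorem exists_stationary_phase_rpow {α : ℝ} (hα0 : α ≠ 0) (hα1 : α ≠ 1) :
    ∃ κ : ℂ, ∃ C : ℝ, 0 < C ∧ ∀ (lam K : ℝ) (W W' W'' : ℝ → ℝ), 0 < lam →
      (∀ x ∈ Icc (1 / 10 : ℝ) 10, HasDerivAt W (W' x) x) →
      (∀ x ∈ Icc (1 / 10 : ℝ) 10, HasDerivAt W' (W'' x) x) →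
      (∀ x ∈ Icc (1 / 10 : ℝ) 10, |W x| ≤ K) →
      (∀ x ∈ Icc (1 / 10 : ℝ) 10, |W' x| ≤ K) → (∀ x ∈ Icc (1 / 10 : ℝ) 10, |W'' x| ≤ K) →
      ‖(∫ x in (1 / 10 : ℝ)..10, (W x : ℂ) * expTwoPiI (lam * powPhase α x)) -
        κ * W 1 * ((lam ^ (-(1 / 2) : ℝ) : ℝ) : ℂ)‖ ≤ C * K / lam := by
  obtain ⟨σ, hσ, hσα⟩ : ∃ σ : ℝ, (σ = 1 ∨ σ = -1) ∧ 0 < σ * (α * (α - 1)) := by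
    have : α * (α - 1) ≠ 0 := mul_ne_zero hα0 (sub_ne_zero.2 hα1)
    rcases lt_or_gt_of_ne this with h | h
    · exact ⟨-1, Or.inr rfl, by linarith⟩
    · exact ⟨1, Or.inl rfl, by linarith⟩
  have hσ2 : σ * σ = 1 := by rcases hσ with rfl | rfl <;> norm_num
  have hQ : ∀ v, 0 < v → 0 < σ * powPhaseQuot α v := by
    intro v hv
    rcases eq_or_ne v 1 with rfl | h1
    · rw [powPhaseQuot_one]; linarith
    · have h2 := mul_powPhase_pos hσα hv h1
      rw [powPhase_eq] at h2
      have h3 : 0 < (v - 1) ^ 2 := by have := sub_ne_zero.2 h1; positivity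
      have h4 : 0 < (v - 1) ^ 2 * (σ * powPhaseQuot α v) := by linarith
      exact pos_of_mul_pos_right h4 h3.le
  -- `s` is a smooth signed square root of `σ * powPhase α`
  set ρ : ℝ → ℝ := fun v ↦ Real.sqrt (σ * powPhaseQuot α v) with hρ
  set s : ℝ → ℝ := fun v ↦ (v - 1) * ρ v with hs
  have hρ0 : ∀ v, 0 < v → 0 < ρ v := fun v hv ↦ Real.sqrt_pos.2 (hQ v hv)
  have hρc : ContDiffOn ℝ 3 ρ (Ioi 0) := fun v hv ↦
    ((contDiffAt_const.mul (contDiffAt_powPhaseQuot α hv)).sqrt (hQ v hv).ne').contDiffWithinAt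
  have hsc : ContDiffOn ℝ 3 s (Ioi 0) := ContDiffOn.mul (by fun_prop) hρc
  have hs2 : ∀ v, 0 < v → σ * s v ^ 2 = powPhase α v := by
    intro v hv
    simp only [hs, hρ]
    rw [mul_pow, Real.sq_sqrt (hQ v hv).le, powPhase_eq]
    linear_combination (v - 1) ^ 2 * powPhaseQuot α v * hσ2
  have hsc1 : ContDiffOn ℝ 2 (deriv s) (Ioi 0) := hsc.deriv_of_isOpen isOpen_Ioi (by norm_num)
  have hsc2 : ContDiffOn ℝ 1 (deriv (deriv s)) (Ioi 0) :=
    hsc1.deriv_of_isOpen isOpen_Ioi (by norm_num)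
  have hsc3 : ContinuousOn (deriv (deriv (deriv s))) (Ioi 0) :=
    hsc2.continuousOn_deriv_of_isOpen isOpen_Ioi le_rfl
  have hρ1 : ContinuousOn (deriv ρ) (Ioi 0) :=
    hρc.continuousOn_deriv_of_isOpen isOpen_Ioi (by norm_num)
  have dd : ∀ {f : ℝ → ℝ} {n : WithTop ℕ∞}, ContDiffOn ℝ n f (Ioi 0) → n ≠ 0 →
      ∀ v, 0 < v → HasDerivAt f (deriv f v) v := fun hf hn v hv ↦
    ((hf.contDiffAt (Ioi_mem_nhds hv)).differentiableAt hn).hasDerivAt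
  have hs0 : ∀ v, 0 < v → 0 < deriv s v := by
    intro v hv
    rcases eq_or_ne v 1 with rfl | h1
    · have := (((hasDerivAt_id (1 : ℝ)).sub_const 1).mul (dd hρc (by norm_num) 1 one_pos)).deriv
      have e' : deriv ((fun x ↦ x - 1) * ρ) 1 = ρ 1 := by simpa using this
      have e : deriv s 1 = ρ 1 := e'
      rw [e]; exact hρ0 1 one_pos
    · have d1 := ((dd hsc (by norm_num) v hv).pow 2).const_mul σ
      have d2 := hasDerivAt_powPhase α hv
      have e : (fun v ↦ σ * s v ^ 2) =ᶠ[nhds v] powPhase α := by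
        filter_upwards [Ioi_mem_nhds hv] with x hx using hs2 x hx
      have e2 := (e.hasDerivAt_iff.2 d2).unique d1
      have h3 := mul_powPhase_deriv_pos hσα hv h1
      rw [e2] at h3
      have h4 : 0 < (v - 1) ^ 2 := by have := sub_ne_zero.2 h1; positivity
      have h5 : 0 < 2 * (ρ v * (v - 1) ^ 2) * deriv s v := by
        refine h3.trans_le (le_of_eq ?_)
        simp only [hs]
        push_cast
        linear_combination (2 * (ρ v * (v - 1) ^ 2) * deriv (fun v ↦ (v - 1) * ρ v) v) * hσ2
      exact pos_of_mul_pos_right h5 (by have := hρ0 v hv; positivity)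
  have hI : ∀ x ∈ Icc (1 / 10 : ℝ) 10, 0 < x := fun x hx ↦ by linarith [hx.1]
  have hIs : Icc (1 / 10 : ℝ) 10 ⊆ Ioi 0 := hI
  obtain ⟨κ, C, hC, H⟩ := exists_stationary_phase (A := 1 / 10) (B := 10) (by norm_num)
    (by norm_num)
    (s := s) (ρ := ρ) (fun x hx ↦ dd hsc (by norm_num) x (hI x hx))
    (fun x hx ↦ dd hsc1 (by norm_num) x (hI x hx)) (fun x hx ↦ dd hsc2 (by norm_num) x (hI x hx))
    (hsc3.mono hIs) (fun x hx ↦ dd hρc (by norm_num) x (hI x hx)) (hρ1.mono hIs)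
    (fun x hx ↦ hρ0 x (hI x hx)) (fun x hx ↦ hs0 x (hI x hx)) (fun x ↦ rfl) hσ
  refine ⟨κ, C, hC, fun lam K W W' W'' hl h1 h2 h3 h4 h5 ↦ ?_⟩
  convert! H lam K W W' W'' hl h1 h2 h3 h4 h5 using 3
  refine intervalIntegral.integral_congr fun x hx ↦ ?_
  rw [uIcc_of_le (by norm_num)] at hx
  rw [hs2 x (hI x hx)]

/-- A second derivative bound from two integrations by parts, for a phase without stationary
points whose derivative `g` is at least `c Z` in absolute value. -/
theorem norm_integral_nonstationary_le {a b : ℝ} (hab : a ≤ b) {w w' w'' h g g' g'' : ℝ → ℝ}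
    {K G c Z : ℝ} (hc : 0 < c) (hZ : 1 ≤ Z)
    (hw : ∀ x ∈ Icc a b, HasDerivAt w (w' x) x) (hw' : ∀ x ∈ Icc a b, HasDerivAt w' (w'' x) x)
    (hw'' : ContinuousOn w'' (Icc a b)) (hwa : w a = 0) (hwb : w b = 0)
    (hK0 : ∀ x ∈ Icc a b, |w x| ≤ K) (hK1 : ∀ x ∈ Icc a b, |w' x| ≤ K)
    (hK2 : ∀ x ∈ Icc a b, |w'' x| ≤ K)
    (hh : ∀ x ∈ Icc a b, HasDerivAt h (g x) x) (hg : ∀ x ∈ Icc a b, HasDerivAt g (g' x) x)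
    (hg' : ∀ x ∈ Icc a b, HasDerivAt g' (g'' x) x) (hg'' : ContinuousOn g'' (Icc a b))
    (hG1 : ∀ x ∈ Icc a b, |g' x| ≤ G) (hG2 : ∀ x ∈ Icc a b, |g'' x| ≤ G)
    (hgc : ∀ x ∈ Icc a b, c * Z ≤ |g x|) {lam : ℝ} (hl : 0 < lam) :
    ‖∫ x in a..b, (w x : ℂ) * expTwoPiI (lam * h x)‖ ≤
      (2 * (K / c ^ 2 + K * G / c ^ 3) +
        (b - a) * (K / c ^ 2 + 4 * (K * G / c ^ 3) + 3 * (K * G * G / c ^ 4))) /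
          (lam ^ 2 * Z ^ 2) := by
  have haI : a ∈ Icc a b := ⟨le_rfl, hab⟩
  have hbI : b ∈ Icc a b := ⟨hab, le_rfl⟩
  have hZ0 : 0 < Z := by linarith
  have hKn : 0 ≤ K := (abs_nonneg _).trans (hK0 a haI)
  have hGn : 0 ≤ G := (abs_nonneg _).trans (hG1 a haI)
  have hg0 : ∀ x ∈ Icc a b, g x ≠ 0 := fun x hx h0 ↦ by
    have := hgc x hx; rw [h0, abs_zero] at this; have := mul_pos hc hZ0; linarith
  have cont : ∀ {f f' : ℝ → ℝ}, (∀ x ∈ Icc a b, HasDerivAt f (f' x) x) →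
      ContinuousOn f (Icc a b) := fun h x hx ↦ (h x hx).continuousAt.continuousWithinAt
  have hIcc : uIcc a b = Icc a b := uIcc_of_le hab
  set u' : ℝ → ℝ := fun x ↦ (w' x * g x - w x * g' x) / g x ^ 2 with hu'
  set f : ℝ → ℝ := fun x ↦ (w' x * g x - w x * g' x) / g x ^ 3 with hf
  set f' : ℝ → ℝ := fun x ↦ (w'' x * g x - w x * g'' x) / g x ^ 3 -
    3 * (w' x * g x - w x * g' x) * g' x / g x ^ 4 with hf'
  have hud : ∀ x ∈ Icc a b, HasDerivAt (fun x ↦ w x / g x) (u' x) x := fun x hx ↦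
    (hw x hx).div (hg x hx) (hg0 x hx)
  have hfd : ∀ x ∈ Icc a b, HasDerivAt f (f' x) x := by
    intro x hx
    have := (((hw' x hx).mul (hg x hx)).sub ((hw x hx).mul (hg' x hx))).div ((hg x hx).pow 3)
      (pow_ne_zero 3 (hg0 x hx))
    convert! this using 1
    have := hg0 x hx
    simp only [hf', Pi.pow_apply, Pi.sub_apply, Pi.mul_apply]
    field_simp
    push_cast
    ring
  have hu'c : ContinuousOn u' (Icc a b) :=
    (((cont hw').mul (cont hg)).sub ((cont hw).mul (cont hg'))).div ((cont hg).pow 2)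
      fun x hx ↦ pow_ne_zero 2 (hg0 x hx)
  have hf'c : ContinuousOn f' (Icc a b) := by
    refine ContinuousOn.sub (ContinuousOn.div ?_ ((cont hg).pow 3)
      fun x hx ↦ pow_ne_zero 3 (hg0 x hx)) (ContinuousOn.div ?_ ((cont hg).pow 4)
      fun x hx ↦ pow_ne_zero 4 (hg0 x hx))
    · exact (hw''.mul (cont hg)).sub ((cont hw).mul hg'')
    · exact (continuousOn_const.mul
        (((cont hw').mul (cont hg)).sub ((cont hw).mul (cont hg')))).mul (cont hg')
  -- the four shapes of terms that occur
  have hcz : ∀ x ∈ Icc a b, ∀ n : ℕ, 2 ≤ n → ∀ A : ℝ, 0 ≤ A →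
      A / |g x| ^ n ≤ A / c ^ n / Z ^ 2 := by
    intro x hx n hn A hA
    rw [div_div]
    refine div_le_div_of_nonneg_left hA (by positivity) ?_
    calc c ^ n * Z ^ 2 ≤ c ^ n * Z ^ n := by gcongr
      _ = (c * Z) ^ n := by ring
      _ ≤ _ := by gcongr; exact hgc x hx
  have hnum : ∀ x ∈ Icc a b, |w' x * g x - w x * g' x| ≤ K * |g x| + K * G := by
    intro x hx
    refine (abs_sub _ _).trans ?_
    rw [abs_mul, abs_mul]
    exact add_le_add (mul_le_mul_of_nonneg_right (hK1 x hx) (abs_nonneg _))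
      (mul_le_mul (hK0 x hx) (hG1 x hx) (abs_nonneg _) hKn)
  have hnum2 : ∀ x ∈ Icc a b, |w'' x * g x - w x * g'' x| ≤ K * |g x| + K * G := by
    intro x hx
    refine (abs_sub _ _).trans ?_
    rw [abs_mul, abs_mul]
    exact add_le_add (mul_le_mul_of_nonneg_right (hK2 x hx) (abs_nonneg _))
      (mul_le_mul (hK0 x hx) (hG2 x hx) (abs_nonneg _) hKn)
  have habs : ∀ x ∈ Icc a b, 0 < |g x| := fun x hx ↦ abs_pos.2 (hg0 x hx)
  have hfb : ∀ x ∈ Icc a b, |f x| ≤ (K / c ^ 2 + K * G / c ^ 3) / Z ^ 2 := by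
    intro x hx
    rw [hf, abs_div, abs_pow]
    have h3 := habs x hx
    calc _ ≤ (K * |g x| + K * G) / |g x| ^ 3 := by gcongr; exact hnum x hx
      _ = K / |g x| ^ 2 + K * G / |g x| ^ 3 := by field_simp
      _ ≤ K / c ^ 2 / Z ^ 2 + K * G / c ^ 3 / Z ^ 2 :=
        add_le_add (hcz x hx 2 le_rfl _ hKn) (hcz x hx 3 (by norm_num) _ (by positivity))
      _ = _ := by ring
  have hfb' : ∀ x ∈ Icc a b, |f' x| ≤
      (K / c ^ 2 + 4 * (K * G / c ^ 3) + 3 * (K * G * G / c ^ 4)) / Z ^ 2 := by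
    intro x hx
    rw [hf']
    refine (abs_sub _ _).trans ?_
    rw [abs_div, abs_pow, abs_div, abs_pow, abs_mul, abs_mul, abs_of_pos (by norm_num : (0:ℝ) < 3)]
    have h3 := habs x hx
    calc _ ≤ (K * |g x| + K * G) / |g x| ^ 3 + 3 * (K * |g x| + K * G) * G / |g x| ^ 4 := by
          gcongr
          · exact hnum2 x hx
          · exact hnum x hx
          · exact hG1 x hx
      _ = K / |g x| ^ 2 + 4 * (K * G / |g x| ^ 3) + 3 * (K * G * G / |g x| ^ 4) := by
          field_simp; ring
      _ ≤ K / c ^ 2 / Z ^ 2 + 4 * (K * G / c ^ 3 / Z ^ 2) + 3 * (K * G * G / c ^ 4 / Z ^ 2) := by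
        have i1 := hcz x hx 2 le_rfl K hKn
        have i2 := hcz x hx 3 (by norm_num) (K * G) (by positivity)
        have i3 := hcz x hx 4 (by norm_num) (K * G * G) (by positivity)
        linarith
      _ = _ := by ring
  -- first integration by parts
  set d : ℂ := 2 * Real.pi * Complex.I * lam with hd
  have hd0 : d ≠ 0 := by simp [hd, hl.ne', Real.pi_ne_zero]
  have hdn : ‖d‖ = 2 * Real.pi * lam := by
    simp [hd, abs_of_pos hl, abs_of_pos Real.pi_pos]
  have hec : ContinuousOn (fun x ↦ expTwoPiI (lam * h x)) (uIcc a b) :=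
    continuous_expTwoPiI.comp_continuousOn (continuousOn_const.mul (hIcc ▸ cont hh))
  have hv : ∀ x ∈ uIcc a b, HasDerivAt (fun x ↦ d⁻¹ * expTwoPiI (lam * h x))
      ((g x : ℂ) * expTwoPiI (lam * h x)) x := by
    intro x hx
    have := (hasDerivAt_expTwoPiI_comp ((hh x (hIcc ▸ hx)).const_mul lam)).const_mul d⁻¹
    convert! this using 1
    push_cast
    have : d⁻¹ * (2 * Real.pi * Complex.I * (lam * g x) * expTwoPiI (lam * h x)) =
      (d⁻¹ * d) * (g x * expTwoPiI (lam * h x)) := by rw [hd]; ring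
    rw [this, inv_mul_cancel₀ hd0, one_mul]
  have key := intervalIntegral.integral_mul_deriv_eq_deriv_mul (a := a) (b := b)
    (u := fun x ↦ ((w x / g x : ℝ) : ℂ)) (u' := fun x ↦ (u' x : ℂ))
    (v := fun x ↦ d⁻¹ * expTwoPiI (lam * h x))
    (v' := fun x ↦ (g x : ℂ) * expTwoPiI (lam * h x))
    (fun x hx ↦ (hud x (hIcc ▸ hx)).ofReal_comp) hv
    (Complex.continuous_ofReal.comp_continuousOn (hIcc ▸ hu'c)).intervalIntegrable
    ((Complex.continuous_ofReal.comp_continuousOn (hIcc ▸ cont hg)).mul hec).intervalIntegrable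
  have e1 : ∫ x in a..b, (w x : ℂ) * expTwoPiI (lam * h x) =
      ∫ x in a..b, ((w x / g x : ℝ) : ℂ) * ((g x : ℂ) * expTwoPiI (lam * h x)) := by
    refine intervalIntegral.integral_congr fun x hx ↦ ?_
    have : (g x : ℂ) ≠ 0 := by exact_mod_cast hg0 x (hIcc ▸ hx)
    push_cast; field_simp
  have e2 : ∫ x in a..b, (u' x : ℂ) * (d⁻¹ * expTwoPiI (lam * h x)) =
      d⁻¹ * ∫ x in a..b, ((f x * g x : ℝ) : ℂ) * expTwoPiI (lam * h x) := by
    rw [← intervalIntegral.integral_const_mul]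
    refine intervalIntegral.integral_congr fun x hx ↦ ?_
    have h1 := hg0 x (hIcc ▸ hx)
    have : f x * g x = u' x := by simp only [hf, hu']; field_simp
    simp only [this]; ring
  rw [e1, key, hwa, hwb, e2]
  simp only [zero_div, Complex.ofReal_zero, zero_mul, sub_self, zero_sub, norm_neg, norm_mul,
    norm_inv, hdn]
  have main := norm_integral_mul_deriv_expTwoPiI_le hab hfd hf'c hh (cont hg) hl
  have i1 : ∫ x in a..b, |f' x| ≤
      (b - a) * ((K / c ^ 2 + 4 * (K * G / c ^ 3) + 3 * (K * G * G / c ^ 4)) / Z ^ 2) := by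
    rw [← smul_eq_mul, ← intervalIntegral.integral_const]
    refine intervalIntegral.integral_mono_on hab ?_ (by simp) hfb'
    exact ContinuousOn.intervalIntegrable (by rw [hIcc]; exact hf'c.abs)
  have i2 := hfb a haI
  have i3 := hfb b hbI
  have hpi := Real.pi_gt_three
  have i4 : (2 * Real.pi * lam)⁻¹ ≤ 1 / lam := by
    rw [← one_div]
    apply one_div_le_one_div_of_le hl
    nlinarith
  calc _ ≤ (1 / lam) * (((K / c ^ 2 + K * G / c ^ 3) / Z ^ 2 + (K / c ^ 2 + K * G / c ^ 3) / Z ^ 2 +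
        (b - a) * ((K / c ^ 2 + 4 * (K * G / c ^ 3) + 3 * (K * G * G / c ^ 4)) / Z ^ 2)) / lam) := by
        refine mul_le_mul i4 (main.trans ?_) (norm_nonneg _) (by positivity)
        gcongr
    _ = _ := by field_simp; ring

/-! ### The dual exponential sum: one Fourier integral -/

/-- A smooth bump function that is `1` on `[1, 2]` and vanishes outside `(1/2, 5/2)`. -/
noncomputable def cutoff : ContDiffBump (3 / 2 : ℝ) := ⟨1 / 2, 1, by norm_num, by norm_num⟩

theorem cutoff_eq_one {x : ℝ} (h1 : 1 ≤ x) (h2 : x ≤ 2) : cutoff x = 1 := by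
  apply cutoff.one_of_mem_closedBall
  rw [Real.closedBall_eq_Icc]
  constructor <;> simp only [cutoff] <;> linarith

theorem cutoff_eq_zero {x : ℝ} (h : x ≤ 1 / 2 ∨ 5 / 2 ≤ x) : cutoff x = 0 := by
  apply cutoff.zero_of_le_dist
  rw [Real.dist_eq]
  simp only [cutoff]
  rcases h with h | h
  · rw [abs_of_nonpos (by linarith)]; linarith
  · rw [abs_of_nonneg (by linarith)]; linarith

theorem contDiff_cutoff {n : ℕ∞} : ContDiff ℝ n cutoff := cutoff.contDiff

theorem hasDerivAt_cutoff (x : ℝ) : HasDerivAt cutoff (deriv cutoff x) x :=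
  (contDiff_cutoff.differentiable (n := 1) (by norm_num) x).hasDerivAt

theorem contDiff_deriv_cutoff : ContDiff ℝ 1 (deriv cutoff) := by
  have : ContDiff ℝ (1 + 1) cutoff := contDiff_cutoff (n := 2)
  exact (contDiff_succ_iff_deriv.1 this).2.2

theorem hasDerivAt_deriv_cutoff (x : ℝ) :
    HasDerivAt (deriv cutoff) (deriv (deriv cutoff) x) x :=
  (contDiff_deriv_cutoff.differentiable (by norm_num) x).hasDerivAt

theorem continuous_deriv_deriv_cutoff : Continuous (deriv (deriv cutoff)) :=
  contDiff_deriv_cutoff.continuous_deriv le_rfl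

theorem exists_cutoff_bound : ∃ K : ℝ, 0 < K ∧ ∀ x, |cutoff x| ≤ K ∧ |deriv cutoff x| ≤ K ∧
    |deriv (deriv cutoff) x| ≤ K := by
  have hcs : HasCompactSupport cutoff := cutoff.hasCompactSupport
  obtain ⟨K1, h1⟩ := hcs.exists_bound_of_continuous cutoff.continuous
  obtain ⟨K2, h2⟩ := hcs.deriv.exists_bound_of_continuous contDiff_deriv_cutoff.continuous
  obtain ⟨K3, h3⟩ := hcs.deriv.deriv.exists_bound_of_continuous continuous_deriv_deriv_cutoff
  have p1 := (norm_nonneg _).trans (h1 0)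
  have p2 := (norm_nonneg _).trans (h2 0)
  have p3 := (norm_nonneg _).trans (h3 0)
  refine ⟨K1 + K2 + K3 + 1, by linarith, fun x ↦ ⟨?_, ?_, ?_⟩⟩
  · have := h1 x; rw [Real.norm_eq_abs] at this; linarith
  · have := h2 x; rw [Real.norm_eq_abs] at this; linarith
  · have := h3 x; rw [Real.norm_eq_abs] at this; linarith

/-- The Fourier integral `∫ w(x) e(t x ^ α - y x) dx` with the smooth cutoff `w`. -/
noncomputable def cutoffIntegral (α t y : ℝ) : ℂ :=
  ∫ x : ℝ, (cutoff x : ℂ) * expTwoPiI (t * x ^ α - y * x)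

theorem cutoffIntegral_eq (α t y : ℝ) {a b : ℝ} (ha : a ≤ 1 / 2) (hb : 5 / 2 ≤ b) :
    cutoffIntegral α t y = ∫ x in a..b, (cutoff x : ℂ) * expTwoPiI (t * x ^ α - y * x) := by
  rw [cutoffIntegral, intervalIntegral.integral_eq_integral_of_support_subset]
  intro x hx
  rw [Function.mem_support] at hx
  constructor
  · by_contra h
    push Not at h
    exact hx (by rw [cutoff_eq_zero (Or.inl (by linarith))]; simp)
  · by_contra h
    push Not at h
    exact hx (by rw [cutoff_eq_zero (Or.inr (by linarith))]; simp)

/-- The amplitude of the dual sum: `x₀ ^ (1 - α/2) w(x₀)` at the stationary point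
`x₀ = z ^ (1/(α-1))`; it is `0` if there is no stationary point. -/
noncomputable def dualAmp (α z : ℝ) : ℝ :=
  if 0 < z then (z ^ (1 / (α - 1))) ^ (1 - α / 2) * cutoff (z ^ (1 / (α - 1))) else 0

theorem dualAmp_of_nonstationary {α z : ℝ}
    (hz : z ≤ 0 ∨ z ^ (1 / (α - 1)) < 1 / 4 ∨ 5 < z ^ (1 / (α - 1))) : dualAmp α z = 0 := by
  unfold dualAmp
  split_ifs with h
  · rw [cutoff_eq_zero, mul_zero]
    rcases hz with hz | hz | hz
    · linarith
    · left; linarith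
    · right; linarith
  · rfl

/-- Away from the stationary range, the derivative of the phase is bounded below. -/
theorem exists_nonstationary_lower_bound {β : ℝ} (hβ : β ≠ 0) :
    ∃ c : ℝ, 0 < c ∧ ∀ z : ℝ, (z ≤ 0 ∨ z ^ (1 / β) < 1 / 4 ∨ 5 < z ^ (1 / β)) →
      ∀ x ∈ Icc (1 / 2 : ℝ) (5 / 2), c * (1 + |z|) ≤ |x ^ β - z| := by
  have hpos : ∀ x ∈ Icc (1 / 2 : ℝ) (5 / 2), 0 < x := fun x hx ↦ by linarith [hx.1]
  obtain ⟨m, hm, hmx⟩ : ∃ m : ℝ, 0 < m ∧ ∀ x ∈ Icc (1 / 2 : ℝ) (5 / 2), m ≤ x ^ β := by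
    obtain ⟨x0, hx0, hmin⟩ := isCompact_Icc.exists_isMinOn (s := Icc (1 / 2 : ℝ) (5 / 2))
      ⟨1, by norm_num, by norm_num⟩ (f := fun x : ℝ ↦ x ^ β)
      (fun x hx ↦ (Real.continuousAt_rpow_const _ _ (Or.inl (hpos x hx).ne')).continuousWithinAt)
    exact ⟨x0 ^ β, Real.rpow_pos_of_pos (hpos x0 hx0) _, fun x hx ↦ hmin hx⟩
  set q : ℝ := 2 ^ (-|β|) with hq
  have hβ0 : 0 < |β| := abs_pos.2 hβ
  have hq0 : 0 < q := Real.rpow_pos_of_pos two_pos _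
  have hq1 : q < 1 := Real.rpow_lt_one_of_one_lt_of_neg one_lt_two (by linarith)
  have hqi : (2 : ℝ) ^ |β| = q⁻¹ := by rw [hq, Real.rpow_neg two_pos.le, inv_inv]
  set c0 := 1 - q with hc0
  have hc00 : 0 < c0 := by linarith
  refine ⟨c0 / 2 * min 1 m, by positivity, fun z hz x hx ↦ ?_⟩
  have hx0 := hpos x hx
  have hxm := hmx x hx
  have hmin1 : min 1 m ≤ 1 := min_le_left _ _
  have hminm : min 1 m ≤ m := min_le_right _ _
  have hmin0 : 0 < min 1 m := by positivity
  have hstep : min 1 m * (1 + |z|) ≤ x ^ β + |z| := by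
    nlinarith [abs_nonneg z]
  have suff : c0 / 2 * (x ^ β + |z|) ≤ |x ^ β - z| := by
    rcases le_or_gt z 0 with hz0 | hz0
    · rw [abs_of_nonpos hz0, abs_of_nonneg (by linarith)]
      have : c0 / 2 ≤ 1 := by linarith
      nlinarith
    · have hz' := hz.resolve_left (not_le.2 hz0)
      set x0 := z ^ (1 / β) with hx0def
      have hx00 : 0 < x0 := Real.rpow_pos_of_pos hz0 _
      have hzx : z = x0 ^ β := by
        rw [hx0def, ← Real.rpow_mul hz0.le, one_div_mul_cancel hβ, Real.rpow_one]
      -- the ratio `x / x₀` is at least `2` or at most `1/2`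
      have hr : 2 * x0 ≤ x ∨ 2 * x ≤ x0 := by
        rcases hz' with h | h
        · left; linarith [hx.1]
        · right; linarith [hx.2]
      have two : ∀ u v : ℝ, 0 < u → 2 * u ≤ v →
          u ^ β ≤ q * v ^ β ∨ v ^ β ≤ q * u ^ β := by
        intro u v hu huv
        have hv : 0 < v := by linarith
        rcases lt_or_gt_of_ne hβ with hb | hb
        · right
          have h1 : v ^ β ≤ (2 * u) ^ β :=
            Real.rpow_le_rpow_of_nonpos (by positivity) huv hb.le
          rw [Real.mul_rpow two_pos.le hu.le] at h1
          rw [hq, abs_of_neg hb, neg_neg]; exact h1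
        · left
          have h1 : (2 * u) ^ β ≤ v ^ β := Real.rpow_le_rpow (by positivity) huv hb.le
          rw [Real.mul_rpow two_pos.le hu.le] at h1
          have h2 : (2 : ℝ) ^ β = q⁻¹ := by rw [← hqi, abs_of_pos hb]
          rw [h2, inv_mul_le_iff₀ hq0] at h1
          exact h1
      have hcase : z ≤ q * x ^ β ∨ x ^ β ≤ q * z := by
        rw [hzx]
        rcases hr with h | h
        · exact two x0 x hx00 h
        · exact (two x x0 hx0 h).symm
      have hxb : 0 < x ^ β := Real.rpow_pos_of_pos hx0 _
      rw [abs_of_pos hz0]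
      rcases hcase with h | h
      · have h5 : z ≤ x ^ β := by nlinarith
        rw [abs_of_nonneg (by linarith)]
        nlinarith
      · have h5 : x ^ β ≤ z := by nlinarith
        rw [abs_of_nonpos (by linarith)]
        nlinarith
  calc c0 / 2 * min 1 m * (1 + |z|) = c0 / 2 * (min 1 m * (1 + |z|)) := by ring
    _ ≤ c0 / 2 * (x ^ β + |z|) := by gcongr
    _ ≤ _ := suff

/-- If the stationary point is far from the support of the cutoff, the Fourier integral is small
enough to be summed over the frequencies. -/
theorem exists_bound_cutoffIntegral_nonstationary {α : ℝ} (hα0 : α ≠ 0) (hα1 : α ≠ 1) :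
    ∃ C : ℝ, 0 < C ∧ ∀ t z : ℝ, 1 ≤ t →
      (z ≤ 0 ∨ z ^ (1 / (α - 1)) < 1 / 4 ∨ 5 < z ^ (1 / (α - 1))) →
      ‖cutoffIntegral α t (α * t * z)‖ ≤ C / (t * (1 + |z|) ^ 2) := by
  obtain ⟨c, hc, hcz⟩ := exists_nonstationary_lower_bound (sub_ne_zero.2 hα1)
  obtain ⟨K, hK, hKb⟩ := exists_cutoff_bound
  have hpos : ∀ x ∈ Icc (1 / 2 : ℝ) (5 / 2), 0 < x := fun x hx ↦ by linarith [hx.1]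
  have rc : ∀ p : ℝ, ContinuousOn (fun x : ℝ ↦ x ^ p) (Icc (1 / 2 : ℝ) (5 / 2)) := fun p x hx ↦
    (Real.continuousAt_rpow_const _ _ (Or.inl (hpos x hx).ne')).continuousWithinAt
  set g' : ℝ → ℝ := fun x ↦ α * ((α - 1) * x ^ (α - 1 - 1)) with hg'
  set g'' : ℝ → ℝ := fun x ↦ α * ((α - 1) * ((α - 1 - 1) * x ^ (α - 1 - 1 - 1))) with hg''
  have hg'c : ContinuousOn g' (Icc (1 / 2 : ℝ) (5 / 2)) :=
    continuousOn_const.mul (continuousOn_const.mul (rc _))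
  have hg''c : ContinuousOn g'' (Icc (1 / 2 : ℝ) (5 / 2)) :=
    continuousOn_const.mul (continuousOn_const.mul (continuousOn_const.mul (rc _)))
  obtain ⟨G1, hG1⟩ := isCompact_Icc.exists_bound_of_continuousOn hg'c
  obtain ⟨G2, hG2⟩ := isCompact_Icc.exists_bound_of_continuousOn hg''c
  set G := max G1 G2 with hG
  have hG0 : 0 ≤ G := ((norm_nonneg _).trans (hG1 1 ⟨by norm_num, by norm_num⟩)).trans
    (le_max_left _ _)
  have hα : 0 < |α| := abs_pos.2 hα0
  set c' := |α| * c with hc'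
  have hc'0 : 0 < c' := by positivity
  set C0 : ℝ := (2 * (K / c' ^ 2 + K * G / c' ^ 3) +
        (5 / 2 - 1 / 2) * (K / c' ^ 2 + 4 * (K * G / c' ^ 3) + 3 * (K * G * G / c' ^ 4))) with hC0
  have hC00 : 0 < C0 := by
    have h1 : 0 < K / c' ^ 2 := by positivity
    have h2 : 0 ≤ K * G / c' ^ 3 := by positivity
    have h3 : 0 ≤ K * G * G / c' ^ 4 := by positivity
    rw [hC0]; linarith
  refine ⟨C0, hC00, fun t z ht hz ↦ ?_⟩
  have ht0 : 0 < t := by linarith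
  have main := norm_integral_nonstationary_le (a := 1 / 2) (b := 5 / 2) (by norm_num)
    (w := cutoff) (w' := deriv cutoff) (w'' := deriv (deriv cutoff))
    (h := fun x ↦ x ^ α - α * z * x) (g := fun x ↦ α * (x ^ (α - 1) - z)) (g' := g') (g'' := g'')
    (K := K) (G := G) (c := c') (Z := 1 + |z|) hc'0 (by linarith [abs_nonneg z])
    (fun x _ ↦ hasDerivAt_cutoff x) (fun x _ ↦ hasDerivAt_deriv_cutoff x)
    continuous_deriv_deriv_cutoff.continuousOn (cutoff_eq_zero (Or.inl le_rfl))
    (cutoff_eq_zero (Or.inr le_rfl)) (fun x _ ↦ (hKb x).1) (fun x _ ↦ (hKb x).2.1)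
    (fun x _ ↦ (hKb x).2.2)
    (fun x hx ↦ by
      have h1 := (Real.hasDerivAt_rpow_const (x := x) (p := α) (Or.inl (hpos x hx).ne')).sub
        ((hasDerivAt_id x).const_mul (α * z))
      convert! h1 using 1
      ring)
    (fun x hx ↦ ((Real.hasDerivAt_rpow_const (x := x) (p := α - 1)
      (Or.inl (hpos x hx).ne')).sub_const z).const_mul α)
    (fun x hx ↦ ((Real.hasDerivAt_rpow_const (x := x) (p := α - 1 - 1)
      (Or.inl (hpos x hx).ne')).const_mul _).const_mul α)
    hg''c (fun x hx ↦ (hG1 x hx).trans (le_max_left _ _))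
    (fun x hx ↦ (hG2 x hx).trans (le_max_right _ _))
    (fun x hx ↦ by
      rw [abs_mul, hc', mul_assoc]
      exact mul_le_mul_of_nonneg_left (hcz z hz x hx) hα.le)
    ht0
  rw [cutoffIntegral_eq α t _ (a := 1 / 2) (b := 5 / 2) le_rfl le_rfl]
  have e : ∀ x : ℝ, t * x ^ α - α * t * z * x = t * (x ^ α - α * z * x) := fun x ↦ by ring
  simp_rw [e]
  refine main.trans ?_
  have : t * (1 + |z|) ^ 2 ≤ t ^ 2 * (1 + |z|) ^ 2 := by
    have h1 : t ≤ t ^ 2 := by nlinarith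
    gcongr
  exact div_le_div_of_nonneg_left hC00.le (by positivity) this

/-- **The van der Corput transform of one term**: stationary phase evaluation of the Fourier
integral `∫ w(x) e(t x ^ α - α t z x) dx`, uniformly in `z`. The phase of the main term is again a
monomial, with the dual exponent `α / (α - 1)`. -/
theorem exists_cutoffIntegral_asymptotic {α : ℝ} (hα0 : α ≠ 0) (hα1 : α ≠ 1) :
    ∃ κ : ℂ, ∃ C : ℝ, 0 < C ∧ ∀ t z : ℝ, 1 ≤ t →
      ‖cutoffIntegral α t (α * t * z) - κ * ((t ^ (-(1 / 2) : ℝ) : ℝ) : ℂ) * dualAmp α z *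
        expTwoPiI ((1 - α) * t * z ^ (α / (α - 1)))‖ ≤ C / (t * (1 + |z|) ^ 2) := by
  obtain ⟨C1, hC1, H1⟩ := exists_bound_cutoffIntegral_nonstationary hα0 hα1
  obtain ⟨κ, C2, hC2, H2⟩ := exists_stationary_phase_rpow hα0 hα1
  obtain ⟨K, hK, hKb⟩ := exists_cutoff_bound
  have hβ : α - 1 ≠ 0 := sub_ne_zero.2 hα1
  have hpos : ∀ x ∈ Icc (1 / 4 : ℝ) 5, 0 < x := fun x hx ↦ by linarith [hx.1]
  have rc : ∀ p : ℝ, ContinuousOn (fun x : ℝ ↦ x ^ p) (Icc (1 / 4 : ℝ) 5) := fun p x hx ↦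
    (Real.continuousAt_rpow_const _ _ (Or.inl (hpos x hx).ne')).continuousWithinAt
  obtain ⟨B1, hB1⟩ := isCompact_Icc.exists_bound_of_continuousOn (rc (-α))
  obtain ⟨B2, hB2⟩ := isCompact_Icc.exists_bound_of_continuousOn (rc (α - 1))
  have hI : (1 : ℝ) ∈ Icc (1 / 4 : ℝ) 5 := ⟨by norm_num, by norm_num⟩
  have hB10 : 0 ≤ B1 := (norm_nonneg _).trans (hB1 1 hI)
  have hB20 : 0 ≤ B2 := (norm_nonneg _).trans (hB2 1 hI)
  refine ⟨κ, C1 + 5 * (C2 * (25 * K)) * B1 * (1 + B2) ^ 2, by positivity, fun t z ht ↦ ?_⟩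
  have ht0 : 0 < t := by linarith
  have hden : 0 < t * (1 + |z|) ^ 2 := by have := abs_nonneg z; positivity
  by_cases hz : z ≤ 0 ∨ z ^ (1 / (α - 1)) < 1 / 4 ∨ 5 < z ^ (1 / (α - 1))
  · rw [dualAmp_of_nonstationary hz]
    simp only [Complex.ofReal_zero, mul_zero, zero_mul, sub_zero]
    refine (H1 t z ht hz).trans (div_le_div_of_nonneg_right ?_ hden.le)
    have : 0 ≤ 5 * (C2 * (25 * K)) * B1 * (1 + B2) ^ 2 := by positivity
    linarith
  push Not at hz
  obtain ⟨hz0, hz1, hz2⟩ := hz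
  set x0 := z ^ (1 / (α - 1)) with hx0def
  have hx0 : 0 < x0 := by linarith
  have hx0I : x0 ∈ Icc (1 / 4 : ℝ) 5 := ⟨hz1, hz2⟩
  have hzx : z = x0 ^ (α - 1) := by
    rw [hx0def, ← Real.rpow_mul hz0.le, one_div_mul_cancel hβ, Real.rpow_one]
  have hzα : z ^ (α / (α - 1)) = x0 ^ α := by
    rw [hx0def, ← Real.rpow_mul hz0.le]; congr 1; ring
  -- the substitution `x = x0 * v` moves the stationary point to `v = 1`
  set lam := t * x0 ^ α with hlam
  have hl : 0 < lam := mul_pos ht0 (Real.rpow_pos_of_pos hx0 _)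
  have hx5 : |x0| ≤ 5 := by rw [abs_of_pos hx0]; exact hz2
  have hmul : ∀ v : ℝ, HasDerivAt (fun v ↦ x0 * v) x0 v := fun v ↦ by
    simpa using (hasDerivAt_id v).const_mul x0
  have S := H2 lam (25 * K) (fun v ↦ cutoff (x0 * v)) (fun v ↦ deriv cutoff (x0 * v) * x0)
    (fun v ↦ deriv (deriv cutoff) (x0 * v) * x0 * x0) hl
    (fun v _ ↦ (hasDerivAt_cutoff (x0 * v)).comp v (hmul v))
    (fun v _ ↦ ((hasDerivAt_deriv_cutoff (x0 * v)).comp v (hmul v)).mul_const x0)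
    (fun v _ ↦ by linarith [(hKb (x0 * v)).1])
    (fun v _ ↦ by
      rw [abs_mul]
      have := mul_le_mul (hKb (x0 * v)).2.1 hx5 (abs_nonneg _) hK.le
      linarith)
    (fun v _ ↦ by
      rw [abs_mul, abs_mul]
      have := mul_le_mul (mul_le_mul (hKb (x0 * v)).2.2 hx5 (abs_nonneg _) hK.le) hx5
        (abs_nonneg _) (by positivity)
      linarith)
  have e1 : cutoffIntegral α t (α * t * z) = x0 * (expTwoPiI ((1 - α) * lam) *
      ∫ v in (1 / 10 : ℝ)..10, (cutoff (x0 * v) : ℂ) * expTwoPiI (lam * powPhase α v)) := by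
    rw [cutoffIntegral_eq α t _ (a := x0 * (1 / 10)) (b := x0 * 10) (by linarith) (by linarith)]
    have := intervalIntegral.smul_integral_comp_mul_left (E := ℂ) (a := 1 / 10) (b := 10)
      (fun x : ℝ ↦ ((cutoff x : ℝ) : ℂ) * expTwoPiI (t * x ^ α - α * t * z * x)) x0
    rw [Complex.real_smul] at this
    rw [← this]
    refine congrArg (fun I : ℂ ↦ (x0 : ℂ) * I) ?_
    rw [← intervalIntegral.integral_const_mul]
    refine intervalIntegral.integral_congr fun v hv ↦ ?_
    rw [uIcc_of_le (by norm_num)] at hv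
    have hv0 : 0 < v := by linarith [hv.1]
    have ep : t * (x0 * v) ^ α - α * t * z * (x0 * v) = (1 - α) * lam + lam * powPhase α v := by
      have h1 : x0 ^ (α - 1) * x0 = x0 ^ α := by
        rw [← Real.rpow_add_one hx0.ne']; congr 1; ring
      rw [Real.mul_rpow hx0.le hv0.le, hzx, hlam, powPhase]
      linear_combination (-α * t * v) * h1
    simp only [ep, expTwoPiI_add]; ring
  have e2 : lam ^ (-(1 / 2) : ℝ) = t ^ (-(1 / 2) : ℝ) * x0 ^ (-(α / 2)) := by
    rw [hlam, Real.mul_rpow ht0.le (Real.rpow_nonneg hx0.le _), ← Real.rpow_mul hx0.le]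
    congr 2; ring
  have e3 : dualAmp α z = x0 * x0 ^ (-(α / 2)) * cutoff x0 := by
    rw [dualAmp, if_pos hz0, ← hx0def]
    congr 1
    rw [sub_eq_add_neg, Real.rpow_add hx0, Real.rpow_one]
  rw [e1, e3, hzα, show (1 - α) * t * x0 ^ α = (1 - α) * lam by rw [hlam]; ring]
  have alg : ∀ J : ℂ, x0 * (expTwoPiI ((1 - α) * lam) * J) - κ * ((t ^ (-(1 / 2) : ℝ) : ℝ) : ℂ) *
      ((x0 * x0 ^ (-(α / 2)) * cutoff x0 : ℝ) : ℂ) * expTwoPiI ((1 - α) * lam) =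
      x0 * expTwoPiI ((1 - α) * lam) *
        (J - κ * (cutoff (x0 * 1) : ℝ) * ((lam ^ (-(1 / 2) : ℝ) : ℝ) : ℂ)) := by
    intro J; rw [e2, mul_one]; push_cast; ring
  rw [alg, norm_mul, norm_mul, norm_expTwoPiI, Complex.norm_real, Real.norm_eq_abs, mul_one]
  have b1 : x0 ^ (-α) ≤ B1 := (le_abs_self _).trans (hB1 x0 hx0I)
  have b2 : |z| ≤ B2 := by rw [hzx]; exact hB2 x0 hx0I
  calc _ ≤ 5 * (C2 * (25 * K) / lam) := mul_le_mul hx5 S (norm_nonneg _) (by norm_num)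
    _ = 5 * (C2 * (25 * K)) * x0 ^ (-α) / t := by
        rw [hlam, Real.rpow_neg hx0.le]; field_simp
    _ = 5 * (C2 * (25 * K)) * x0 ^ (-α) * (1 + |z|) ^ 2 / (t * (1 + |z|) ^ 2) := by
        have : 0 < (1 + |z|) ^ 2 := by have := abs_nonneg z; positivity
        field_simp
    _ ≤ _ := by
        refine div_le_div_of_nonneg_right ?_ hden.le
        calc _ ≤ 5 * (C2 * (25 * K)) * B1 * (1 + B2) ^ 2 := by gcongr
          _ ≤ _ := by linarith

/-! ### The dual exponential sum: Poisson summation -/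

/-- The smoothed exponential sum `∑ w(m / M) e(t (m / M) ^ α)`. -/
noncomputable def smoothSum (α M t : ℝ) : ℂ :=
  expSum (Finset.Icc 1 ⌊5 / 2 * M⌋₊) (fun m ↦ (cutoff (m / M) : ℂ)) (fun m ↦ ((m : ℝ) / M) ^ α) t

theorem contDiff_cutoff_mul_expTwoPiI (α t : ℝ) {M : ℝ} (hM : 0 < M) :
    ContDiff ℝ ∞ fun x : ℝ ↦ (cutoff (x / M) : ℂ) * expTwoPiI (t * (x / M) ^ α) := by
  rw [contDiff_iff_contDiffAt]
  intro x
  rcases lt_or_ge 0 x with hx | hx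
  · have h1 : ContDiffAt ℝ ∞ (fun x : ℝ ↦ (x / M) ^ α) x := by
      have h2 : ContDiffAt ℝ ∞ (fun y : ℝ ↦ y ^ α) (x / M) :=
        Real.contDiffAt_rpow_const_of_ne (by positivity)
      exact ContDiffAt.comp x (f := fun x ↦ x / M) h2 (contDiffAt_id.div_const M)
    have h3 : ContDiffAt ℝ ∞ (fun x : ℝ ↦ (cutoff (x / M) : ℂ)) x := by
      have : ContDiffAt ℝ ∞ (fun x : ℝ ↦ cutoff (x / M)) x :=
        ContDiffAt.comp x (f := fun x ↦ x / M) contDiff_cutoff.contDiffAt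
          (contDiffAt_id.div_const M)
      exact Complex.ofRealCLM.contDiff.contDiffAt.comp x this
    refine h3.mul ?_
    unfold expTwoPiI
    refine ContDiffAt.cexp ?_
    refine contDiffAt_const.mul ?_
    exact Complex.ofRealCLM.contDiff.contDiffAt.comp x (contDiffAt_const.mul h1)
  · have : (fun x : ℝ ↦ (cutoff (x / M) : ℂ) * expTwoPiI (t * (x / M) ^ α)) =ᶠ[nhds x]
        fun _ ↦ 0 := by
      filter_upwards [gt_mem_nhds (show x < M / 2 by linarith)] with y hy
      rw [cutoff_eq_zero (Or.inl ?_)]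
      · simp
      · rw [div_le_iff₀ hM]; linarith
    exact contDiffAt_const.congr_of_eventuallyEq this

theorem hasCompactSupport_cutoff_mul (α t : ℝ) {M : ℝ} (hM : 0 < M) :
    HasCompactSupport fun x : ℝ ↦ (cutoff (x / M) : ℂ) * expTwoPiI (t * (x / M) ^ α) := by
  refine HasCompactSupport.intro (K := Icc 0 (5 / 2 * M)) isCompact_Icc fun x hx ↦ ?_
  rw [cutoff_eq_zero]
  · simp
  · by_contra h
    push Not at h
    apply hx
    have h1 := (lt_div_iff₀ hM).1 h.1
    have h2 := (div_lt_iff₀ hM).1 h.2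
    exact ⟨by linarith, by linarith⟩

/-- Poisson summation for the smoothed exponential sum. -/
theorem smoothSum_eq_tsum (α t : ℝ) {M : ℝ} (hM : 0 < M) :
    smoothSum α M t = ∑' ν : ℤ, M * cutoffIntegral α t (ν * M) := by
  set φ : ℝ → ℂ := fun x ↦ (cutoff (x / M) : ℂ) * expTwoPiI (t * (x / M) ^ α) with hφ
  set f := (hasCompactSupport_cutoff_mul α t hM).toSchwartzMap
    (contDiff_cutoff_mul_expTwoPiI α t hM) with hf
  have hfφ : ∀ x, f x = φ x := fun x ↦ rfl
  have poisson := SchwartzMap.tsum_eq_tsum_fourier f 0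
  simp only [zero_add, hfφ] at poisson
  have hl : ∑' n : ℤ, φ n = smoothSum α M t := by
    have inj : Set.InjOn (fun m : ℕ ↦ (m : ℤ)) (Finset.Icc 1 ⌊5 / 2 * M⌋₊) :=
      fun a _ b _ h ↦ by simpa using h
    rw [tsum_eq_sum (s := (Finset.Icc 1 ⌊5 / 2 * M⌋₊).image fun m : ℕ ↦ (m : ℤ)),
      Finset.sum_image inj]
    · simp [smoothSum, expSum, hφ]
    · intro n hn
      have : cutoff ((n : ℝ) / M) = 0 := by
        apply cutoff_eq_zero
        by_contra h
        push Not at h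
        apply hn
        have h1 := (lt_div_iff₀ hM).1 h.1
        have h2 := (div_lt_iff₀ hM).1 h.2
        have h3 : (0 : ℝ) < n := by linarith
        have h4 : 0 < n := by exact_mod_cast h3
        lift n to ℕ using h4.le
        simp only [Finset.mem_image, Finset.mem_Icc, Nat.cast_inj, exists_eq_right]
        refine ⟨by omega, Nat.le_floor ?_⟩
        push_cast at h2
        exact h2.le
      simp only [hφ, this]; simp
  rw [← hl, poisson]
  refine tsum_congr fun ν ↦ ?_
  rw [SchwartzMap.fourier_coe, Real.fourier_real_eq_integral_exp_smul, QuotientAddGroup.mk_zero,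
    fourier_eval_zero, mul_one, cutoffIntegral]
  have := MeasureTheory.Measure.integral_comp_div
    (fun x : ℝ ↦ (cutoff x : ℂ) * expTwoPiI (t * x ^ α - ν * M * x)) M
  rw [abs_of_pos hM, Complex.real_smul] at this
  rw [← this]
  refine integral_congr_ae (Filter.Eventually.of_forall fun x ↦ ?_)
  simp only [smul_eq_mul, hfφ, hφ]
  have e : t * (x / M) ^ α - ν * M * (x / M) = t * (x / M) ^ α + -(ν * x) := by
    have : (ν : ℝ) * M * (x / M) = ν * x := by field_simp
    rw [this]; ring
  rw [e, expTwoPiI_add, expTwoPiI_eq (-(ν * x))]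
  have e2 : -2 * Real.pi * x * (ν : ℝ) = 2 * Real.pi * -(ν * x) := by ring
  rw [e2]; ring

theorem sum_range_one_div_sq_le {r : ℝ} (hr : 0 < r) (n : ℕ) :
    ∑ i ∈ Finset.range n, 1 / (1 + (i + 1) * r) ^ 2 ≤ 1 / r := by
  -- comparison with the telescoping series of the `1 / (1 + i * r) - 1 / (1 + (i + 1) * r)`
  have h : ∀ n : ℕ, ∑ i ∈ Finset.range n, 1 / (1 + ((i : ℝ) + 1) * r) ^ 2 ≤
      1 / r * (1 - 1 / (1 + n * r)) := by
    intro n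
    induction n with
    | zero => simp
    | succ n ih =>
      rw [Finset.sum_range_succ]
      have h1 : 0 < 1 + n * r := by positivity
      have h2 : 0 < 1 + ((n : ℝ) + 1) * r := by positivity
      have h3 : 1 / (1 + ((n : ℝ) + 1) * r) ^ 2 ≤
          1 / r * (1 / (1 + n * r) - 1 / (1 + ((n : ℝ) + 1) * r)) := by
        have : 1 / r * (1 / (1 + n * r) - 1 / (1 + ((n : ℝ) + 1) * r)) =
            1 / ((1 + n * r) * (1 + ((n : ℝ) + 1) * r)) := by
          field_simp; ring
        rw [this, sq]
        apply one_div_le_one_div_of_le (by positivity)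
        gcongr
        linarith
      push_cast
      calc _ ≤ 1 / r * (1 - 1 / (1 + n * r)) +
            1 / r * (1 / (1 + n * r) - 1 / (1 + ((n : ℝ) + 1) * r)) := add_le_add ih h3
        _ = _ := by ring
  refine (h n).trans ?_
  have : 0 < 1 / r := by positivity
  have h2 : 0 ≤ 1 / (1 + n * r) := by positivity
  nlinarith

theorem tsum_int_one_div_sq_le {r : ℝ} (hr : 0 < r) :
    Summable (fun ν : ℤ ↦ 1 / (1 + |(ν : ℝ)| * r) ^ 2) ∧
      ∑' ν : ℤ, 1 / (1 + |(ν : ℝ)| * r) ^ 2 ≤ 1 + 2 / r := by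
  set f : ℤ → ℝ := fun ν : ℤ ↦ 1 / (1 + |(ν : ℝ)| * r) ^ 2 with hf
  have hp : ∀ n : ℕ, f n = 1 / (1 + n * r) ^ 2 := by
    intro n; simp [hf]
  have hm : ∀ n : ℕ, f (-(n + 1 : ℤ)) = 1 / (1 + (n + 1) * r) ^ 2 := by
    intro n
    have : |((-(n + 1 : ℤ) : ℤ) : ℝ)| = n + 1 := by
      push_cast; rw [abs_of_nonpos (by linarith [Nat.cast_nonneg (α := ℝ) n])]; ring
    simp only [hf, this]
  have s2 : Summable fun n : ℕ ↦ f (-(n + 1 : ℤ)) := by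
    simp_rw [hm]
    exact summable_of_sum_range_le (fun n ↦ by positivity) (sum_range_one_div_sq_le hr)
  have s1' : Summable fun n : ℕ ↦ f ((n + 1 : ℕ) : ℤ) := by
    simp_rw [hp]; push_cast
    exact summable_of_sum_range_le (fun n ↦ by positivity) (sum_range_one_div_sq_le hr)
  have s1 : Summable fun n : ℕ ↦ f (n : ℤ) :=
    (summable_nat_add_iff (f := fun n : ℕ ↦ f (n : ℤ)) 1).1 s1'
  have t2 : ∑' n : ℕ, f (-(n + 1 : ℤ)) ≤ 1 / r := by
    simp_rw [hm]
    exact Real.tsum_le_of_sum_range_le (fun n ↦ by positivity) (sum_range_one_div_sq_le hr)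
  have t1 : ∑' n : ℕ, f (n : ℤ) ≤ 1 + 1 / r := by
    rw [s1.tsum_eq_zero_add]
    have h0 : f ((0 : ℕ) : ℤ) = 1 := by rw [hp]; simp
    rw [h0]
    gcongr
    simp_rw [hp]; push_cast
    exact Real.tsum_le_of_sum_range_le (fun n ↦ by positivity) (sum_range_one_div_sq_le hr)
  refine ⟨Summable.of_nat_of_neg_add_one s1 s2, ?_⟩
  rw [tsum_of_nat_of_neg_add_one s1 s2]
  calc _ ≤ 1 + 1 / r + 1 / r := add_le_add t1 t2
    _ = _ := by ring

/-- **The van der Corput transform**: the smoothed sum of length `M` equals, up to a small error, a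
dual sum of length about `t / M` with the dual exponent. The finite set `s` is any set that contains
all indices at which the dual amplitude does not vanish. -/
theorem exists_smoothSum_dual {α : ℝ} (hα0 : α ≠ 0) (hα1 : α ≠ 1) :
    ∃ κ : ℂ, ∃ C : ℝ, 0 < C ∧ ∀ M t : ℝ, 0 < M → 1 ≤ t → ∀ s : Finset ℕ, 0 ∉ s →
      (∀ n : ℕ, n ≠ 0 → n ∉ s → dualAmp α (n * M / (|α| * t)) = 0) →
      ‖smoothSum α M t - κ * (M * t ^ (-(1 / 2) : ℝ) : ℝ) * ∑ n ∈ s,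
        (dualAmp α (n * M / (|α| * t)) : ℂ) *
          expTwoPiI ((1 - α) * t * (n * M / (|α| * t)) ^ (α / (α - 1)))‖ ≤ C * (1 + M / t) := by
  obtain ⟨κ, C, hC, H⟩ := exists_cutoffIntegral_asymptotic hα0 hα1
  have hα : 0 < |α| := abs_pos.2 hα0
  refine ⟨κ, C * (1 + 2 * |α|), by positivity, fun M t hM ht s hs0 hs ↦ ?_⟩
  have ht0 : 0 < t := by linarith
  -- the terms of the Poisson summation formula, and their stationary phase approximations
  set F : ℤ → ℂ := fun ν ↦ M * cutoffIntegral α t (ν * M) with hF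
  set G : ℤ → ℂ := fun ν ↦ M * (κ * ((t ^ (-(1 / 2) : ℝ) : ℝ) : ℂ) *
    dualAmp α (ν * M / (α * t)) * expTwoPiI ((1 - α) * t * (ν * M / (α * t)) ^ (α / (α - 1))))
    with hG
  set r := M / (|α| * t) with hr
  have hr0 : 0 < r := by positivity
  have hFG : ∀ ν : ℤ, ‖F ν - G ν‖ ≤ M * C / t * (1 / (1 + |(ν : ℝ)| * r) ^ 2) := by
    intro ν
    have h1 := H t (ν * M / (α * t)) ht
    have e1 : α * t * (ν * M / (α * t)) = ν * M := by field_simp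
    have e2 : |(ν : ℝ) * M / (α * t)| = |(ν : ℝ)| * r := by
      rw [abs_div, abs_mul, abs_mul, abs_of_pos hM, abs_of_pos ht0, hr]; ring
    rw [e1, e2] at h1
    rw [hF, hG]
    simp only
    rw [← mul_sub, norm_mul, Complex.norm_real, Real.norm_eq_abs, abs_of_pos hM]
    calc _ ≤ M * (C / (t * (1 + |(ν : ℝ)| * r) ^ 2)) := mul_le_mul_of_nonneg_left h1 hM.le
      _ = _ := by field_simp
  obtain ⟨sm, hsm⟩ := tsum_int_one_div_sq_le hr0
  have sFG : Summable fun ν ↦ ‖F ν - G ν‖ :=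
    Summable.of_nonneg_of_le (fun _ ↦ norm_nonneg _) hFG (sm.mul_left _)
  -- the sign of the frequency agrees with the sign of `α`
  set ε : ℤ := if 0 < α then 1 else -1 with hε
  have hε2 : ε * ε = 1 := by rw [hε]; split_ifs <;> norm_num
  have hεα : (ε : ℝ) / α = 1 / |α| := by
    rw [hε]; split_ifs with h
    · rw [abs_of_pos h]; simp
    · rw [abs_of_neg (lt_of_le_of_ne (not_lt.1 h) hα0)]; push_cast; rw [neg_div, div_neg]
  have hεn : ∀ n : ℤ, ((ε * n : ℤ) : ℝ) * M / (α * t) = n * M / (|α| * t) := by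
    intro n
    push_cast
    calc _ = (ε : ℝ) / α * (n * M / t) := by field_simp
      _ = _ := by rw [hεα]; field_simp
  have hGs : ∀ ν ∉ s.image (fun n : ℕ ↦ ε * (n : ℤ)), G ν = 0 := by
    intro ν hν
    have e : ν = ε * (ε * ν) := by rw [← mul_assoc, hε2, one_mul]
    have hz : dualAmp α (ν * M / (α * t)) = 0 := by
      rw [e, hεn]
      rcases le_or_gt (ε * ν) 0 with h | h
      · apply dualAmp_of_nonstationary; left
        have : ((ε * ν : ℤ) : ℝ) ≤ 0 := by exact_mod_cast h
        apply div_nonpos_of_nonpos_of_nonneg _ (by positivity)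
        exact mul_nonpos_of_nonpos_of_nonneg this hM.le
      · obtain ⟨n, hn⟩ := Int.eq_ofNat_of_zero_le h.le
        rw [hn] at h ⊢
        have := hs n (by omega) (fun hns ↦ hν (Finset.mem_image.2 ⟨n, hns, by
          rw [← hn, ← e]⟩))
        simpa using this
    simp only [hG, hz]; simp
  have inj : Set.InjOn (fun n : ℕ ↦ ε * (n : ℤ)) s := by
    intro a _ b _ h
    have : ε * (ε * (a : ℤ)) = ε * (ε * (b : ℤ)) := congrArg _ h
    rw [← mul_assoc, ← mul_assoc, hε2, one_mul, one_mul] at this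
    exact_mod_cast this
  have hGsum : HasSum G (∑ ν ∈ s.image (fun n : ℕ ↦ ε * (n : ℤ)), G ν) :=
    hasSum_sum_of_ne_finset_zero hGs
  have e3 : ∑ ν ∈ s.image (fun n : ℕ ↦ ε * (n : ℤ)), G ν =
      κ * (M * t ^ (-(1 / 2) : ℝ) : ℝ) * ∑ n ∈ s,
        (dualAmp α (n * M / (|α| * t)) : ℂ) *
          expTwoPiI ((1 - α) * t * (n * M / (|α| * t)) ^ (α / (α - 1))) := by
    rw [Finset.sum_image inj, Finset.mul_sum]
    refine Finset.sum_congr rfl fun n _ ↦ ?_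
    simp only [hG, hεn]
    push_cast; ring
  have hsum : HasSum F (∑' ν, (F ν - G ν) + ∑ ν ∈ s.image (fun n : ℕ ↦ ε * (n : ℤ)), G ν) := by
    have := sFG.of_norm.hasSum.add hGsum
    simpa using this
  rw [smoothSum_eq_tsum α t hM, hsum.tsum_eq, e3, add_sub_cancel_right]
  refine (norm_tsum_le_tsum_norm sFG).trans ?_
  refine (sFG.tsum_le_tsum hFG (sm.mul_left _)).trans ?_
  rw [tsum_mul_left]
  calc _ ≤ M * C / t * (1 + 2 / r) := by gcongr
    _ = C * (M / t + 2 * |α|) := by rw [hr]; field_simp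
    _ ≤ _ := by
      rw [mul_assoc]
      refine mul_le_mul_of_nonneg_left ?_ hC.le
      have : 0 < M / t := by positivity
      nlinarith

/-! ### Fourth moments of exponential sums with slowly varying coefficients -/

theorem add_pow_four_le {x y : ℝ} : (x + y) ^ 4 ≤ 8 * (x ^ 4 + y ^ 4) := by
  nlinarith [sq_nonneg (x - y), sq_nonneg (x ^ 2 - y ^ 2), sq_nonneg (x + y),
    sq_nonneg ((x - y) ^ 2), mul_nonneg (sq_nonneg (x - y)) (sq_nonneg (x + y))]

theorem norm_add_pow_four_le (x y : ℂ) : ‖x + y‖ ^ 4 ≤ 8 * (‖x‖ ^ 4 + ‖y‖ ^ 4) :=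
  (pow_le_pow_left₀ (norm_nonneg _) (norm_add_le x y) 4).trans add_pow_four_le

/-- Hölder's inequality for the fourth power, via the tangent line inequality
`4 m³ x - 3 m⁴ ≤ x⁴` at the mean value `m`. -/
theorem integral_pow_four_le {a b : ℝ} (hab : a < b) {φ : ℝ → ℝ} (hφ : ContinuousOn φ (Icc a b)) :
    (∫ x in a..b, φ x) ^ 4 ≤ (b - a) ^ 3 * ∫ x in a..b, φ x ^ 4 := by
  set I := ∫ x in a..b, φ x with hI
  have hba : 0 < b - a := by linarith
  set m := I / (b - a) with hm
  rw [← uIcc_of_le hab.le] at hφ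
  have h1 : ∫ x in a..b, (4 * m ^ 3 * φ x - 3 * m ^ 4) ≤ ∫ x in a..b, φ x ^ 4 := by
    refine intervalIntegral.integral_mono_on hab.le ?_ ?_ fun x _ ↦ ?_
    · exact ((continuousOn_const.mul hφ).sub continuousOn_const).intervalIntegrable
    · exact (hφ.pow 4).intervalIntegrable
    · nlinarith [mul_nonneg (sq_nonneg (φ x - m))
        (add_nonneg (sq_nonneg (φ x + m)) (mul_nonneg zero_le_two (sq_nonneg m)))]
  rw [intervalIntegral.integral_sub (hφ.intervalIntegrable.const_mul _) (by simp),
    intervalIntegral.integral_const_mul, intervalIntegral.integral_const, ← hI, smul_eq_mul] at h1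
  have hIm : I = m * (b - a) := by rw [hm]; field_simp
  have h2 : I ^ 4 = (b - a) ^ 3 * (4 * m ^ 3 * I - (b - a) * (3 * m ^ 4)) := by rw [hIm]; ring
  rw [h2]
  exact mul_le_mul_of_nonneg_left h1 (by positivity)

/-- Slowly varying coefficients may be replaced by constant ones in a fourth moment bound. -/
theorem integral_norm_pow_four_varying_le {ι : Type*} (s : Finset ι) {T : ℝ} (hT : 0 < T)
    {b b' : ι → ℝ → ℝ} {K B : ℝ} {ψ : ℝ → ℝ} {f : ι → ℝ} (hψ : ContinuousOn ψ (Icc T (2 * T)))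
    (hb : ∀ i ∈ s, ∀ t ∈ Icc T (2 * T), HasDerivAt (b i) (b' i t) t)
    (hb' : ∀ i ∈ s, ContinuousOn (b' i) (Icc T (2 * T)))
    (hK : 0 < K) (hbK : ∀ i ∈ s, ∀ t ∈ Icc T (2 * T), |b i t| ≤ K)
    (hbK' : ∀ i ∈ s, ∀ t ∈ Icc T (2 * T), |b' i t| ≤ K / T)
    (hB : ∀ c : ι → ℂ, (∀ i ∈ s, ‖c i‖ ≤ 1) →
      ∫ t in T..(2 * T), ‖expSum s c f (ψ t)‖ ^ 4 ≤ B) :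
    ∫ t in T..(2 * T), ‖expSum s (fun i ↦ (b i t : ℂ)) f (ψ t)‖ ^ 4 ≤ 16 * K ^ 4 * B := by
  have hTT : T < 2 * T := by linarith
  have hTI : T ∈ Icc T (2 * T) := ⟨le_rfl, hTT.le⟩
  have hIcc : uIcc T (2 * T) = Icc T (2 * T) := uIcc_of_le hTT.le
  -- scaling the coefficients
  have hBK : ∀ (K : ℝ), 0 < K → ∀ c : ι → ℂ, (∀ i ∈ s, ‖c i‖ ≤ K) →
      ∫ t in T..(2 * T), ‖expSum s c f (ψ t)‖ ^ 4 ≤ K ^ 4 * B := by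
    intro K hK c hc
    have h1 := hB (fun i ↦ c i / K) (fun i hi ↦ by
      rw [norm_div, Complex.norm_real, Real.norm_eq_abs, abs_of_pos hK, div_le_one hK]
      exact hc i hi)
    have h2 : ∀ t, ‖expSum s c f t‖ ^ 4 = K ^ 4 * ‖expSum s (fun i ↦ c i / K) f t‖ ^ 4 := by
      intro t
      have : expSum s c f t = K * expSum s (fun i ↦ c i / K) f t := by
        unfold expSum
        rw [Finset.mul_sum]
        refine Finset.sum_congr rfl fun i _ ↦ ?_
        have : (K : ℂ) ≠ 0 := by exact_mod_cast hK.ne'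
        field_simp
      rw [this, norm_mul, Complex.norm_real, Real.norm_eq_abs, abs_of_pos hK, mul_pow]
    simp_rw [h2]
    rw [intervalIntegral.integral_const_mul]
    exact mul_le_mul_of_nonneg_left h1 (by positivity)
  set F' : ℝ → ℝ → ℂ := fun t τ ↦ expSum s (fun i ↦ (b' i τ : ℂ)) f (ψ t) with hF'
  have hF'c : ContinuousOn (Function.uncurry fun t τ ↦ ‖F' t τ‖ ^ 4)
      (Icc T (2 * T) ×ˢ Icc T (2 * T)) := by
    refine ContinuousOn.pow (ContinuousOn.norm ?_) 4
    simp only [hF', expSum]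
    refine continuousOn_finsetSum _ fun i hi ↦ ?_
    refine ContinuousOn.mul ?_ ?_
    · exact Complex.continuous_ofReal.comp_continuousOn
        ((hb' i hi).comp continuousOn_snd fun p hp ↦ hp.2)
    · exact continuous_expTwoPiI.comp_continuousOn
        ((hψ.comp continuousOn_fst fun p hp ↦ hp.1).mul continuousOn_const)
  have hF'τ : ∀ t, ContinuousOn (fun τ ↦ F' t τ) (Icc T (2 * T)) := by
    intro t
    simp only [hF', expSum]
    exact continuousOn_finsetSum _ fun i hi ↦
      (Complex.continuous_ofReal.comp_continuousOn (hb' i hi)).mul continuousOn_const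
  -- the fundamental theorem of calculus in the coefficients
  have hftc : ∀ t ∈ Icc T (2 * T), ‖expSum s (fun i ↦ (b i t : ℂ)) f (ψ t)‖ ^ 4 ≤
      8 * (‖expSum s (fun i ↦ (b i T : ℂ)) f (ψ t)‖ ^ 4 +
        T ^ 3 * ∫ τ in T..(2 * T), ‖F' t τ‖ ^ 4) := by
    intro t ht
    have hsub : Icc T t ⊆ Icc T (2 * T) := Icc_subset_Icc le_rfl ht.2
    have h1 : ∫ τ in T..t, F' t τ = expSum s (fun i ↦ (b i t : ℂ)) f (ψ t) -
        expSum s (fun i ↦ (b i T : ℂ)) f (ψ t) := by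
      rw [intervalIntegral.integral_eq_sub_of_hasDerivAt
        (f := fun τ ↦ expSum s (fun i ↦ (b i τ : ℂ)) f (ψ t))]
      · intro τ hτ
        rw [uIcc_of_le ht.1] at hτ
        simp only [hF', expSum]
        exact HasDerivAt.fun_sum fun i hi ↦
          ((hb i hi τ (hsub hτ)).ofReal_comp).mul_const _
      · refine ContinuousOn.intervalIntegrable ?_
        rw [uIcc_of_le ht.1]
        exact (hF'τ t).mono hsub
    have h2 : expSum s (fun i ↦ (b i t : ℂ)) f (ψ t) =
        expSum s (fun i ↦ (b i T : ℂ)) f (ψ t) + ∫ τ in T..t, F' t τ := by rw [h1]; ring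
    rw [h2]
    refine (norm_add_pow_four_le _ _).trans ?_
    gcongr
    have h3 : ‖∫ τ in T..t, F' t τ‖ ≤ ∫ τ in T..(2 * T), ‖F' t τ‖ := by
      refine (intervalIntegral.norm_integral_le_integral_norm ht.1).trans ?_
      refine intervalIntegral.integral_mono_interval le_rfl ht.1 ht.2
        (Filter.Eventually.of_forall fun _ ↦ norm_nonneg _) ?_
      exact ContinuousOn.intervalIntegrable (by rw [hIcc]; exact (hF'τ t).norm)
    refine (pow_le_pow_left₀ (norm_nonneg _) h3 4).trans ?_
    have := integral_pow_four_le hTT (hF'τ t).norm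
    rwa [show 2 * T - T = T by ring] at this
  have hec : ∀ c : ι → ℂ, ContinuousOn (fun t ↦ ‖expSum s c f (ψ t)‖ ^ 4) (Icc T (2 * T)) :=
    fun c ↦ (((continuous_expSum s c f).comp_continuousOn hψ).norm).pow 4
  have hp : Integrable (Function.uncurry fun t τ ↦ ‖F' t τ‖ ^ 4)
      ((volume.restrict (Ioc T (2 * T))).prod (volume.restrict (Ioc T (2 * T)))) := by
    rw [Measure.prod_restrict]
    have : IntegrableOn (Function.uncurry fun t τ ↦ ‖F' t τ‖ ^ 4)
        (Icc T (2 * T) ×ˢ Icc T (2 * T)) (volume.prod volume) :=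
      hF'c.integrableOn_compact (isCompact_Icc.prod isCompact_Icc)
    exact this.mono_set (prod_mono Ioc_subset_Icc_self Ioc_subset_Icc_self)
  have hint2 : IntervalIntegrable (fun t ↦ ∫ τ in T..(2 * T), ‖F' t τ‖ ^ 4) volume T (2 * T) := by
    rw [intervalIntegrable_iff_integrableOn_Ioc_of_le hTT.le]
    simp_rw [intervalIntegral.integral_of_le hTT.le]
    exact hp.integral_prod_left
  have hint3 : IntervalIntegrable (fun τ ↦ ∫ t in T..(2 * T), ‖F' t τ‖ ^ 4) volume T (2 * T) := by
    rw [intervalIntegrable_iff_integrableOn_Ioc_of_le hTT.le]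
    simp_rw [intervalIntegral.integral_of_le hTT.le]
    exact hp.integral_prod_right
  have hbt : ContinuousOn (fun t ↦ ‖expSum s (fun i ↦ (b i t : ℂ)) f (ψ t)‖ ^ 4)
      (Icc T (2 * T)) := by
    refine ContinuousOn.pow (ContinuousOn.norm ?_) 4
    unfold expSum
    refine continuousOn_finsetSum _ fun i hi ↦ ContinuousOn.mul ?_ ?_
    · exact Complex.continuous_ofReal.comp_continuousOn
        fun t ht ↦ (hb i hi t ht).continuousAt.continuousWithinAt
    · exact continuous_expTwoPiI.comp_continuousOn (hψ.mul continuousOn_const)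
  have hswap : ∫ t in T..(2 * T), ∫ τ in T..(2 * T), ‖F' t τ‖ ^ 4 =
      ∫ τ in T..(2 * T), ∫ t in T..(2 * T), ‖F' t τ‖ ^ 4 := by
    simp_rw [intervalIntegral.integral_of_le hTT.le]
    exact integral_integral_swap hp
  have hin : ∫ τ in T..(2 * T), ∫ t in T..(2 * T), ‖F' t τ‖ ^ 4 ≤ T * ((K / T) ^ 4 * B) := by
    have : ∫ τ in T..(2 * T), ∫ t in T..(2 * T), ‖F' t τ‖ ^ 4 ≤
        ∫ τ in T..(2 * T), (K / T) ^ 4 * B := by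
      refine intervalIntegral.integral_mono_on hTT.le hint3 (by simp) fun τ hτ ↦ ?_
      refine hBK (K / T) (by positivity) _ fun i hi ↦ ?_
      rw [Complex.norm_real]; exact hbK' i hi τ hτ
    rwa [intervalIntegral.integral_const, smul_eq_mul, show 2 * T - T = T by ring] at this
  have hb0 := hBK K hK (fun i ↦ (b i T : ℂ)) fun i hi ↦ by
    rw [Complex.norm_real]; exact hbK i hi T hTI
  calc ∫ t in T..(2 * T), ‖expSum s (fun i ↦ (b i t : ℂ)) f (ψ t)‖ ^ 4
      ≤ ∫ t in T..(2 * T), 8 * (‖expSum s (fun i ↦ (b i T : ℂ)) f (ψ t)‖ ^ 4 +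
        T ^ 3 * ∫ τ in T..(2 * T), ‖F' t τ‖ ^ 4) := by
        refine intervalIntegral.integral_mono_on hTT.le ?_ ?_ hftc
        · exact ContinuousOn.intervalIntegrable (by rw [hIcc]; exact hbt)
        · refine IntervalIntegrable.const_mul (IntervalIntegrable.add ?_ (hint2.const_mul _)) _
          exact ContinuousOn.intervalIntegrable (by rw [hIcc]; exact hec _)
    _ = 8 * ((∫ t in T..(2 * T), ‖expSum s (fun i ↦ (b i T : ℂ)) f (ψ t)‖ ^ 4) +
        T ^ 3 * ∫ t in T..(2 * T), ∫ τ in T..(2 * T), ‖F' t τ‖ ^ 4) := by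
        rw [intervalIntegral.integral_const_mul, intervalIntegral.integral_add ?_
          (hint2.const_mul _), intervalIntegral.integral_const_mul]
        exact ContinuousOn.intervalIntegrable (by rw [hIcc]; exact hec _)
    _ ≤ 8 * (K ^ 4 * B + T ^ 3 * (T * ((K / T) ^ 4 * B))) := by
        rw [hswap]; gcongr
    _ = 16 * K ^ 4 * B := by field_simp; ring

/-- Change of variables in the integral of a nonnegative function: the new variable `ψ` moves with
speed at least `c`. -/
theorem integral_comp_le {a b : ℝ} (hab : a ≤ b) {Ψ : ℝ → ℝ} (hΨ : Continuous Ψ)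
    (hΨ0 : ∀ x, 0 ≤ Ψ x) {ψ ψ' : ℝ → ℝ} {c R : ℝ} (hc : 0 < c)
    (hψ : ∀ t ∈ Icc a b, HasDerivAt ψ (ψ' t) t) (hψ' : ContinuousOn ψ' (Icc a b))
    (hψc : ∀ t ∈ Icc a b, c ≤ ψ' t) (hR : ∀ t ∈ Icc a b, |ψ t| ≤ R) :
    ∫ t in a..b, Ψ (ψ t) ≤ 1 / c * ∫ x in (-R)..R, Ψ x := by
  have hIcc : uIcc a b = Icc a b := uIcc_of_le hab
  have hψc' : ContinuousOn ψ (Icc a b) := fun x hx ↦ (hψ x hx).continuousAt.continuousWithinAt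
  have hR0 : 0 ≤ R := (abs_nonneg _).trans (hR a ⟨le_rfl, hab⟩)
  have h1 : ∫ t in a..b, Ψ (ψ t) ≤ ∫ t in a..b, 1 / c * (Ψ (ψ t) * ψ' t) := by
    refine intervalIntegral.integral_mono_on hab ?_ ?_ fun t ht ↦ ?_
    · exact ContinuousOn.intervalIntegrable (by rw [hIcc]; exact hΨ.comp_continuousOn hψc')
    · refine ContinuousOn.intervalIntegrable ?_
      rw [hIcc]
      exact continuousOn_const.mul ((hΨ.comp_continuousOn hψc').mul hψ')
    · have h2 := mul_le_mul_of_nonneg_left (hψc t ht) (hΨ0 (ψ t))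
      calc Ψ (ψ t) = 1 / c * (Ψ (ψ t) * c) := by field_simp
        _ ≤ 1 / c * (Ψ (ψ t) * ψ' t) := mul_le_mul_of_nonneg_left h2 (by positivity)
  refine h1.trans ?_
  have h3 : ∫ t in a..b, Ψ (ψ t) * ψ' t = ∫ x in (ψ a)..(ψ b), Ψ x :=
    intervalIntegral.integral_comp_mul_deriv (fun t ht ↦ hψ t (hIcc ▸ ht)) (hIcc ▸ hψ') hΨ
  rw [intervalIntegral.integral_const_mul, h3]
  refine mul_le_mul_of_nonneg_left ?_ (by positivity)
  refine (le_abs_self _).trans ?_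
  have ha := abs_le.1 (hR a ⟨le_rfl, hab⟩)
  have hb := abs_le.1 (hR b ⟨hab, le_rfl⟩)
  refine (intervalIntegral.abs_integral_mono_interval ?_
    (Filter.Eventually.of_forall fun x ↦ hΨ0 x) (hΨ.intervalIntegrable (-R) R)).trans ?_
  · rw [uIoc_of_le (by linarith : -R ≤ R)]
    exact Ioc_subset_Ioc (le_min ha.1 hb.1) (max_le ha.2 hb.2)
  · rw [abs_of_nonneg (intervalIntegral.integral_nonneg (by linarith) fun x _ ↦ hΨ0 x)]

/-! ### The fourth moment bound with exponent `η` and its consequences -/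

theorem card_dyadic_le {M : ℝ} (hM : 0 ≤ M) : ((dyadic M).card : ℝ) ≤ 2 * M := by
  rw [dyadic, Nat.card_Ioc]
  exact (Nat.cast_le.2 (Nat.sub_le _ _)).trans (Nat.floor_le (by positivity))

/-- The normalised monomial frequencies `(m / M) ^ α`. -/
noncomputable def monoFreq (α M : ℝ) (m : ℕ) : ℝ := ((m : ℝ) / M) ^ α

/-- The bound `∫ |∑ e(t (m / M) ^ α)|⁴ dt ≪ M ^ (4 + η)` over `|t| ≤ M²`, `m` in a dyadic interval,
for all exponents `α ≠ 0, 1` simultaneously. The bootstrapping argument decreases `η`. -/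
def FourthMomentBound (η : ℝ) : Prop :=
  ∀ α : ℝ, α ≠ 0 → α ≠ 1 → ∃ C : ℝ, 0 < C ∧ ∀ M : ℝ, 1 / 2 ≤ M →
    ∫ t in (-M ^ 2)..(M ^ 2), ‖expSum (dyadic M) (fun _ ↦ 1) (monoFreq α M) t‖ ^ 4 ≤
      C * M ^ (4 + η)

/-- By the majorant principle, the bound extends to arbitrary coefficients and to integrals over
intervals of arbitrary length. -/
theorem FourthMomentBound.coeff {η : ℝ} (H : FourthMomentBound η) {α : ℝ} (h0 : α ≠ 0)
    (h1 : α ≠ 1) : ∃ C : ℝ, 0 < C ∧ ∀ M R : ℝ, 1 / 2 ≤ M → 0 ≤ R → ∀ b : ℕ → ℂ,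
      (∀ m ∈ dyadic M, ‖b m‖ ≤ 1) →
      ∫ t in (-R)..R, ‖expSum (dyadic M) b (monoFreq α M) t‖ ^ 4 ≤
        C * (R / M ^ 2 + 1) * M ^ (4 + η) := by
  obtain ⟨C, hC, HC⟩ := H α h0 h1
  refine ⟨9 * C, by positivity, fun M R hM hR b hb ↦ ?_⟩
  have hM0 : 0 < M := by linarith
  have := integral_norm_pow_four_expSum_le_long (dyadic M) (θ := b) (monoFreq α M)
    (w := fun _ ↦ 1) hb (T := M ^ 2 / 3) (by positivity) hR
  rw [show 3 * (M ^ 2 / 3) = M ^ 2 by ring] at this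
  simp only [Complex.ofReal_one] at this
  have hMη : 0 < M ^ (4 + η) := Real.rpow_pos_of_pos hM0 _
  refine this.trans ?_
  calc _ ≤ (R / (M ^ 2 / 3) + 1) * (3 * (C * M ^ (4 + η))) := by gcongr; exact HC M hM
    _ = (9 * (R / M ^ 2) + 3) * (C * M ^ (4 + η)) := by field_simp; ring
    _ ≤ (9 * (R / M ^ 2) + 9) * (C * M ^ (4 + η)) := by gcongr; norm_num
    _ = _ := by ring

/-- The fourth moment bound for index sets that are covered by `J` dyadic intervals. -/
theorem FourthMomentBound.range {η : ℝ} (H : FourthMomentBound η) {α : ℝ} (h0 : α ≠ 0)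
    (h1 : α ≠ 1) (J : ℕ) : ∃ C : ℝ, 0 < C ∧ ∀ A R : ℝ, 1 / 2 ≤ A → 0 ≤ R → ∀ s : Finset ℕ,
      (∀ n ∈ s, A < n ∧ (n : ℝ) ≤ 2 ^ J * A) → ∀ b : ℕ → ℂ, (∀ n ∈ s, ‖b n‖ ≤ 1) →
      ∫ t in (-R)..R, ‖expSum s b (monoFreq α A) t‖ ^ 4 ≤
        C * (R / A ^ 2 + 1) * A ^ (4 + η) := by
  classical
  obtain ⟨C, hC, HC⟩ := H.coeff h0 h1
  induction J with
  | zero =>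
    refine ⟨1, one_pos, fun A R hA hR s hs b hb ↦ ?_⟩
    have hA0 : 0 < A := by linarith
    have : s = ∅ := by
      rw [Finset.eq_empty_iff_forall_notMem]
      intro n hn
      have := hs n hn
      simp only [pow_zero, one_mul] at this
      linarith [this.1, this.2]
    subst this
    simp only [expSum, Finset.sum_empty, norm_zero]
    have : 0 ≤ A ^ (4 + η) := Real.rpow_nonneg hA0.le _
    norm_num
    positivity
  | succ J ih =>
    obtain ⟨D, hD, HD⟩ := ih
    set ρ : ℝ := ((2 : ℝ) ^ J) ^ α with hρ
    have h2J : (0 : ℝ) < 2 ^ J := by positivity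
    have hρ0 : 0 < ρ := Real.rpow_pos_of_pos h2J _
    refine ⟨8 * (D + 1 / ρ * C * (ρ + 1) * (2 ^ J) ^ (4 + η)), by positivity,
      fun A R hA hR s hs b hb ↦ ?_⟩
    have hA0 : 0 < A := by linarith
    set B := 2 ^ J * A with hB
    have hBA : A ≤ B := by
      have : (1 : ℝ) ≤ 2 ^ J := one_le_pow₀ one_le_two
      nlinarith
    set s1 := s.filter fun n : ℕ ↦ (n : ℝ) ≤ B with hs1
    set s2 := s.filter fun n : ℕ ↦ ¬ (n : ℝ) ≤ B with hs2
    have hsub : s2 ⊆ dyadic B := by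
      intro n hn
      rw [hs2, Finset.mem_filter, not_le] at hn
      rw [mem_dyadic (by linarith)]
      refine ⟨hn.2, (hs n hn.1).2.trans (le_of_eq ?_)⟩
      rw [hB]; ring
    set b2 : ℕ → ℂ := fun n ↦ if n ∈ s2 then b n else 0 with hb2
    have hsplit : ∀ t, expSum s b (monoFreq α A) t =
        expSum s1 b (monoFreq α A) t + expSum (dyadic B) b2 (monoFreq α B) (t * ρ) := by
      intro t
      have e1 : expSum (dyadic B) b2 (monoFreq α B) (t * ρ) = expSum s2 b (monoFreq α A) t := by
        unfold expSum
        rw [← Finset.sum_subset hsub]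
        · refine Finset.sum_congr rfl fun n hn ↦ ?_
          simp only [hb2, if_pos hn]
          have : monoFreq α A n = ρ * monoFreq α B n := by
            unfold monoFreq
            rw [hρ, ← Real.mul_rpow h2J.le (by positivity), hB]
            congr 1; field_simp
          rw [this, mul_assoc]
        · intro n _ hn; simp [hb2, hn]
      rw [e1]
      exact (Finset.sum_filter_add_sum_filter_not s _ _).symm
    have i1 := HD A R hA hR s1 (fun n hn ↦ by
      rw [hs1, Finset.mem_filter] at hn
      exact ⟨(hs n hn.1).1, hn.2⟩) b (fun n hn ↦ hb n (Finset.mem_filter.1 hn).1)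
    have i2 := HC B (ρ * R) (by linarith) (by positivity) b2 (fun n _ ↦ by
      simp only [hb2]
      split_ifs with h
      · exact hb n (Finset.mem_filter.1 h).1
      · simp)
    have i3 : ∫ t in (-R)..R, ‖expSum (dyadic B) b2 (monoFreq α B) (t * ρ)‖ ^ 4 =
        1 / ρ * ∫ t in (-(ρ * R))..(ρ * R), ‖expSum (dyadic B) b2 (monoFreq α B) t‖ ^ 4 := by
      rw [intervalIntegral.integral_comp_mul_right
        (fun t ↦ ‖expSum (dyadic B) b2 (monoFreq α B) t‖ ^ 4) hρ0.ne', smul_eq_mul, one_div]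
      congr 2 <;> ring
    have i4 : (ρ * R / B ^ 2 + 1) * B ^ (4 + η) ≤
        (ρ + 1) * (2 ^ J) ^ (4 + η) * ((R / A ^ 2 + 1) * A ^ (4 + η)) := by
      have e1 : B ^ (4 + η) = (2 ^ J) ^ (4 + η) * A ^ (4 + η) := by
        rw [hB, Real.mul_rpow h2J.le hA0.le]
      have e2 : ρ * R / B ^ 2 + 1 ≤ (ρ + 1) * (R / A ^ 2 + 1) := by
        have : ρ * R / B ^ 2 ≤ ρ * (R / A ^ 2) := by
          rw [mul_div_assoc]; gcongr
        have h3 : 0 ≤ R / A ^ 2 := by positivity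
        nlinarith
      rw [e1]
      calc _ ≤ ((ρ + 1) * (R / A ^ 2 + 1)) * ((2 ^ J) ^ (4 + η) * A ^ (4 + η)) := by gcongr
        _ = _ := by ring
    have ci : ∀ f : ℝ → ℝ, Continuous f → IntervalIntegrable f volume (-R) R :=
      fun f hf ↦ hf.intervalIntegrable _ _
    calc ∫ t in (-R)..R, ‖expSum s b (monoFreq α A) t‖ ^ 4
        ≤ ∫ t in (-R)..R, 8 * (‖expSum s1 b (monoFreq α A) t‖ ^ 4 +
            ‖expSum (dyadic B) b2 (monoFreq α B) (t * ρ)‖ ^ 4) := by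
          refine intervalIntegral.integral_mono_on (by linarith) (ci _ (by fun_prop))
            (ci _ (by fun_prop)) fun t _ ↦ ?_
          rw [hsplit]; exact norm_add_pow_four_le _ _
      _ = 8 * ((∫ t in (-R)..R, ‖expSum s1 b (monoFreq α A) t‖ ^ 4) +
            1 / ρ * ∫ t in (-(ρ * R))..(ρ * R), ‖expSum (dyadic B) b2 (monoFreq α B) t‖ ^ 4) := by
          rw [intervalIntegral.integral_const_mul, intervalIntegral.integral_add
            (ci _ (by fun_prop)) (ci _ (by fun_prop)), i3]
      _ ≤ 8 * (D * (R / A ^ 2 + 1) * A ^ (4 + η) +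
            1 / ρ * (C * (ρ * R / B ^ 2 + 1) * B ^ (4 + η))) := by gcongr
      _ = 8 * (D * (R / A ^ 2 + 1) * A ^ (4 + η) +
            1 / ρ * C * ((ρ * R / B ^ 2 + 1) * B ^ (4 + η))) := by ring
      _ ≤ 8 * (D * (R / A ^ 2 + 1) * A ^ (4 + η) + 1 / ρ * C *
            ((ρ + 1) * (2 ^ J) ^ (4 + η) * ((R / A ^ 2 + 1) * A ^ (4 + η)))) := by gcongr
      _ = _ := by ring

/-! ### The fourth moment of the dual sum -/

/-- The derivative in `t` of the dual amplitude `dualAmp α (q / t)`. -/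
noncomputable def dualAmpDeriv (α q t : ℝ) : ℝ :=
  ((1 - α / 2) * ((q / t) ^ (1 / (α - 1))) ^ (1 - α / 2) * cutoff ((q / t) ^ (1 / (α - 1))) +
    ((q / t) ^ (1 / (α - 1))) ^ (1 - α / 2) * (q / t) ^ (1 / (α - 1)) *
      deriv cutoff ((q / t) ^ (1 / (α - 1)))) * (-(1 / (α - 1)) / t)

theorem hasDerivAt_dualAmp (α : ℝ) {q t : ℝ} (hq : 0 < q) (ht : 0 < t) :
    HasDerivAt (fun t ↦ dualAmp α (q / t)) (dualAmpDeriv α q t) t := by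
  set β := 1 / (α - 1) with hβ
  have hz : 0 < q / t := by positivity
  set x := (q / t) ^ β with hx
  have hx0 : 0 < x := Real.rpow_pos_of_pos hz _
  have h1 : HasDerivAt (fun t ↦ (q / t) ^ β) (-β * x / t) t := by
    have h2 : HasDerivAt (fun t : ℝ ↦ q / t) (-(q / t ^ 2)) t := by
      have := (hasDerivAt_inv ht.ne').const_mul q
      convert! this using 1
      ring
    have h3 := h2.rpow_const (p := β) (Or.inl hz.ne')
    convert! h3 using 1
    rw [Real.rpow_sub_one hz.ne', ← hx]; field_simp
  have h4 : HasDerivAt (fun x : ℝ ↦ x ^ (1 - α / 2)) ((1 - α / 2) * x ^ (1 - α / 2) / x) x := by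
    have := Real.hasDerivAt_rpow_const (x := x) (p := 1 - α / 2) (Or.inl hx0.ne')
    convert! this using 1
    rw [Real.rpow_sub_one hx0.ne']; ring
  have h5 : HasDerivAt (fun t ↦ ((q / t) ^ β) ^ (1 - α / 2) * cutoff ((q / t) ^ β))
      (dualAmpDeriv α q t) t := by
    have := (h4.mul (hasDerivAt_cutoff x)).comp t h1
    convert! this using 1
    rw [dualAmpDeriv, ← hβ, ← hx]; field_simp
  refine h5.congr_of_eventuallyEq ?_
  filter_upwards [lt_mem_nhds ht] with y hy
  rw [dualAmp, if_pos (by positivity)]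

theorem continuousOn_dualAmpDeriv (α : ℝ) {q : ℝ} (hq : 0 < q) :
    ContinuousOn (dualAmpDeriv α q) (Ioi 0) := by
  have h1 : ContinuousOn (fun t : ℝ ↦ q / t) (Ioi 0) :=
    continuousOn_const.div continuousOn_id fun t ht ↦ (mem_Ioi.1 ht).ne'
  have h2 : ContinuousOn (fun t : ℝ ↦ (q / t) ^ (1 / (α - 1))) (Ioi 0) :=
    h1.rpow_const fun t ht ↦ Or.inl (div_pos hq ht).ne'
  have h3 : ContinuousOn (fun t : ℝ ↦ ((q / t) ^ (1 / (α - 1))) ^ (1 - α / 2)) (Ioi 0) :=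
    h2.rpow_const fun t ht ↦ Or.inl (Real.rpow_pos_of_pos (div_pos hq ht) _).ne'
  unfold dualAmpDeriv
  refine ContinuousOn.mul (ContinuousOn.add ?_ ?_) ?_
  · exact (continuousOn_const.mul h3).mul (cutoff.continuous.comp_continuousOn h2)
  · exact (h3.mul h2).mul (contDiff_deriv_cutoff.continuous.comp_continuousOn h2)
  · exact continuousOn_const.div continuousOn_id fun t ht ↦ (mem_Ioi.1 ht).ne'

/-- The amplitude `dualAmp α (q / t)` is slowly varying in `t`: it and `t` times its derivative are
bounded, uniformly in `q`. -/
theorem exists_bound_dualAmp (α : ℝ) : ∃ K : ℝ, 0 < K ∧ ∀ q t : ℝ, 0 < q → 0 < t →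
    |dualAmp α (q / t)| ≤ K ∧ |dualAmpDeriv α q t| ≤ K / t := by
  obtain ⟨K, hK, hKb⟩ := exists_cutoff_bound
  have hpos : ∀ x ∈ Icc (1 / 2 : ℝ) (5 / 2), 0 < x := fun x hx ↦ by linarith [hx.1]
  obtain ⟨B, hB⟩ := isCompact_Icc.exists_bound_of_continuousOn (s := Icc (1 / 2 : ℝ) (5 / 2))
    (f := fun x : ℝ ↦ x ^ (1 - α / 2))
    (fun x hx ↦ (Real.continuousAt_rpow_const _ _ (Or.inl (hpos x hx).ne')).continuousWithinAt)
  have hB0 : 0 ≤ B := (norm_nonneg _).trans (hB 1 ⟨by norm_num, by norm_num⟩)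
  have hdz : ∀ x : ℝ, x ∉ Icc (1 / 2 : ℝ) (5 / 2) → cutoff x = 0 ∧ deriv cutoff x = 0 := by
    intro x hx
    have : ∀ᶠ y in nhds x, cutoff y = 0 := by
      filter_upwards [isClosed_Icc.isOpen_compl.mem_nhds hx] with y hy
      apply cutoff_eq_zero
      by_contra h
      push Not at h
      exact hy ⟨h.1.le, h.2.le⟩
    refine ⟨this.self_of_nhds, ?_⟩
    have h2 : (cutoff : ℝ → ℝ) =ᶠ[nhds x] fun _ ↦ 0 := this
    rw [h2.deriv_eq]; simp
  set β := 1 / (α - 1) with hβ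
  refine ⟨B * K + (|1 - α / 2| * B * K + B * (5 / 2) * K) * |β| + 1, by positivity,
    fun q t hq ht ↦ ?_⟩
  have hz : 0 < q / t := by positivity
  set x := (q / t) ^ β with hx
  have n1 : 0 ≤ B * K := by positivity
  have n2 : 0 ≤ (|1 - α / 2| * B * K + B * (5 / 2) * K) * |β| := by positivity
  by_cases hxI : x ∈ Icc (1 / 2 : ℝ) (5 / 2)
  · have hb := hB x hxI
    rw [Real.norm_eq_abs] at hb
    have hx5 : |x| ≤ 5 / 2 := by rw [abs_of_pos (hpos x hxI)]; exact hxI.2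
    constructor
    · rw [dualAmp, if_pos hz, ← hβ, ← hx, abs_mul]
      have := mul_le_mul hb (hKb x).1 (abs_nonneg _) hB0
      linarith
    · rw [dualAmpDeriv, ← hβ, ← hx, abs_mul, abs_div, abs_neg, abs_of_pos ht, ← mul_div_assoc]
      refine div_le_div_of_nonneg_right ?_ ht.le
      have h1 : |(1 - α / 2) * x ^ (1 - α / 2) * cutoff x + x ^ (1 - α / 2) * x * deriv cutoff x| ≤
          |1 - α / 2| * B * K + B * (5 / 2) * K := by
        refine (abs_add_le _ _).trans (add_le_add ?_ ?_)
        · rw [abs_mul, abs_mul]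
          have := (hKb x).1
          gcongr
        · rw [abs_mul, abs_mul]
          have := (hKb x).2.1
          gcongr
      have := mul_le_mul_of_nonneg_right h1 (abs_nonneg β)
      linarith
  · obtain ⟨e1, e2⟩ := hdz x hxI
    constructor
    · rw [dualAmp, if_pos hz, ← hβ, ← hx, e1, mul_zero, abs_zero]; linarith
    · rw [dualAmpDeriv, ← hβ, ← hx, e1, e2]
      simp only [mul_zero, add_zero, zero_mul, abs_zero]
      positivity

theorem exists_rpow_bounds {a b : ℝ} (ha : 0 < a) (hab : a ≤ b) (p : ℝ) :
    ∃ c C : ℝ, 0 < c ∧ 0 < C ∧ ∀ x ∈ Icc a b, c ≤ x ^ p ∧ x ^ p ≤ C := by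
  have hpos : ∀ x ∈ Icc a b, 0 < x := fun x hx ↦ ha.trans_le hx.1
  have hc : ContinuousOn (fun x : ℝ ↦ x ^ p) (Icc a b) := fun x hx ↦
    (Real.continuousAt_rpow_const _ _ (Or.inl (hpos x hx).ne')).continuousWithinAt
  have hne : (Icc a b).Nonempty := ⟨a, le_rfl, hab⟩
  obtain ⟨x0, hx0, hmin⟩ := isCompact_Icc.exists_isMinOn hne hc
  obtain ⟨x1, hx1, hmax⟩ := isCompact_Icc.exists_isMaxOn hne hc
  exact ⟨x0 ^ p, x1 ^ p, Real.rpow_pos_of_pos (hpos x0 hx0) _, Real.rpow_pos_of_pos (hpos x1 hx1) _,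
    fun x hx ↦ ⟨hmin hx, hmax hx⟩⟩

/-- The dual amplitude is supported in a compact subinterval of `(0, ∞)`. -/
theorem exists_dualAmp_support {α : ℝ} (hα1 : α ≠ 1) : ∃ z1 z2 : ℝ, 0 < z1 ∧ z1 ≤ z2 ∧
    ∀ z, dualAmp α z ≠ 0 → z1 ≤ z ∧ z ≤ z2 := by
  obtain ⟨c, C, hc, hC, H⟩ := exists_rpow_bounds (a := 1 / 4) (b := 5) (by norm_num) (by norm_num)
    (α - 1)
  have h1 := H 1 ⟨by norm_num, by norm_num⟩
  refine ⟨c, C, hc, h1.1.trans h1.2, fun z hz ↦ ?_⟩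
  have hn := mt dualAmp_of_nonstationary hz
  push Not at hn
  obtain ⟨h0, h2, h3⟩ := hn
  have := H _ ⟨h2, h3⟩
  rwa [← Real.rpow_mul h0.le, one_div_mul_cancel (sub_ne_zero.2 hα1), Real.rpow_one] at this

/-- The fourth moment of the dual sum of length `T / M`, which reduces to the fourth moment bound
for the dual exponent `α / (α - 1)`. -/
theorem FourthMomentBound.dual_sum {η : ℝ} (H : FourthMomentBound η) (hη : 0 ≤ η) {α : ℝ}
    (h0 : α ≠ 0) (h1 : α ≠ 1) {z1 z2 : ℝ} (hz1 : 0 < z1) (hz12 : z1 ≤ z2) :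
    ∃ C : ℝ, 0 < C ∧ ∀ M T : ℝ, 1 / 2 ≤ M → 1 ≤ T → T ≤ M ^ 2 → ∀ s : Finset ℕ,
      (∀ n ∈ s, n ≠ 0 ∧ z1 * |α| * (T / M) ≤ n ∧ (n : ℝ) ≤ 2 * z2 * |α| * (T / M)) →
      ∫ t in T..(2 * T), ‖∑ n ∈ s, (dualAmp α (n * M / (|α| * t)) : ℂ) *
          expTwoPiI ((1 - α) * t * (n * M / (|α| * t)) ^ (α / (α - 1)))‖ ^ 4 ≤
        C * (M ^ 2 / T * (T / M) ^ (4 + η)) := by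
  have hα : 0 < |α| := abs_pos.2 h0
  have hα1 : α - 1 ≠ 0 := sub_ne_zero.2 h1
  have hz2 : 0 < z2 := hz1.trans_le hz12
  set α' := α / (α - 1) with hα'
  have h0' : α' ≠ 0 := div_ne_zero h0 hα1
  have h1' : α' ≠ 1 := by
    rw [hα', Ne, div_eq_one_iff_eq hα1]; intro h; linarith
  have hLeg : (1 - α) * (1 - α') = 1 := by rw [hα']; field_simp; ring
  obtain ⟨J, hJ⟩ := pow_unbounded_of_one_lt (4 * z2 / z1) one_lt_two
  obtain ⟨C1, hC1, HC⟩ := H.range h0' h1' J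
  obtain ⟨K, hK, HK⟩ := exists_bound_dualAmp α
  obtain ⟨c1, c2, hc1, hc2, hc⟩ := exists_rpow_bounds (a := z1 / 4) (b := z2) (by positivity)
    (by linarith) α'
  set c3 : ℝ := |1 - α| * 2 * c2 * (4 / (z1 * |α|) ^ 2) with hc3
  have hc30 : 0 ≤ c3 := by positivity
  refine ⟨16 * K ^ 4 * (1 / c1 * (C1 * (c3 + 1) * (z2 * |α|) ^ (4 + η))), by positivity,
    fun M T hM hT hTM s hs ↦ ?_⟩
  have hM0 : 0 < M := by linarith
  have hT0 : 0 < T := by linarith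
  set L := T / M with hL
  have hL0 : 0 < L := by positivity
  have hLη : 0 < L ^ (4 + η) := Real.rpow_pos_of_pos hL0 _
  rcases s.eq_empty_or_nonempty with rfl | ⟨n0, hn0⟩
  · simp only [Finset.sum_empty, norm_zero]
    norm_num
    positivity
  -- the scale of the dual variable
  set A := max (1 / 2) (z1 * |α| * L / 2) with hA
  have hA12 : 1 / 2 ≤ A := le_max_left _ _
  have hAz : z1 * |α| * L / 2 ≤ A := le_max_right _ _
  have hA0 : 0 < A := by linarith
  have hzL : z1 * |α| * L ≤ z2 * |α| * L := by gcongr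
  have hAz2 : A ≤ z2 * |α| * L := by
    obtain ⟨h2, _, h3⟩ := hs n0 hn0
    have : (1 : ℝ) ≤ n0 := by exact_mod_cast Nat.one_le_iff_ne_zero.2 h2
    refine max_le (by linarith) ?_
    have : 0 < z1 * |α| * L := by positivity
    linarith
  have hsA : ∀ n ∈ s, A < n ∧ (n : ℝ) ≤ 2 ^ J * A := by
    intro n hn
    obtain ⟨h2, h3, h4⟩ := hs n hn
    have : (1 : ℝ) ≤ n := by exact_mod_cast Nat.one_le_iff_ne_zero.2 h2
    have h5 : 0 < z1 * |α| * L := by positivity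
    refine ⟨max_lt (by linarith) (by linarith), h4.trans ?_⟩
    calc 2 * z2 * |α| * L = 4 * z2 / z1 * (z1 * |α| * L / 2) := by field_simp; ring
      _ ≤ 2 ^ J * A := by gcongr
  set k := A * M / |α| with hk
  have hk0 : 0 < k := by positivity
  have hkt : ∀ t ∈ Icc T (2 * T), k / t ∈ Icc (z1 / 4) z2 := by
    intro t ht
    have ht0 : 0 < t := hT0.trans_le ht.1
    constructor
    · rw [le_div_iff₀ ht0, hk, le_div_iff₀ hα]
      have : L * M = T := by rw [hL]; field_simp
      calc z1 / 4 * t * |α| ≤ z1 / 4 * (2 * T) * |α| := by gcongr; exact ht.2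
        _ = z1 * |α| * L / 2 * M := by rw [← this]; ring
        _ ≤ A * M := by gcongr
    · rw [div_le_iff₀ ht0, hk, div_le_iff₀ hα]
      have : L * M = T := by rw [hL]; field_simp
      calc A * M ≤ z2 * |α| * L * M := by gcongr
        _ = z2 * T * |α| := by rw [← this]; ring
        _ ≤ z2 * t * |α| := by gcongr; exact ht.1
  -- the phases are `ψ t * (n / A) ^ α'`; by `hLeg` the derivative of the new variable `ψ` is
  -- exactly `(k / t) ^ α'`, which is bounded below
  set ψ : ℝ → ℝ := fun t ↦ (1 - α) * (t * (k / t) ^ α') with hψ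
  have hψd : ∀ t ∈ Icc T (2 * T), HasDerivAt ψ ((k / t) ^ α') t := by
    intro t ht
    have ht0 : 0 < t := hT0.trans_le ht.1
    have hz : 0 < k / t := by positivity
    have h2 : HasDerivAt (fun t : ℝ ↦ k / t) (-(k / t ^ 2)) t := by
      have := (hasDerivAt_inv ht0.ne').const_mul k
      convert! this using 1
      ring
    have h3 := ((hasDerivAt_id t).mul (h2.rpow_const (p := α') (Or.inl hz.ne'))).const_mul (1 - α)
    convert! h3 using 1
    rw [Real.rpow_sub_one hz.ne']
    simp only [id]
    have e : (1 - α) * (1 * (k / t) ^ α' + t * (-(k / t ^ 2) * α' * ((k / t) ^ α' / (k / t)))) =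
        (1 - α) * (1 - α') * (k / t) ^ α' := by field_simp; ring
    rw [e, hLeg, one_mul]
  have hψ'c : ContinuousOn (fun t : ℝ ↦ (k / t) ^ α') (Icc T (2 * T)) := by
    refine ContinuousOn.rpow_const (continuousOn_const.div continuousOn_id fun t ht ↦ ?_) ?_
    · exact (hT0.trans_le ht.1).ne'
    · exact fun t ht ↦ Or.inl (div_pos hk0 (hT0.trans_le ht.1)).ne'
  set R := |1 - α| * (2 * T * c2) with hR
  have hR0 : 0 ≤ R := by positivity
  have hψR : ∀ t ∈ Icc T (2 * T), |ψ t| ≤ R := by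
    intro t ht
    have ht0 : 0 < t := hT0.trans_le ht.1
    have h2 := hc _ (hkt t ht)
    rw [hψ, hR, abs_mul]
    refine mul_le_mul_of_nonneg_left ?_ (abs_nonneg _)
    rw [abs_of_nonneg (mul_nonneg ht0.le (hc1.le.trans h2.1))]
    exact mul_le_mul ht.2 h2.2 (hc1.le.trans h2.1) (by positivity)
  have hcont : ContinuousOn ψ (Icc T (2 * T)) := fun t ht ↦
    (hψd t ht).continuousAt.continuousWithinAt
  set q : ℕ → ℝ := fun n ↦ n * M / |α| with hq
  have hq0 : ∀ n ∈ s, 0 < q n := by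
    intro n hn
    have : (0 : ℝ) < n := by exact_mod_cast Nat.pos_of_ne_zero (hs n hn).1
    simp only [hq]; positivity
  have main := integral_norm_pow_four_varying_le s hT0 (b := fun n t ↦ dualAmp α (q n / t))
    (b' := fun n t ↦ dualAmpDeriv α (q n) t) (K := K)
    (B := 1 / c1 * (C1 * (R / A ^ 2 + 1) * A ^ (4 + η))) (ψ := ψ) (f := monoFreq α' A) hcont
    (fun n hn t ht ↦ hasDerivAt_dualAmp α (hq0 n hn) (hT0.trans_le ht.1))
    (fun n hn ↦ (continuousOn_dualAmpDeriv α (hq0 n hn)).mono fun t ht ↦ hT0.trans_le ht.1) hK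
    (fun n hn t ht ↦ (HK _ t (hq0 n hn) (hT0.trans_le ht.1)).1)
    (fun n hn t ht ↦ (HK _ t (hq0 n hn) (hT0.trans_le ht.1)).2.trans
      (div_le_div_of_nonneg_left hK.le hT0 ht.1))
    (fun c hcb ↦ by
      have h2 := integral_comp_le (by linarith : T ≤ 2 * T)
        (Ψ := fun x ↦ ‖expSum s c (monoFreq α' A) x‖ ^ 4) (by fun_prop) (fun x ↦ by positivity)
        hc1 hψd hψ'c (fun t ht ↦ (hc _ (hkt t ht)).1) hψR
      exact h2.trans (mul_le_mul_of_nonneg_left (HC A R hA12 hR0 s hsA c hcb) (by positivity)))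
  have e1 : ∫ t in T..(2 * T), ‖∑ n ∈ s, (dualAmp α (n * M / (|α| * t)) : ℂ) *
          expTwoPiI ((1 - α) * t * (n * M / (|α| * t)) ^ α')‖ ^ 4 =
      ∫ t in T..(2 * T),
        ‖expSum s (fun n ↦ (dualAmp α (q n / t) : ℂ)) (monoFreq α' A) (ψ t)‖ ^ 4 := by
    refine intervalIntegral.integral_congr fun t ht ↦ ?_
    rw [uIcc_of_le (by linarith)] at ht
    have ht0 : 0 < t := hT0.trans_le ht.1
    simp only [expSum]
    congr 2
    refine Finset.sum_congr rfl fun n hn ↦ ?_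
    have e2 : q n / t = n * M / (|α| * t) := by simp only [hq]; rw [div_div]
    have e3 : ψ t * monoFreq α' A n = (1 - α) * t * (n * M / (|α| * t)) ^ α' := by
      have : n * M / (|α| * t) = k / t * (n / A) := by rw [hk]; field_simp
      rw [this, Real.mul_rpow (by positivity) (by positivity)]
      simp only [hψ, monoFreq]; ring
    rw [e2, e3]
  rw [e1]
  refine main.trans ?_
  rw [mul_assoc (16 * K ^ 4)]
  refine mul_le_mul_of_nonneg_left ?_ (by positivity)
  rw [mul_assoc (1 / c1)]
  refine mul_le_mul_of_nonneg_left ?_ (by positivity)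
  have b1 : R / A ^ 2 + 1 ≤ (c3 + 1) * (M ^ 2 / T) := by
    have h2 : R / A ^ 2 ≤ c3 * (M ^ 2 / T) := by
      calc R / A ^ 2 ≤ R / (z1 * |α| * L / 2) ^ 2 := by gcongr
        _ = c3 * (M ^ 2 / T) := by rw [hR, hc3, hL]; field_simp; ring
    have h3 : 1 ≤ M ^ 2 / T := by rw [le_div_iff₀ hT0]; linarith
    linarith
  have b2 : A ^ (4 + η) ≤ (z2 * |α|) ^ (4 + η) * L ^ (4 + η) := by
    rw [← Real.mul_rpow (by positivity) hL0.le]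
    exact Real.rpow_le_rpow hA0.le hAz2 (by linarith)
  calc C1 * (R / A ^ 2 + 1) * A ^ (4 + η)
      ≤ C1 * ((c3 + 1) * (M ^ 2 / T)) * ((z2 * |α|) ^ (4 + η) * L ^ (4 + η)) := by gcongr
    _ = _ := by ring

/-! ### Bootstrapping the fourth moment bound -/

@[fun_prop] theorem continuous_smoothSum (α M : ℝ) : Continuous (smoothSum α M) :=
  continuous_expSum _ _ _

theorem norm_smoothSum_neg (α M t : ℝ) : ‖smoothSum α M (-t)‖ = ‖smoothSum α M t‖ := by
  rw [← RCLike.norm_conj (smoothSum α M t)]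
  congr 1
  simp [smoothSum, expSum, map_sum, conj_expTwoPiI]

/-- The fourth moment of the smooth sum over a dyadic range `T ≤ t ≤ 2 T`, by duality. -/
theorem FourthMomentBound.smoothSum_dyadic {η : ℝ} (H : FourthMomentBound η) (hη : 0 ≤ η) {α : ℝ}
    (h0 : α ≠ 0) (h1 : α ≠ 1) : ∃ C : ℝ, 0 < C ∧ ∀ M T : ℝ, 1 / 2 ≤ M → 1 ≤ T → T ≤ M ^ 2 →
      ∫ t in T..(2 * T), ‖smoothSum α M t‖ ^ 4 ≤
        C * (M ^ 2 * T * (T / M) ^ η + T + M ^ 4 / T ^ 3) := by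
  have hα : 0 < |α| := abs_pos.2 h0
  obtain ⟨κ, C1, hC1, HC⟩ := exists_smoothSum_dual h0 h1
  obtain ⟨z1, z2, hz1, hz12, hz⟩ := exists_dualAmp_support h1
  obtain ⟨C2, hC2, HC2⟩ := H.dual_sum hη h0 h1 hz1 hz12
  have hz2 : 0 < z2 := hz1.trans_le hz12
  refine ⟨8 * (‖κ‖ ^ 4 * C2 + 8 * C1 ^ 4), by positivity, fun M T hM hT hTM ↦ ?_⟩
  have hM0 : 0 < M := by linarith
  have hT0 : 0 < T := by linarith
  set s : Finset ℕ := (Finset.Icc 1 ⌊2 * z2 * |α| * (T / M)⌋₊).filter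
    fun n : ℕ ↦ z1 * |α| * (T / M) ≤ n with hs
  have hsm : ∀ n ∈ s, n ≠ 0 ∧ z1 * |α| * (T / M) ≤ n ∧ (n : ℝ) ≤ 2 * z2 * |α| * (T / M) := by
    intro n hn
    rw [hs, Finset.mem_filter, Finset.mem_Icc] at hn
    exact ⟨by omega, hn.2, (Nat.le_floor_iff (by positivity)).1 hn.1.2⟩
  set D : ℝ → ℂ := fun t ↦ ∑ n ∈ s, (dualAmp α (n * M / (|α| * t)) : ℂ) *
          expTwoPiI ((1 - α) * t * (n * M / (|α| * t)) ^ (α / (α - 1))) with hD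
  have hdual := HC2 M T hM hT hTM s hsm
  have hpt : ∀ t ∈ Icc T (2 * T), ‖smoothSum α M t‖ ^ 4 ≤
      8 * (‖κ‖ ^ 4 * M ^ 4 / T ^ 2 * ‖D t‖ ^ 4 + 8 * C1 ^ 4 * (1 + M ^ 4 / T ^ 4)) := by
    intro t ht
    have ht0 : 0 < t := hT0.trans_le ht.1
    have ha := HC M t hM0 (hT.trans ht.1) s (fun h ↦ (hsm 0 h).1 rfl) (fun n hn hns ↦ by
      by_contra hne
      obtain ⟨g1, g2⟩ := hz _ hne
      rw [le_div_iff₀ (by positivity)] at g1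
      rw [div_le_iff₀ (by positivity)] at g2
      refine hns ?_
      rw [hs, Finset.mem_filter, Finset.mem_Icc, Nat.le_floor_iff (by positivity)]
      refine ⟨⟨Nat.one_le_iff_ne_zero.2 hn, ?_⟩, ?_⟩
      · rw [← mul_div_assoc, le_div_iff₀ hM0]
        calc (n : ℝ) * M ≤ z2 * (|α| * t) := g2
          _ ≤ z2 * (|α| * (2 * T)) := by gcongr; exact ht.2
          _ = _ := by ring
      · rw [← mul_div_assoc, div_le_iff₀ hM0]
        calc z1 * |α| * T = z1 * (|α| * T) := by ring
          _ ≤ z1 * (|α| * t) := by gcongr; exact ht.1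
          _ ≤ _ := g1)
    set E := κ * (M * t ^ (-(1 / 2) : ℝ) : ℝ) * D t with hE
    have e1 : smoothSum α M t = E + (smoothSum α M t - E) := by ring
    have e2 : ‖E‖ ^ 4 ≤ ‖κ‖ ^ 4 * M ^ 4 / T ^ 2 * ‖D t‖ ^ 4 := by
      have h3 : 0 ≤ t ^ (-(1 / 2) : ℝ) := Real.rpow_nonneg ht0.le _
      have h4 : (t ^ (-(1 / 2) : ℝ)) ^ 4 = 1 / t ^ 2 := by
        rw [← Real.rpow_natCast, ← Real.rpow_mul ht0.le, show -(1 / 2 : ℝ) * (4 : ℕ) = -(2 : ℕ) by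
          norm_num, Real.rpow_neg ht0.le, Real.rpow_natCast, one_div]
      rw [hE, norm_mul, norm_mul, Complex.norm_real, Real.norm_of_nonneg (by positivity), mul_pow,
        mul_pow, mul_pow, h4, mul_one_div, mul_div_assoc]
      gcongr
      exact ht.1
    have e3 : ‖smoothSum α M t - E‖ ^ 4 ≤ 8 * C1 ^ 4 * (1 + M ^ 4 / T ^ 4) := by
      calc ‖smoothSum α M t - E‖ ^ 4 ≤ (C1 * (1 + M / T)) ^ 4 := by
            gcongr
            refine ha.trans ?_
            gcongr
            exact ht.1
        _ = C1 ^ 4 * (1 + M / T) ^ 4 := by ring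
        _ ≤ C1 ^ 4 * (8 * (1 ^ 4 + (M / T) ^ 4)) := by gcongr; exact add_pow_four_le
        _ = _ := by rw [div_pow]; ring
    rw [e1]
    refine (norm_add_pow_four_le _ _).trans ?_
    gcongr
  have hDc : ContinuousOn D (Icc T (2 * T)) := by
    rw [hD]
    refine continuousOn_finsetSum _ fun n hn ↦ ?_
    have hn0 : (0 : ℝ) < n := by exact_mod_cast Nat.pos_of_ne_zero (hsm n hn).1
    have hpos : ∀ t ∈ Icc T (2 * T), 0 < t := fun t ht ↦ hT0.trans_le ht.1
    have c1 : ContinuousOn (fun t : ℝ ↦ n * M / (|α| * t)) (Icc T (2 * T)) :=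
      continuousOn_const.div (by fun_prop) fun t ht ↦ (mul_pos hα (hpos t ht)).ne'
    refine ContinuousOn.mul ?_ ?_
    · refine Complex.continuous_ofReal.comp_continuousOn fun t ht ↦ ?_
      have := (hasDerivAt_dualAmp α (q := n * M / |α|) (by positivity)
        (hpos t ht)).continuousAt.continuousWithinAt (s := Icc T (2 * T))
      simpa only [div_div] using this
    · refine continuous_expTwoPiI.comp_continuousOn (ContinuousOn.mul (by fun_prop) ?_)
      exact c1.rpow_const fun t ht ↦ Or.inl (div_pos (by positivity)
        (mul_pos hα (hpos t ht))).ne'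
  have hTη : 0 < (T / M) ^ η := Real.rpow_pos_of_pos (by positivity) _
  have hi : IntervalIntegrable (fun t ↦ ‖D t‖ ^ 4) volume T (2 * T) := by
    refine ContinuousOn.intervalIntegrable ?_
    rw [uIcc_of_le (by linarith)]
    exact hDc.norm.pow 4
  calc ∫ t in T..(2 * T), ‖smoothSum α M t‖ ^ 4
      ≤ ∫ t in T..(2 * T), 8 * (‖κ‖ ^ 4 * M ^ 4 / T ^ 2 * ‖D t‖ ^ 4 +
          8 * C1 ^ 4 * (1 + M ^ 4 / T ^ 4)) := by
        refine intervalIntegral.integral_mono_on (by linarith)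
          (Continuous.intervalIntegrable (by fun_prop) _ _) ?_ hpt
        exact ((hi.const_mul _).add intervalIntegrable_const).const_mul _
    _ = 8 * (‖κ‖ ^ 4 * M ^ 4 / T ^ 2 * (∫ t in T..(2 * T), ‖D t‖ ^ 4) +
          8 * C1 ^ 4 * (1 + M ^ 4 / T ^ 4) * T) := by
        rw [intervalIntegral.integral_const_mul, intervalIntegral.integral_add
          (hi.const_mul _) intervalIntegrable_const, intervalIntegral.integral_const_mul,
          intervalIntegral.integral_const, smul_eq_mul]
        ring
    _ ≤ 8 * (‖κ‖ ^ 4 * M ^ 4 / T ^ 2 * (C2 * (M ^ 2 / T * (T / M) ^ (4 + η))) +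
          8 * C1 ^ 4 * (1 + M ^ 4 / T ^ 4) * T) := by gcongr
    _ = 8 * (‖κ‖ ^ 4 * C2 * (M ^ 2 * T * (T / M) ^ η) + 8 * C1 ^ 4 * (T + M ^ 4 / T ^ 3)) := by
        rw [Real.rpow_add (by positivity), show (4 : ℝ) = (4 : ℕ) by norm_num, Real.rpow_natCast]
        field_simp
    _ ≤ 8 * (‖κ‖ ^ 4 * C2 + 8 * C1 ^ 4) * (M ^ 2 * T * (T / M) ^ η + T + M ^ 4 / T ^ 3) := by
        have a1 : 0 ≤ ‖κ‖ ^ 4 * C2 := by positivity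
        have a2 : 0 ≤ 8 * C1 ^ 4 := by positivity
        have a3 : 0 ≤ M ^ 2 * T * (T / M) ^ η := by positivity
        have a4 : 0 ≤ T + M ^ 4 / T ^ 3 := by positivity
        nlinarith [mul_nonneg a1 a4, mul_nonneg a2 a3]

/-- The fourth moment of the smooth sum up to height `T ≤ M ^ 2`. -/
theorem FourthMomentBound.smoothSum_le {η : ℝ} (H : FourthMomentBound η) (hη : 0 ≤ η) {α : ℝ}
    (h0 : α ≠ 0) (h1 : α ≠ 1) : ∃ C : ℝ, 0 < C ∧ ∀ M T : ℝ, 1 / 2 ≤ M → 1 ≤ T → T ≤ M ^ 2 →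
      ∫ t in (-T)..T, ‖smoothSum α M t‖ ^ 4 ≤ C * (M ^ 2 * T * (T / M) ^ η + T + M ^ 4) := by
  obtain ⟨C, hC, HC⟩ := H.smoothSum_dyadic hη h0 h1
  have h2η : (1 : ℝ) ≤ 2 ^ η := Real.one_le_rpow one_le_two hη
  refine ⟨2 * (C * (2 * 2 ^ η) + (5 / 2) ^ 4), by positivity, fun M T hM hT hTM ↦ ?_⟩
  have hM0 : 0 < M := by linarith
  have hT0 : 0 < T := by linarith
  have ci : ∀ a b, IntervalIntegrable (fun t ↦ ‖smoothSum α M t‖ ^ 4) volume a b :=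
    fun a b ↦ Continuous.intervalIntegrable (by fun_prop) _ _
  -- summation over dyadic ranges; `2 * (1 - 1 / 2 ^ n)` dominates the sum of the `1 / 8 ^ i`
  have hind : ∀ n : ℕ, (2 : ℝ) ^ n ≤ 2 * M ^ 2 → ∫ t in (1 : ℝ)..2 ^ n, ‖smoothSum α M t‖ ^ 4 ≤
      C * (M ^ 2 * 2 ^ n * (2 ^ n / M) ^ η + 2 ^ n + M ^ 4 * (2 * (1 - 1 / 2 ^ n))) := by
    intro n
    induction n with
    | zero =>
      intro _
      simp only [pow_zero, intervalIntegral.integral_same]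
      have : 0 ≤ (1 / M) ^ η := Real.rpow_nonneg (by positivity) _
      norm_num
      positivity
    | succ n ih =>
      intro hn
      set U : ℝ := 2 ^ n with hU
      have hU1 : 1 ≤ U := one_le_pow₀ one_le_two
      have hUM : U ≤ M ^ 2 := by rw [pow_succ] at hn; linarith
      have i1 := ih (by linarith)
      have i2 := HC M U hM hU1 hUM
      have hU0 : 0 < U := by linarith
      rw [pow_succ, mul_comm U 2, ← intervalIntegral.integral_add_adjacent_intervals (ci 1 U)
        (ci U (2 * U))]
      refine (add_le_add i1 i2).trans ?_
      rw [← mul_add]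
      refine mul_le_mul_of_nonneg_left ?_ hC.le
      have hUη : 0 ≤ (U / M) ^ η := Real.rpow_nonneg (by positivity) _
      have e1 : (2 * U / M) ^ η = 2 ^ η * (U / M) ^ η := by
        rw [← Real.mul_rpow (by norm_num) (by positivity)]; congr 1; ring
      have e2 : M ^ 2 * (2 * U) * (U / M) ^ η ≤ M ^ 2 * (2 * U) * (2 * U / M) ^ η := by
        rw [e1]
        gcongr
        nlinarith
      have e3 : M ^ 4 / U ^ 3 ≤ M ^ 4 * (1 / U) := by
        rw [div_eq_mul_one_div]
        gcongr
        nlinarith [mul_nonneg hU0.le (sub_nonneg.2 hU1), mul_self_nonneg U]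
      have e4 : M ^ 4 * (2 * (1 - 1 / (2 * U))) = M ^ 4 * (2 * (1 - 1 / U)) + M ^ 4 * (1 / U) := by
        field_simp; ring
      rw [e4]
      linarith
  have hpos : ∫ t in (0 : ℝ)..T, ‖smoothSum α M t‖ ^ 4 ≤
      (C * (2 * 2 ^ η) + (5 / 2) ^ 4) * (M ^ 2 * T * (T / M) ^ η + T + M ^ 4) := by
    obtain ⟨n, hn1, hn2⟩ := exists_nat_pow_near hT one_lt_two
    have hTη : 0 ≤ (T / M) ^ η := Real.rpow_nonneg (by positivity) _
    have hn3 : (2 : ℝ) ^ (n + 1) ≤ 2 * T := by rw [pow_succ]; linarith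
    have i1 := hind (n + 1) (by linarith)
    have i2 : ∫ t in (1 : ℝ)..T, ‖smoothSum α M t‖ ^ 4 ≤
        ∫ t in (1 : ℝ)..2 ^ (n + 1), ‖smoothSum α M t‖ ^ 4 :=
      intervalIntegral.integral_mono_interval le_rfl hT hn2.le
        (Filter.Eventually.of_forall fun t ↦ by positivity) (ci _ _)
    have i3 : ∫ t in (0 : ℝ)..1, ‖smoothSum α M t‖ ^ 4 ≤ (5 / 2) ^ 4 * M ^ 4 := by
      have hb : ∀ t, ‖smoothSum α M t‖ ≤ 5 / 2 * M := by
        intro t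
        have := norm_expSum_le (Finset.Icc 1 ⌊5 / 2 * M⌋₊) (fun m ↦ (cutoff (m / M) : ℂ))
          (fun m ↦ ((m : ℝ) / M) ^ α) (w := fun _ ↦ 1) (fun m _ ↦ by
            rw [Complex.norm_real, Real.norm_of_nonneg cutoff.nonneg]; exact cutoff.le_one) t
        refine this.trans ?_
        rw [Finset.sum_const, Nat.card_Icc, nsmul_eq_mul, mul_one, Nat.add_sub_cancel]
        exact Nat.floor_le (by positivity)
      calc ∫ t in (0 : ℝ)..1, ‖smoothSum α M t‖ ^ 4 ≤ ∫ t in (0 : ℝ)..1, (5 / 2 * M) ^ 4 := by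
            refine intervalIntegral.integral_mono_on zero_le_one (ci _ _) intervalIntegrable_const
              fun t _ ↦ ?_
            gcongr
            exact hb t
        _ = _ := by rw [intervalIntegral.integral_const, smul_eq_mul]; ring
    have e1 : ((2 : ℝ) ^ (n + 1) / M) ^ η ≤ 2 ^ η * (T / M) ^ η := by
      rw [← Real.mul_rpow (by norm_num) (by positivity)]
      refine Real.rpow_le_rpow (by positivity) ?_ hη
      rw [← mul_div_assoc]; gcongr
    rw [← intervalIntegral.integral_add_adjacent_intervals (ci 0 1) (ci 1 T)]
    have e2 : C * (M ^ 2 * 2 ^ (n + 1) * (2 ^ (n + 1) / M) ^ η + 2 ^ (n + 1) +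
        M ^ 4 * (2 * (1 - 1 / 2 ^ (n + 1)))) ≤
        C * (M ^ 2 * (2 * T) * (2 ^ η * (T / M) ^ η) + 2 ^ η * (2 * T) + 2 ^ η * (M ^ 4 * 2)) := by
      have h3 : (0 : ℝ) ≤ 1 / 2 ^ (n + 1) := by positivity
      have h4 : M ^ 4 * (2 * (1 - 1 / 2 ^ (n + 1))) ≤ M ^ 4 * 2 :=
        mul_le_mul_of_nonneg_left (by linarith) (by positivity)
      have h5 : M ^ 4 * 2 ≤ 2 ^ η * (M ^ 4 * 2) := le_mul_of_one_le_left (by positivity) h2η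
      have h6 : 2 * T ≤ 2 ^ η * (2 * T) := le_mul_of_one_le_left (by positivity) h2η
      refine mul_le_mul_of_nonneg_left
        (add_le_add (add_le_add ?_ (by linarith)) (by linarith)) hC.le
      gcongr
    have e3 : 0 ≤ M ^ 2 * T * (T / M) ^ η + T := by positivity
    nlinarith
  have hneg : ∫ t in (-T)..0, ‖smoothSum α M t‖ ^ 4 = ∫ t in (0 : ℝ)..T, ‖smoothSum α M t‖ ^ 4 := by
    rw [← neg_zero, ← intervalIntegral.integral_comp_neg (fun t ↦ ‖smoothSum α M t‖ ^ 4)]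
    simp only [neg_zero, norm_smoothSum_neg]
  rw [← intervalIntegral.integral_add_adjacent_intervals (ci (-T) 0) (ci 0 T), hneg]
  linarith

theorem fourthMomentBound_two : FourthMomentBound 2 := by
  intro α h0 h1
  refine ⟨32, by norm_num, fun M hM ↦ ?_⟩
  have hM0 : 0 < M := by linarith
  have hb : ∀ t, ‖expSum (dyadic M) (fun _ ↦ 1) (monoFreq α M) t‖ ≤ 2 * M := by
    intro t
    refine (norm_expSum_le (dyadic M) (fun _ ↦ 1) (monoFreq α M) (w := fun _ ↦ 1) (by simp)
      t).trans ?_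
    rw [Finset.sum_const, nsmul_eq_mul, mul_one]
    exact card_dyadic_le hM0.le
  calc ∫ t in (-M ^ 2)..(M ^ 2), ‖expSum (dyadic M) (fun _ ↦ 1) (monoFreq α M) t‖ ^ 4
      ≤ ∫ t in (-M ^ 2)..(M ^ 2), (2 * M) ^ 4 := by
        refine intervalIntegral.integral_mono_on (by nlinarith)
          (Continuous.intervalIntegrable (by fun_prop) _ _) intervalIntegrable_const fun t _ ↦ ?_
        gcongr
        exact hb t
    _ = 32 * M ^ (4 + 2 : ℝ) := by
        rw [intervalIntegral.integral_const, smul_eq_mul,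
          show (4 + 2 : ℝ) = (6 : ℕ) by norm_num, Real.rpow_natCast]; ring

/-- One step of the bootstrapping: the majorant principle shortens the range of integration to
`M ^ 2 / K`, where duality is efficient. The choice `K = M ^ (η / (1 + η))` balances the terms. -/
theorem FourthMomentBound.step {η : ℝ} (H : FourthMomentBound η) (hη : 0 ≤ η) :
    FourthMomentBound (η / (1 + η)) := by
  intro α h0 h1
  obtain ⟨C, hC, HC⟩ := H.smoothSum_le hη h0 h1
  obtain ⟨C0, hC0, HC0⟩ := fourthMomentBound_two α h0 h1
  set η' := η / (1 + η) with hη'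
  have hη'0 : 0 ≤ η' := by positivity
  have hη'1 : η' ≤ 1 := by rw [hη', div_le_one (by linarith)]; linarith
  refine ⟨C0 + 36 * C, by positivity, fun M hM ↦ ?_⟩
  have hM0 : 0 < M := by linarith
  have hMη : 0 < M ^ (4 + η') := Real.rpow_pos_of_pos hM0 _
  rcases le_or_gt M 1 with hM1 | hM1
  · calc ∫ t in (-M ^ 2)..(M ^ 2), ‖expSum (dyadic M) (fun _ ↦ 1) (monoFreq α M) t‖ ^ 4
        ≤ C0 * M ^ (4 + 2 : ℝ) := HC0 M hM
      _ ≤ C0 * M ^ (4 + η') := mul_le_mul_of_nonneg_left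
          (Real.rpow_le_rpow_of_exponent_ge hM0 hM1 (by linarith)) hC0.le
      _ ≤ (C0 + 36 * C) * M ^ (4 + η') := by nlinarith
  · set K := M ^ η' with hK
    have hK0 : 0 < K := Real.rpow_pos_of_pos hM0 _
    have hK1 : 1 ≤ K := Real.one_le_rpow hM1.le hη'0
    have hKM : K ≤ M := by
      calc K ≤ M ^ (1 : ℝ) := Real.rpow_le_rpow_of_exponent_le hM1.le hη'1
        _ = M := Real.rpow_one M
    set T := M ^ 2 / K with hT
    have hT1 : 1 ≤ T := by rw [hT, le_div_iff₀ hK0]; nlinarith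
    have hTM : T ≤ M ^ 2 := div_le_self (by positivity) hK1
    have hT0 : 0 < T := by linarith
    -- the choice of `K` makes the term from duality equal to the trivial term
    have hbal : M ^ 2 * T * (T / M) ^ η = M ^ 4 := by
      have e1 : K * K ^ η = M ^ η := by
        rw [← Real.rpow_one_add' hK0.le (by linarith), hK, ← Real.rpow_mul hM0.le, hη',
          div_mul_cancel₀ _ (by linarith)]
      have e2 : T / M = M / K := by rw [hT]; field_simp
      have e3 : (0 : ℝ) < K ^ η := Real.rpow_pos_of_pos hK0 _
      rw [e2, Real.div_rpow hM0.le hK0.le, ← e1, hT]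
      field_simp
    have hsub : dyadic M ⊆ Finset.Icc 1 ⌊5 / 2 * M⌋₊ := by
      intro m hm
      rw [mem_dyadic hM0.le] at hm
      rw [Finset.mem_Icc, Nat.le_floor_iff (by positivity)]
      refine ⟨?_, by linarith⟩
      have : (0 : ℝ) < m := by linarith
      exact_mod_cast this
    have hmaj := integral_norm_pow_four_expSum_le_long (Finset.Icc 1 ⌊5 / 2 * M⌋₊)
      (θ := fun m ↦ if m ∈ dyadic M then 1 else 0) (monoFreq α M) (w := fun m ↦ cutoff (m / M))
      (fun m _ ↦ by
        split_ifs with hm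
        · rw [mem_dyadic hM0.le] at hm
          rw [cutoff_eq_one (by rw [le_div_iff₀ hM0]; linarith) (by rw [div_le_iff₀ hM0]; linarith)]
          simp
        · simpa using cutoff.nonneg) (T := T / 3) (R := M ^ 2) (by positivity) (by positivity)
    have e1 : ∀ t, expSum (Finset.Icc 1 ⌊5 / 2 * M⌋₊) (fun m ↦ if m ∈ dyadic M then 1 else 0)
        (monoFreq α M) t = expSum (dyadic M) (fun _ ↦ 1) (monoFreq α M) t := by
      intro t
      unfold expSum
      rw [← Finset.sum_subset hsub]
      · exact Finset.sum_congr rfl fun m hm ↦ by simp [hm]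
      · intro m _ hm; simp [hm]
    simp only [e1] at hmaj
    refine hmaj.trans ?_
    rw [show 3 * (T / 3) = T by ring]
    have e2 : M ^ 2 / (T / 3) = 3 * K := by rw [hT]; field_simp
    have e3 : K * M ^ 4 = M ^ (4 + η') := by
      rw [Real.rpow_add hM0, mul_comm, ← hK, show (4 : ℝ) = (4 : ℕ) by norm_num,
        Real.rpow_natCast]
    have e4 : T ≤ M ^ 4 := hTM.trans (by
      have : 1 ≤ M ^ 2 := one_le_pow₀ hM1.le
      nlinarith)
    rw [e2]
    calc _ ≤ (3 * K + 1) * (3 * (C * (M ^ 2 * T * (T / M) ^ η + T + M ^ 4))) := by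
          gcongr
          exact HC M T hM hT1 hTM
      _ ≤ (3 * K + K) * (3 * (C * (M ^ 4 + M ^ 4 + M ^ 4))) := by rw [hbal]; gcongr
      _ = 36 * C * M ^ (4 + η') := by rw [← e3]; ring
      _ ≤ (C0 + 36 * C) * M ^ (4 + η') := by nlinarith

/-- The condition `1 / 2 ≤ M` makes the bound monotone in `η` up to the constant. -/
theorem FourthMomentBound.mono {η η' : ℝ} (H : FourthMomentBound η) (h : η ≤ η') :
    FourthMomentBound η' := by
  intro α h0 h1
  obtain ⟨C, hC, HC⟩ := H α h0 h1
  refine ⟨C * 2 ^ (η' - η), by positivity, fun M hM ↦ (HC M hM).trans ?_⟩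
  have hM0 : 0 < M := by linarith
  rw [mul_assoc]
  refine mul_le_mul_of_nonneg_left ?_ hC.le
  have e : M ^ (4 + η') = M ^ (η' - η) * M ^ (4 + η) := by
    rw [← Real.rpow_add hM0]; congr 1; ring
  rw [e, ← mul_assoc, ← Real.mul_rpow (by norm_num) hM0.le]
  exact le_mul_of_one_le_left (Real.rpow_nonneg hM0.le _)
    (Real.one_le_rpow (by linarith) (by linarith))

/-- The fourth moment bound of Robert and Sargos. The bootstrapping runs through the exponents
`2 / (1 + 2 * n)`. -/
theorem fourthMomentBound {η : ℝ} (hη : 0 < η) : FourthMomentBound η := by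
  have h : ∀ n : ℕ, FourthMomentBound (2 / (1 + 2 * n)) := by
    intro n
    induction n with
    | zero => simpa using fourthMomentBound_two
    | succ n ih =>
      have := ih.step (by positivity)
      convert! this using 1
      push_cast; field_simp; ring
  obtain ⟨n, hn⟩ := exists_nat_gt (1 / η)
  refine (h n).mono ?_
  rw [div_lt_iff₀ hη] at hn
  rw [div_le_iff₀ (by positivity)]
  nlinarith

/-! ### The divisor bound -/

/-- The divisor bound. Only the primes `p < 2 ^ (1 / ε)` contribute a factor greater than `1` to
the quotient of the number of divisors by `n ^ ε`. -/
theorem exists_card_divisors_le {ε : ℝ} (hε : 0 < ε) :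
    ∃ C : ℝ, 0 < C ∧ ∀ n : ℕ, n ≠ 0 → (n.divisors.card : ℝ) ≤ C * (n : ℝ) ^ ε := by
  obtain ⟨P, hP⟩ := exists_nat_gt ((2 : ℝ) ^ (1 / ε))
  set c := ε * Real.log 2 with hc
  have hc0 : 0 < c := mul_pos hε (Real.log_pos one_lt_two)
  set B := 1 + 1 / c with hB
  have hB1 : 1 ≤ B := by rw [hB]; have : 0 < 1 / c := by positivity
                         linarith
  refine ⟨B ^ P, by positivity, fun n hn ↦ ?_⟩
  rw [Nat.card_divisors hn]
  have hloc : ∀ p ∈ n.primeFactors, ((n.factorization p + 1 : ℕ) : ℝ) ≤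
      (if p < P then B else 1) * ((p ^ n.factorization p : ℕ) : ℝ) ^ ε := by
    intro p hp
    have hp2 : (2 : ℝ) ≤ p := by exact_mod_cast (Nat.prime_of_mem_primeFactors hp).two_le
    set a := n.factorization p
    have e1 : ((p ^ a : ℕ) : ℝ) ^ ε = ((p : ℝ) ^ ε) ^ a := by
      push_cast
      rw [← Real.rpow_natCast, ← Real.rpow_natCast, ← Real.rpow_mul (by positivity),
        ← Real.rpow_mul (by positivity), mul_comm]
    rw [e1]
    push_cast
    split_ifs with h
    · have h1 : 1 + a * c ≤ ((p : ℝ) ^ ε) ^ a := by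
        calc 1 + a * c ≤ Real.exp (a * c) := by
              rw [add_comm]; exact Real.add_one_le_exp _
          _ = ((2 : ℝ) ^ ε) ^ a := by
              rw [Real.rpow_def_of_pos two_pos, ← Real.exp_nat_mul, hc]; congr 2; ring
          _ ≤ _ := by gcongr
      calc (a : ℝ) + 1 ≤ B * (1 + a * c) := by
            have : (1 + 1 / c) * (1 + a * c) = a + 1 + (1 / c + a * c) := by field_simp; ring
            rw [hB, this]
            have : 0 ≤ 1 / c + a * c := by positivity
            linarith
        _ ≤ _ := by gcongr
    · have h1 : 2 ≤ (p : ℝ) ^ ε := by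
        have h2 : (2 : ℝ) ^ (1 / ε) ≤ p := hP.le.trans (by exact_mod_cast not_lt.1 h)
        calc (2 : ℝ) = ((2 : ℝ) ^ (1 / ε)) ^ ε := by
              rw [← Real.rpow_mul two_pos.le, one_div_mul_cancel hε.ne', Real.rpow_one]
          _ ≤ _ := by gcongr
      rw [one_mul]
      calc (a : ℝ) + 1 ≤ 2 ^ a := by exact_mod_cast (Nat.lt_two_pow_self (n := a))
        _ ≤ _ := by gcongr
  have hprod : ∏ p ∈ n.primeFactors, ((p ^ n.factorization p : ℕ) : ℝ) ^ ε = (n : ℝ) ^ ε := by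
    rw [Real.finsetProd_rpow _ _ (fun p _ ↦ by positivity), ← Nat.cast_prod]
    congr 2
    exact Nat.prod_factorization_pow_eq_self hn
  calc ((∏ p ∈ n.primeFactors, (n.factorization p + 1) : ℕ) : ℝ)
      = ∏ p ∈ n.primeFactors, ((n.factorization p + 1 : ℕ) : ℝ) := by push_cast; rfl
    _ ≤ ∏ p ∈ n.primeFactors, ((if p < P then B else 1) *
          ((p ^ n.factorization p : ℕ) : ℝ) ^ ε) :=
        Finset.prod_le_prod (fun _ _ ↦ by positivity) hloc
    _ = (∏ p ∈ n.primeFactors, if p < P then B else 1) * (n : ℝ) ^ ε := by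
        rw [Finset.prod_mul_distrib, hprod]
    _ ≤ B ^ P * (n : ℝ) ^ ε := by
        gcongr
        rw [Finset.prod_ite, Finset.prod_const, Finset.prod_const_one, mul_one]
        refine pow_le_pow_right₀ hB1 ?_
        calc (n.primeFactors.filter (· < P)).card ≤ (Finset.range P).card :=
              Finset.card_le_card fun p hp ↦ Finset.mem_range.2 (Finset.mem_filter.1 hp).2
          _ = P := Finset.card_range P

/-! ### The spacing problem for `h ^ β * n ^ γ` -/

/-- At most `L / δ + 1` points at mutual distance at least `δ` lie in an interval of length `L`. -/
theorem card_le_of_separated {ι : Type*} (s : Finset ι) {f : ι → ℝ} {δ L x : ℝ} (hδ : 0 < δ)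
    (hL : 0 ≤ L) (hsep : ∀ i ∈ s, ∀ j ∈ s, i ≠ j → δ ≤ |f i - f j|)
    (hf : ∀ i ∈ s, x ≤ f i ∧ f i ≤ x + L) : (s.card : ℝ) ≤ L / δ + 1 := by
  have h1 : s.card ≤ (Finset.range (⌊L / δ⌋₊ + 1)).card := by
    refine Finset.card_le_card_of_injOn (fun i ↦ ⌊(f i - x) / δ⌋₊) (fun i hi ↦ ?_)
      fun i hi j hj hij ↦ ?_
    · have := hf i hi
      simp only [Finset.coe_range, mem_Iio, Nat.lt_succ_iff]
      refine Nat.floor_le_floor ?_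
      gcongr
      linarith
    · by_contra hne
      have h2 := hsep i hi j hj hne
      have n1 : 0 ≤ (f i - x) / δ := div_nonneg (by linarith [(hf i hi).1]) hδ.le
      have n2 : 0 ≤ (f j - x) / δ := div_nonneg (by linarith [(hf j hj).1]) hδ.le
      simp only at hij
      have a1 := Nat.floor_le n1
      have a2 := Nat.lt_floor_add_one ((f i - x) / δ)
      have a3 := Nat.floor_le n2
      have a4 := Nat.lt_floor_add_one ((f j - x) / δ)
      rw [hij] at a1 a2
      have : |(f i - x) / δ - (f j - x) / δ| < 1 := by rw [abs_lt]; constructor <;> linarith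
      rw [← sub_div, sub_sub_sub_cancel_right, abs_div, abs_of_pos hδ, div_lt_one hδ] at this
      linarith
  rw [Finset.card_range] at h1
  calc (s.card : ℝ) ≤ ((⌊L / δ⌋₊ + 1 : ℕ) : ℝ) := by exact_mod_cast h1
    _ ≤ L / δ + 1 := by push_cast; gcongr; exact Nat.floor_le (by positivity)

/-- Pairs of integers of the dyadic interval with greatest common divisor `g`. -/
noncomputable def gcdPairs (H : ℝ) (g : ℕ) : Finset (ℕ × ℕ) :=
  (dyadic H ×ˢ dyadic H).filter fun p ↦ p.1.gcd p.2 = g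

/-- The logarithm of the ratio of the two members of a pair. -/
noncomputable def logRatio (p : ℕ × ℕ) : ℝ := Real.log p.1 - Real.log p.2

theorem mem_gcdPairs {H : ℝ} (hH : 0 ≤ H) {g : ℕ} {p : ℕ × ℕ} : p ∈ gcdPairs H g ↔
    ((H < p.1 ∧ (p.1 : ℝ) ≤ 2 * H) ∧ (H < p.2 ∧ (p.2 : ℝ) ≤ 2 * H)) ∧ p.1.gcd p.2 = g := by
  rw [gcdPairs, Finset.mem_filter, Finset.mem_product, mem_dyadic hH, mem_dyadic hH]

theorem card_gcdPairs_le {H : ℝ} (hH : 0 < H) {g : ℕ} (hg : 0 < g) :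
    ((gcdPairs H g).card : ℝ) ≤ (2 * H / g) ^ 2 := by
  have hg' : (0 : ℝ) < g := by exact_mod_cast hg
  set n := ⌊2 * H / g⌋₊
  have h1 : (gcdPairs H g).card ≤ (Finset.Icc 1 n ×ˢ Finset.Icc 1 n).card := by
    refine Finset.card_le_card_of_injOn (fun p ↦ (p.1 / g, p.2 / g)) (fun p hp ↦ ?_)
      fun p hp q hq hpq ↦ ?_
    · rw [Finset.mem_coe, mem_gcdPairs hH.le] at hp
      obtain ⟨⟨⟨a1, a2⟩, a3, a4⟩, a5⟩ := hp
      have d1 : g ∣ p.1 := a5 ▸ Nat.gcd_dvd_left _ _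
      have d2 : g ∣ p.2 := a5 ▸ Nat.gcd_dvd_right _ _
      have p1 : 0 < p.1 := by have : (0 : ℝ) < p.1 := by linarith
                              exact_mod_cast this
      have p2 : 0 < p.2 := by have : (0 : ℝ) < p.2 := by linarith
                              exact_mod_cast this
      simp only [Finset.coe_product, Finset.coe_Icc, mem_prod, mem_Icc]
      refine ⟨⟨Nat.div_pos (Nat.le_of_dvd p1 d1) hg, ?_⟩,
        ⟨Nat.div_pos (Nat.le_of_dvd p2 d2) hg, ?_⟩⟩
      · rw [Nat.le_floor_iff (by positivity), Nat.cast_div d1 hg'.ne']; gcongr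
      · rw [Nat.le_floor_iff (by positivity), Nat.cast_div d2 hg'.ne']; gcongr
    · rw [Finset.mem_coe, mem_gcdPairs hH.le] at hp hq
      have d1 : g ∣ p.1 := hp.2 ▸ Nat.gcd_dvd_left _ _
      have d2 : g ∣ p.2 := hp.2 ▸ Nat.gcd_dvd_right _ _
      have d3 : g ∣ q.1 := hq.2 ▸ Nat.gcd_dvd_left _ _
      have d4 : g ∣ q.2 := hq.2 ▸ Nat.gcd_dvd_right _ _
      simp only [Prod.mk.injEq] at hpq
      exact Prod.ext ((Nat.div_left_inj d1 d3).1 hpq.1) ((Nat.div_left_inj d2 d4).1 hpq.2)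
  rw [Finset.card_product, Nat.card_Icc, Nat.add_sub_cancel] at h1
  calc ((gcdPairs H g).card : ℝ) ≤ ((n * n : ℕ) : ℝ) := by exact_mod_cast h1
    _ = (n : ℝ) ^ 2 := by push_cast; ring
    _ ≤ _ := by gcongr; exact Nat.floor_le (by positivity)

theorem div_le_abs_log_sub_log {x y d B : ℝ} (hx : 0 < x) (hy : 0 < y) (hxB : x ≤ B) (hyB : y ≤ B)
    (hd : d ≤ |x - y|) : d / B ≤ |Real.log x - Real.log y| := by
  have key : ∀ x y : ℝ, 0 < x → 0 < y → x ≤ B → y ≤ x → d ≤ |x - y| →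
      d / B ≤ |Real.log x - Real.log y| := by
    intro x y hx hy hxB hyx hd
    rw [abs_of_nonneg (sub_nonneg.2 hyx)] at hd
    have h1 := Real.one_sub_inv_le_log_of_pos (div_pos hx hy)
    rw [Real.log_div hx.ne' hy.ne', inv_div] at h1
    refine le_trans ?_ (le_abs_self _)
    refine le_trans ?_ h1
    calc d / B ≤ (x - y) / B := by gcongr; linarith
      _ ≤ (x - y) / x := div_le_div_of_nonneg_left (sub_nonneg.2 hyx) hx hxB
      _ = 1 - y / x := by rw [sub_div, div_self hx.ne']
  rcases le_total y x with h | h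
  · exact key x y hx hy hxB h hd
  · rw [abs_sub_comm] at hd ⊢
    exact key y x hy hx hyB h hd

/-- Distinct pairs with the same greatest common divisor have well separated ratios. -/
theorem logRatio_separated {H : ℝ} (hH : 0 < H) {g : ℕ} (hg : 0 < g) {p q : ℕ × ℕ}
    (hp : p ∈ gcdPairs H g) (hq : q ∈ gcdPairs H g) (hne : p ≠ q) :
    1 / (2 * H / g) ^ 2 ≤ |logRatio p - logRatio q| := by
  have hg' : (0 : ℝ) < g := by exact_mod_cast hg
  rw [mem_gcdPairs hH.le] at hp hq
  obtain ⟨⟨⟨a1, a2⟩, a3, a4⟩, a5⟩ := hp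
  obtain ⟨⟨⟨b1, b2⟩, b3, b4⟩, b5⟩ := hq
  have p1 : (0 : ℝ) < p.1 := by linarith
  have p2 : (0 : ℝ) < p.2 := by linarith
  have q1 : (0 : ℝ) < q.1 := by linarith
  have q2 : (0 : ℝ) < q.2 := by linarith
  obtain ⟨a, a', hcop, hpa, hpa'⟩ := Nat.exists_coprime p.1 p.2
  obtain ⟨b, b', hcop', hqb, hqb'⟩ := Nat.exists_coprime q.1 q.2
  rw [a5] at hpa hpa'
  rw [b5] at hqb hqb'
  have hint : a * b' ≠ b * a' := by
    intro h
    have e1 : a = b := Nat.dvd_antisymm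
      (hcop.dvd_of_dvd_mul_right (h ▸ Dvd.intro _ rfl))
      (hcop'.dvd_of_dvd_mul_right (h.symm ▸ Dvd.intro _ rfl))
    have e2 : a' = b' := by
      have : 0 < a := Nat.pos_of_ne_zero fun h0 ↦ by
        rw [hpa, h0] at p1; simp at p1
      rw [← e1] at h
      exact (Nat.eq_of_mul_eq_mul_left this h).symm
    exact hne (Prod.ext (by rw [hpa, hqb, e1]) (by rw [hpa', hqb', e2]))
  have hdiff : (g : ℝ) ^ 2 ≤ |(p.1 : ℝ) * q.2 - q.1 * p.2| := by
    have e1 : (p.1 : ℝ) * q.2 - q.1 * p.2 = g ^ 2 * (((a : ℤ) * b' - b * a' : ℤ) : ℝ) := by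
      rw [hpa, hpa', hqb, hqb']; push_cast; ring
    have e2 : (1 : ℝ) ≤ |(((a : ℤ) * b' - b * a' : ℤ) : ℝ)| := by
      have hne0 : (a : ℤ) * b' - b * a' ≠ 0 := sub_ne_zero.2 (by exact_mod_cast hint)
      have h2 : ((1 : ℤ) : ℝ) ≤ ((|(a : ℤ) * b' - b * a'| : ℤ) : ℝ) :=
        Int.cast_le.2 (Int.one_le_abs hne0)
      rwa [Int.cast_abs, Int.cast_one] at h2
    rw [e1, abs_mul, abs_of_nonneg (by positivity : (0 : ℝ) ≤ (g : ℝ) ^ 2)]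
    exact le_mul_of_one_le_right (by positivity) e2
  have h1 := div_le_abs_log_sub_log (B := (2 * H) * (2 * H)) (mul_pos p1 q2) (mul_pos q1 p2)
    (mul_le_mul a2 b4 q2.le (by positivity)) (mul_le_mul b2 a4 p2.le (by positivity)) hdiff
  have e3 : Real.log (p.1 * q.2) - Real.log (q.1 * p.2) = logRatio p - logRatio q := by
    rw [Real.log_mul p1.ne' q2.ne', Real.log_mul q1.ne' p2.ne', logRatio, logRatio]; ring
  rw [e3] at h1
  refine le_trans (le_of_eq ?_) h1
  field_simp

/-- If both factors are separated, then fixing one member of a pair leaves few choices for the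
other. -/
theorem card_filter_abs_add_le {ι κ : Type*} (s : Finset ι) (r : Finset κ) {f : ι → ℝ} {g : κ → ℝ}
    {β γ Δ δ : ℝ} (hβ : β ≠ 0) (hΔ : 0 ≤ Δ) (hδ : 0 < δ)
    (hsep : ∀ i ∈ s, ∀ j ∈ s, i ≠ j → δ ≤ |f i - f j|) :
    (((s ×ˢ r).filter fun p ↦ |β * f p.1 + γ * g p.2| ≤ Δ).card : ℝ) ≤
      r.card * (2 * Δ / (|β| * δ) + 1) := by
  classical
  have hβ' : 0 < |β| := abs_pos.2 hβ
  have h1 : ((s ×ˢ r).filter fun p ↦ |β * f p.1 + γ * g p.2| ≤ Δ).card =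
      ∑ k ∈ r, (s.filter fun i ↦ |β * f i + γ * g k| ≤ Δ).card := by
    rw [Finset.card_filter, Finset.sum_product_right]
    exact Finset.sum_congr rfl fun k _ ↦ (Finset.card_filter _ _).symm
  rw [h1]
  push_cast
  rw [← nsmul_eq_mul]
  refine Finset.sum_le_card_nsmul _ _ _ fun k _ ↦ ?_
  have h2 := card_le_of_separated (s.filter fun i ↦ |β * f i + γ * g k| ≤ Δ) (f := f) hδ
    (L := 2 * Δ / |β|) (x := -(γ * g k / β) - Δ / |β|) (by positivity)
    (fun i hi j hj ↦ hsep i (Finset.mem_filter.1 hi).1 j (Finset.mem_filter.1 hj).1)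
    (fun i hi ↦ by
      have h3 := (Finset.mem_filter.1 hi).2
      have e : β * f i + γ * g k = β * (f i + γ * g k / β) := by field_simp
      rw [e, abs_mul, ← le_div_iff₀' hβ', abs_le] at h3
      have : 2 * Δ / |β| = 2 * (Δ / |β|) := by ring
      constructor <;> linarith [h3.1, h3.2])
  rwa [div_div] at h2

/-- For fixed greatest common divisors, either pair of variables may be counted with the other one
fixed; the smaller main term is at most the geometric mean `4 H N / (g g')` of the two. -/
theorem card_filter_gcdPairs_le {β γ : ℝ} (hβ : β ≠ 0) (hγ : γ ≠ 0) {H N Δ : ℝ} (hH : 0 < H)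
    (hN : 0 < N) (hΔ : 0 ≤ Δ) {g g' : ℕ} (hg : 0 < g) (hg' : 0 < g') :
    (((gcdPairs H g ×ˢ gcdPairs N g').filter
        fun p ↦ |β * logRatio p.1 + γ * logRatio p.2| ≤ Δ).card : ℝ) ≤
      (2 * H / g) * (2 * N / g') +
        2 * Δ * (1 / |β| + 1 / |γ|) * ((2 * H / g) * (2 * N / g')) ^ 2 := by
  have hβ' : 0 < |β| := abs_pos.2 hβ
  have hγ' : 0 < |γ| := abs_pos.2 hγ
  have hgr : (0 : ℝ) < g := by exact_mod_cast hg
  have hgr' : (0 : ℝ) < g' := by exact_mod_cast hg'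
  have c1 := card_gcdPairs_le hH hg
  have c2 := card_gcdPairs_le hN hg'
  set u := 2 * H / g with hu
  set v := 2 * N / g' with hv
  have hu0 : 0 < u := by positivity
  have hv0 : 0 < v := by positivity
  have b1 := card_filter_abs_add_le (gcdPairs H g) (gcdPairs N g') (f := logRatio) (g := logRatio)
    (γ := γ) hβ hΔ (δ := 1 / u ^ 2) (by positivity)
    (fun i hi j hj ↦ logRatio_separated hH hg hi hj)
  have b2 := card_filter_abs_add_le (gcdPairs N g') (gcdPairs H g) (f := logRatio) (g := logRatio)
    (γ := β) hγ hΔ (δ := 1 / v ^ 2) (by positivity)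
    (fun i hi j hj ↦ logRatio_separated hN hg' hi hj)
  have hswap : ((gcdPairs N g' ×ˢ gcdPairs H g).filter
        fun p ↦ |γ * logRatio p.1 + β * logRatio p.2| ≤ Δ).card =
      ((gcdPairs H g ×ˢ gcdPairs N g').filter
        fun p ↦ |β * logRatio p.1 + γ * logRatio p.2| ≤ Δ).card := by
    refine Finset.card_bij' (fun p _ ↦ p.swap) (fun p _ ↦ p.swap) ?_ ?_ (by simp) (by simp)
    · intro p hp
      simp only [Finset.mem_filter, Finset.mem_product, Prod.fst_swap, Prod.snd_swap] at hp ⊢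
      exact ⟨hp.1.symm, by rw [add_comm]; exact hp.2⟩
    · intro p hp
      simp only [Finset.mem_filter, Finset.mem_product, Prod.fst_swap, Prod.snd_swap] at hp ⊢
      exact ⟨hp.1.symm, by rw [add_comm]; exact hp.2⟩
  rw [hswap] at b2
  set c := (((gcdPairs H g ×ˢ gcdPairs N g').filter
        fun p ↦ |β * logRatio p.1 + γ * logRatio p.2| ≤ Δ).card : ℝ)
  have d1 : c ≤ v ^ 2 + 2 * Δ * (1 / |β|) * (u * v) ^ 2 := by
    refine b1.trans ((mul_le_mul_of_nonneg_right c2 (by positivity)).trans (le_of_eq ?_))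
    field_simp; ring
  have d2 : c ≤ u ^ 2 + 2 * Δ * (1 / |γ|) * (u * v) ^ 2 := by
    refine b2.trans ((mul_le_mul_of_nonneg_right c1 (by positivity)).trans (le_of_eq ?_))
    field_simp; ring
  have n1 : 0 ≤ 2 * Δ * (1 / |β|) * (u * v) ^ 2 := by positivity
  have n2 : 0 ≤ 2 * Δ * (1 / |γ|) * (u * v) ^ 2 := by positivity
  have e : 2 * Δ * (1 / |β| + 1 / |γ|) * (u * v) ^ 2 =
      2 * Δ * (1 / |β|) * (u * v) ^ 2 + 2 * Δ * (1 / |γ|) * (u * v) ^ 2 := by ring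
  -- the smaller of `u ^ 2` and `v ^ 2` is at most `u * v`
  rcases le_total u v with h | h <;> nlinarith

theorem exists_sum_one_div_le {ε : ℝ} (hε : 0 < ε) : ∃ C : ℝ, 0 < C ∧ ∀ H : ℝ, 1 ≤ H →
    ∑ g ∈ Finset.Icc 1 ⌊2 * H⌋₊, (1 / g : ℝ) ≤ C * H ^ ε := by
  refine ⟨1 + 2 ^ ε / ε, by positivity, fun H hH ↦ ?_⟩
  have h1 := harmonic_le_one_add_log ⌊2 * H⌋₊
  rw [harmonic_eq_sum_Icc] at h1
  push_cast at h1
  simp only [← one_div] at h1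
  have hf : 1 ≤ ⌊2 * H⌋₊ := Nat.le_floor (by push_cast; linarith)
  have h2 : Real.log ⌊2 * H⌋₊ ≤ Real.log (2 * H) :=
    Real.log_le_log (by exact_mod_cast hf) (Nat.floor_le (by linarith))
  have h3 := Real.log_le_rpow_div (x := 2 * H) (by linarith) hε
  rw [Real.mul_rpow (by norm_num) (by linarith)] at h3
  have h4 : 1 ≤ H ^ ε := Real.one_le_rpow hH hε.le
  calc _ ≤ 1 + Real.log ⌊2 * H⌋₊ := h1
    _ ≤ H ^ ε + 2 ^ ε * H ^ ε / ε := by linarith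
    _ = _ := by ring

/-- The spacing estimate: few quadruples `(h, h', n, n')` have `h ^ β * n ^ γ` close to
`h' ^ β * n' ^ γ`. Quadruples are sorted by the two greatest common divisors. -/
theorem exists_card_spacing_le {β γ : ℝ} (hβ : β ≠ 0) (hγ : γ ≠ 0) {ε D : ℝ} (hε : 0 < ε)
    (hD : 0 ≤ D) : ∃ C : ℝ, 0 < C ∧ ∀ H N : ℝ, 1 ≤ H → 1 ≤ N →
      ((((dyadic H ×ˢ dyadic H) ×ˢ (dyadic N ×ˢ dyadic N)).filter
        fun p ↦ |β * logRatio p.1 + γ * logRatio p.2| ≤ D / (H * N)).card : ℝ) ≤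
      C * ((H * N) * (H * N) ^ ε) := by
  obtain ⟨C1, hC1, HC1⟩ := exists_sum_one_div_le hε
  set E := 1 / |β| + 1 / |γ| with hE
  have hE0 : 0 ≤ E := by positivity
  refine ⟨(4 + 32 * D * E) * (C1 * C1), by positivity, fun H N hH hN ↦ ?_⟩
  have hH0 : 0 < H := by linarith
  have hN0 : 0 < N := by linarith
  set S := ((dyadic H ×ˢ dyadic H) ×ˢ (dyadic N ×ˢ dyadic N)).filter
        fun p ↦ |β * logRatio p.1 + γ * logRatio p.2| ≤ D / (H * N) with hS
  set I := Finset.Icc 1 ⌊2 * H⌋₊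
  set J := Finset.Icc 1 ⌊2 * N⌋₊
  have hgcd : ∀ {H : ℝ}, 1 ≤ H → ∀ p ∈ dyadic H ×ˢ dyadic H,
      p.1.gcd p.2 ∈ Finset.Icc 1 ⌊2 * H⌋₊ := by
    intro H hH p hp
    rw [Finset.mem_product, mem_dyadic (by linarith), mem_dyadic (by linarith)] at hp
    have : (0 : ℝ) < p.1 := by linarith [hp.1.1]
    have p1 : 0 < p.1 := by exact_mod_cast this
    rw [Finset.mem_Icc, Nat.le_floor_iff (by linarith)]
    refine ⟨Nat.gcd_pos_of_pos_left _ p1, le_trans ?_ hp.1.2⟩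
    exact_mod_cast Nat.gcd_le_left _ p1
  have h1 : S.card = ∑ k ∈ I ×ˢ J,
      (S.filter fun p ↦ (p.1.1.gcd p.1.2, p.2.1.gcd p.2.2) = k).card := by
    refine Finset.card_eq_sum_card_fiberwise fun p hp ↦ ?_
    rw [Finset.mem_coe, hS, Finset.mem_filter, Finset.mem_product] at hp
    exact Finset.mem_coe.2 (Finset.mem_product.2 ⟨hgcd hH _ hp.1.1, hgcd hN _ hp.1.2⟩)
  have h2 : ∀ k ∈ I ×ˢ J,
      ((S.filter fun p ↦ (p.1.1.gcd p.1.2, p.2.1.gcd p.2.2) = k).card : ℝ) ≤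
        (4 + 32 * D * E) * (H * N) * ((1 / k.1 : ℝ) * (1 / k.2)) := by
    intro k hk
    rw [Finset.mem_product, Finset.mem_Icc, Finset.mem_Icc] at hk
    have k1 : (1 : ℝ) ≤ k.1 := by exact_mod_cast hk.1.1
    have k2 : (1 : ℝ) ≤ k.2 := by exact_mod_cast hk.2.1
    have h3 := card_filter_gcdPairs_le hβ hγ hH0 hN0 (Δ := D / (H * N)) (by positivity)
      (g := k.1) (g' := k.2) (by omega) (by omega)
    have h4 : (S.filter fun p ↦ (p.1.1.gcd p.1.2, p.2.1.gcd p.2.2) = k).card ≤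
        ((gcdPairs H k.1 ×ˢ gcdPairs N k.2).filter
          fun p ↦ |β * logRatio p.1 + γ * logRatio p.2| ≤ D / (H * N)).card := by
      refine Finset.card_le_card fun p hp ↦ ?_
      simp only [hS, gcdPairs, Finset.mem_filter, Finset.mem_product, Prod.ext_iff] at hp ⊢
      tauto
    refine (Nat.cast_le.2 h4).trans (h3.trans ?_)
    set x : ℝ := 1 / k.1 with hx
    set y : ℝ := 1 / k.2 with hy
    have hx1 : x ≤ 1 := by rw [hx, div_le_one (by linarith)]; exact k1
    have hy1 : y ≤ 1 := by rw [hy, div_le_one (by linarith)]; exact k2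
    have hx0 : 0 < x := by positivity
    have hy0 : 0 < y := by positivity
    have e1 : 2 * H / k.1 = 2 * H * x := by rw [hx]; ring
    have e2 : 2 * N / k.2 = 2 * N * y := by rw [hy]; ring
    rw [e1, e2]
    have e3 : 2 * (D / (H * N)) * E * ((2 * H * x) * (2 * N * y)) ^ 2 =
        32 * D * E * (H * N) * (x * y) ^ 2 := by field_simp; ring
    have e4 : (x * y) ^ 2 ≤ x * y := by
      have : x * y ≤ 1 := mul_le_one₀ hx1 hy0.le hy1
      have h0 : 0 < x * y := by positivity
      nlinarith
    have e5 : 32 * D * E * (H * N) * (x * y) ^ 2 ≤ 32 * D * E * (H * N) * (x * y) := by gcongr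
    rw [e3]
    linarith
  calc (S.card : ℝ) = ∑ k ∈ I ×ˢ J,
        ((S.filter fun p ↦ (p.1.1.gcd p.1.2, p.2.1.gcd p.2.2) = k).card : ℝ) := by
        rw [h1]; push_cast; rfl
    _ ≤ ∑ k ∈ I ×ˢ J, (4 + 32 * D * E) * (H * N) * ((1 / k.1 : ℝ) * (1 / k.2)) :=
        Finset.sum_le_sum h2
    _ = (4 + 32 * D * E) * (H * N) * ((∑ g ∈ I, (1 / g : ℝ)) * ∑ g ∈ J, (1 / g : ℝ)) := by
        rw [← Finset.mul_sum, Finset.sum_mul_sum, Finset.sum_product]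
    _ ≤ (4 + 32 * D * E) * (H * N) * ((C1 * H ^ ε) * (C1 * N ^ ε)) := by
        have : 0 ≤ ∑ g ∈ J, (1 / g : ℝ) := Finset.sum_nonneg fun g _ ↦ by positivity
        gcongr
        · exact HC1 H hH
        · exact HC1 N hN
    _ = _ := by rw [Real.mul_rpow hH0.le hN0.le]; ring

/-! ### Discrete mean values -/

/-- Gallagher's form of the Sobolev inequality on the interval `[a, a + 1]`. -/
theorem norm_le_integral_add_norm_deriv {f f' : ℝ → ℂ} (hf : ∀ t, HasDerivAt f (f' t) t)
    (hf' : Continuous f') {a t : ℝ} (ht : t ∈ Icc a (a + 1)) :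
    ‖f t‖ ≤ ∫ x in a..(a + 1), (‖f x‖ + ‖f' x‖) := by
  have hfc : Continuous f := continuous_iff_continuousAt.2 fun t ↦ (hf t).continuousAt
  set I := ∫ x in a..(a + 1), ‖f' x‖ with hI
  have hpt : ∀ x ∈ Icc a (a + 1), ‖f t‖ ≤ ‖f x‖ + I := by
    intro x hx
    have h1 : ∫ y in x..t, f' y = f t - f x :=
      integral_eq_sub_of_hasDerivAt (fun y _ ↦ hf y) (hf'.intervalIntegrable _ _)
    have h2 : ‖f t - f x‖ ≤ I := by
      rw [← h1]
      refine (intervalIntegral.norm_integral_le_integral_norm_uIoc).trans ?_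
      rw [hI, intervalIntegral.integral_of_le (by linarith)]
      refine setIntegral_mono_set ?_ (Filter.Eventually.of_forall fun y ↦ norm_nonneg _) ?_
      · exact (hf'.norm.continuousOn.integrableOn_Icc).mono_set Ioc_subset_Icc_self
      · refine (Ioc_subset_Ioc (le_min hx.1 ht.1) (max_le hx.2 ht.2)).eventuallyLE
    calc ‖f t‖ = ‖f x + (f t - f x)‖ := by congr 1; ring
      _ ≤ ‖f x‖ + ‖f t - f x‖ := norm_add_le _ _
      _ ≤ _ := by gcongr
  have ci : ∀ g : ℝ → ℝ, Continuous g → IntervalIntegrable g volume a (a + 1) :=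
    fun g hg ↦ hg.intervalIntegrable _ _
  calc ‖f t‖ = ∫ _x in a..(a + 1), ‖f t‖ := by simp
    _ ≤ ∫ x in a..(a + 1), (‖f x‖ + I) :=
        intervalIntegral.integral_mono_on (by linarith) (ci _ (by fun_prop))
          (ci _ (by fun_prop)) hpt
    _ = _ := by
        rw [intervalIntegral.integral_add (ci _ (by fun_prop)) (ci _ (by fun_prop)),
          intervalIntegral.integral_add (ci _ (by fun_prop)) (ci _ (by fun_prop))]
        simp [hI]

theorem sq_integral_le {G : ℝ → ℝ} (hG : Continuous G) (a : ℝ) :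
    (∫ x in a..(a + 1), G x) ^ 2 ≤ ∫ x in a..(a + 1), G x ^ 2 := by
  set I := ∫ x in a..(a + 1), G x with hI
  have ci : ∀ g : ℝ → ℝ, Continuous g → IntervalIntegrable g volume a (a + 1) :=
    fun g hg ↦ hg.intervalIntegrable _ _
  have h1 : 0 ≤ ∫ x in a..(a + 1), (G x - I) ^ 2 :=
    intervalIntegral.integral_nonneg (by linarith) fun x _ ↦ sq_nonneg _
  have h2 : ∫ x in a..(a + 1), (G x - I) ^ 2 = (∫ x in a..(a + 1), G x ^ 2) - I ^ 2 := by
    have : ∀ x, (G x - I) ^ 2 = G x ^ 2 - (2 * I * G x - I ^ 2) := fun x ↦ by ring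
    simp only [this]
    rw [intervalIntegral.integral_sub (ci _ (by fun_prop)) (ci _ (by fun_prop)),
      intervalIntegral.integral_sub (ci _ (by fun_prop)) (ci _ (by fun_prop)),
      intervalIntegral.integral_const_mul, ← hI]
    simp
    ring
  linarith

/-- A large sieve inequality for points that may cluster: the clustering costs the number of
pairs of points at distance at most `1`. -/
theorem sq_sum_norm_le {ι : Type*} (J : Finset ι) (t : ι → ℝ) {n : ℕ}
    (ht : ∀ j ∈ J, 0 ≤ t j ∧ t j < n) {f f' : ℝ → ℂ} (hf : ∀ t, HasDerivAt f (f' t) t)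
    (hf' : Continuous f') :
    (∑ j ∈ J, ‖f (t j)‖) ^ 2 ≤ ((J ×ˢ J).filter fun p ↦ |t p.1 - t p.2| ≤ 1).card *
      (2 * ((∫ x in (0 : ℝ)..n, ‖f x‖ ^ 2) + ∫ x in (0 : ℝ)..n, ‖f' x‖ ^ 2)) := by
  classical
  have hfc : Continuous f := continuous_iff_continuousAt.2 fun t ↦ (hf t).continuousAt
  set G : ℝ → ℝ := fun x ↦ ‖f x‖ + ‖f' x‖ with hG
  have hGc : Continuous G := by fun_prop
  set I : ℕ → ℝ := fun k ↦ ∫ x in (k : ℝ)..(k + 1), G x with hI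
  have hI0 : ∀ k, 0 ≤ I k := fun k ↦
    intervalIntegral.integral_nonneg (by linarith) fun x _ ↦ by positivity
  set c : ℕ → ℕ := fun k ↦ (J.filter fun j ↦ ⌊t j⌋₊ = k).card with hc
  have hmaps : ∀ j ∈ J, ⌊t j⌋₊ ∈ Finset.range n := fun j hj ↦
    Finset.mem_range.2 ((Nat.floor_lt (ht j hj).1).2 (ht j hj).2)
  have h1 : ∑ j ∈ J, ‖f (t j)‖ ≤ ∑ k ∈ Finset.range n, (c k : ℝ) * I k := by
    calc ∑ j ∈ J, ‖f (t j)‖ ≤ ∑ j ∈ J, I ⌊t j⌋₊ := Finset.sum_le_sum fun j hj ↦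
          norm_le_integral_add_norm_deriv hf hf'
            ⟨Nat.floor_le (ht j hj).1, (Nat.lt_floor_add_one _).le⟩
      _ = ∑ k ∈ Finset.range n, ∑ j ∈ J with ⌊t j⌋₊ = k, I ⌊t j⌋₊ :=
          (Finset.sum_fiberwise_of_maps_to hmaps _).symm
      _ = _ := by
          refine Finset.sum_congr rfl fun k _ ↦ ?_
          rw [Finset.sum_congr rfl (g := fun _ ↦ I k) fun j hj ↦ by
            rw [(Finset.mem_filter.1 hj).2]]
          rw [Finset.sum_const, nsmul_eq_mul]
  have h2 : ∑ k ∈ Finset.range n, (c k : ℝ) ^ 2 ≤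
      ((J ×ˢ J).filter fun p ↦ |t p.1 - t p.2| ≤ 1).card := by
    have e1 : ((J ×ˢ J).filter fun p ↦ ⌊t p.1⌋₊ = ⌊t p.2⌋₊).card =
        ∑ k ∈ Finset.range n, c k ^ 2 := by
      rw [Finset.card_eq_sum_card_fiberwise (f := fun p ↦ ⌊t p.1⌋₊) (t := Finset.range n)]
      · refine Finset.sum_congr rfl fun k _ ↦ ?_
        rw [sq, hc, ← Finset.card_product]
        congr 1
        ext p
        simp only [Finset.mem_filter, Finset.mem_product]
        constructor
        · rintro ⟨⟨⟨a1, a2⟩, a3⟩, a4⟩; exact ⟨⟨a1, a4⟩, a2, by rw [← a3, a4]⟩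
        · rintro ⟨⟨a1, a2⟩, a3, a4⟩; exact ⟨⟨⟨a1, a3⟩, by rw [a2, a4]⟩, a2⟩
      · intro p hp
        simp only [Finset.coe_filter, Finset.mem_product, mem_ofPred_eq] at hp
        exact hmaps _ hp.1.1
    have e2 : ((J ×ˢ J).filter fun p ↦ ⌊t p.1⌋₊ = ⌊t p.2⌋₊).card ≤
        ((J ×ˢ J).filter fun p ↦ |t p.1 - t p.2| ≤ 1).card := by
      refine Finset.card_le_card fun p hp ↦ ?_
      rw [Finset.mem_filter, Finset.mem_product] at hp ⊢
      refine ⟨hp.1, ?_⟩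
      have a1 := Nat.floor_le (ht _ hp.1.1).1
      have a2 := Nat.lt_floor_add_one (t p.1)
      have a3 := Nat.floor_le (ht _ hp.1.2).1
      have a4 := Nat.lt_floor_add_one (t p.2)
      rw [hp.2] at a1 a2
      rw [abs_le]
      constructor <;> linarith
    rw [e1] at e2
    exact_mod_cast e2
  have ci : ∀ (g : ℝ → ℝ), Continuous g → ∀ a b, IntervalIntegrable g volume a b :=
    fun g hg a b ↦ hg.intervalIntegrable _ _
  have h3 : ∑ k ∈ Finset.range n, I k ^ 2 ≤
      2 * ((∫ x in (0 : ℝ)..n, ‖f x‖ ^ 2) + ∫ x in (0 : ℝ)..n, ‖f' x‖ ^ 2) := by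
    calc ∑ k ∈ Finset.range n, I k ^ 2
        ≤ ∑ k ∈ Finset.range n, ∫ x in (k : ℝ)..((k + 1 : ℕ) : ℝ), G x ^ 2 :=
          Finset.sum_le_sum fun k _ ↦ by
            push_cast; exact sq_integral_le hGc k
      _ = ∫ x in (0 : ℝ)..n, G x ^ 2 := by
          rw [intervalIntegral.sum_integral_adjacent_intervals (a := fun k : ℕ ↦ (k : ℝ))
            fun k _ ↦ ci _ (by fun_prop) _ _]
          simp
      _ ≤ ∫ x in (0 : ℝ)..n, 2 * (‖f x‖ ^ 2 + ‖f' x‖ ^ 2) := by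
          refine intervalIntegral.integral_mono_on (by positivity) (ci _ (by fun_prop) _ _)
            (ci _ (by fun_prop) _ _) fun x _ ↦ add_sq_le
      _ = _ := by
          rw [intervalIntegral.integral_const_mul, intervalIntegral.integral_add
            (ci _ (by fun_prop) _ _) (ci _ (by fun_prop) _ _)]
  calc (∑ j ∈ J, ‖f (t j)‖) ^ 2 ≤ (∑ k ∈ Finset.range n, (c k : ℝ) * I k) ^ 2 := by gcongr
    _ ≤ (∑ k ∈ Finset.range n, (c k : ℝ) ^ 2) * ∑ k ∈ Finset.range n, I k ^ 2 :=
        Finset.sum_mul_sq_le_sq_mul_sq _ _ _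
    _ ≤ _ := by gcongr

theorem hasDerivAt_expSum {ι : Type*} (s : Finset ι) (θ : ι → ℂ) (φ : ι → ℝ) (t : ℝ) :
    HasDerivAt (expSum s θ φ)
      (expSum s (fun i ↦ 2 * Real.pi * Complex.I * φ i * θ i) φ t) t := by
  unfold expSum
  refine HasDerivAt.fun_sum fun i _ ↦ ?_
  have h1 : HasDerivAt (fun t : ℝ ↦ t * φ i) (φ i) t := by
    simpa using (hasDerivAt_id t).mul_const (φ i)
  have := (hasDerivAt_expTwoPiI_comp h1).const_mul (θ i)
  convert! this using 1
  ring

/-- The mean square of a bilinear sum over frequency differences, from the majorant principle and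
the fourth moment bound. -/
theorem exists_integral_norm_sq_diff_le {α : ℝ} (h0 : α ≠ 0) (h1 : α ≠ 1) {η : ℝ} (hη : 0 < η) :
    ∃ C : ℝ, 0 < C ∧ ∀ M R w : ℝ, 1 ≤ M → 0 ≤ R → ∀ θ : ℕ × ℕ → ℂ,
      (∀ p ∈ dyadic M ×ˢ dyadic M, ‖θ p‖ ≤ w) →
      ∫ t in (-R)..R, ‖expSum (dyadic M ×ˢ dyadic M) θ
        (fun p ↦ monoFreq α M p.1 - monoFreq α M p.2) t‖ ^ 2 ≤
        C * w ^ 2 * (R / M ^ 2 + 1) * M ^ (4 + η) := by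
  obtain ⟨C, hC, HC⟩ := fourthMomentBound hη α h0 h1
  refine ⟨9 * C, by positivity, fun M R w hM hR θ hθ ↦ ?_⟩
  have hM0 : 0 < M := by linarith
  have hmaj := integral_norm_sq_expSum_le_long (dyadic M ×ˢ dyadic M) (θ := θ)
    (fun p ↦ monoFreq α M p.1 - monoFreq α M p.2) (w := fun _ ↦ w) hθ (T := M ^ 2 / 3) (R := R)
    (by positivity) hR
  have e1 : ∀ t, ‖expSum (dyadic M ×ˢ dyadic M) (fun _ ↦ (w : ℂ))
      (fun p ↦ monoFreq α M p.1 - monoFreq α M p.2) t‖ ^ 2 =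
      w ^ 2 * ‖expSum (dyadic M) (fun _ ↦ 1) (monoFreq α M) t‖ ^ 4 := by
    intro t
    have e2 : expSum (dyadic M ×ˢ dyadic M) (fun _ ↦ (w : ℂ))
        (fun p ↦ monoFreq α M p.1 - monoFreq α M p.2) t =
        w * (expSum (dyadic M) (fun _ ↦ 1) (monoFreq α M) t *
          starRingEnd ℂ (expSum (dyadic M) (fun _ ↦ 1) (monoFreq α M) t)) := by
      rw [conj_expSum, expSum_mul]
      simp [expSum, Finset.mul_sum, sub_eq_add_neg]
    rw [e2, norm_mul, norm_mul, RCLike.norm_conj, Complex.norm_real, mul_pow, Real.norm_eq_abs,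
      sq_abs]
    ring
  simp only [e1] at hmaj
  rw [intervalIntegral.integral_const_mul, show 3 * (M ^ 2 / 3) = M ^ 2 by ring] at hmaj
  refine hmaj.trans ?_
  have hMη : 0 < M ^ (4 + η) := Real.rpow_pos_of_pos hM0 _
  calc _ ≤ (R / (M ^ 2 / 3) + 1) * (3 * (w ^ 2 * (C * M ^ (4 + η)))) := by
        gcongr
        exact HC M (by linarith)
    _ = (3 * (R / M ^ 2) + 1) * (3 * (w ^ 2 * (C * M ^ (4 + η)))) := by
        congr 2; field_simp
    _ ≤ (3 * (R / M ^ 2) + 3) * (3 * (w ^ 2 * (C * M ^ (4 + η)))) := by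
        gcongr; norm_num
    _ = _ := by ring

/-- The discrete mean value of a bilinear sum over frequency differences. -/
theorem exists_sq_sum_norm_diff_le {α : ℝ} (h0 : α ≠ 0) (h1 : α ≠ 1) {η : ℝ} (hη : 0 < η) :
    ∃ C : ℝ, 0 < C ∧ ∀ M R w : ℝ, 1 ≤ M → 1 ≤ R → ∀ θ : ℕ × ℕ → ℂ,
      (∀ p ∈ dyadic M ×ˢ dyadic M, ‖θ p‖ ≤ w) → ∀ {ι : Type} (J : Finset ι) (t : ι → ℝ),
      (∀ j ∈ J, 0 ≤ t j ∧ t j ≤ R) →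
      (∑ j ∈ J, ‖expSum (dyadic M ×ˢ dyadic M) θ
        (fun p ↦ monoFreq α M p.1 - monoFreq α M p.2) (t j)‖) ^ 2 ≤
        ((J ×ˢ J).filter fun p ↦ |t p.1 - t p.2| ≤ 1).card *
          (C * w ^ 2 * (R / M ^ 2 + 1) * M ^ (4 + η)) := by
  obtain ⟨C, hC, HC⟩ := exists_integral_norm_sq_diff_le h0 h1 hη
  obtain ⟨_, B, _, hB0, hB⟩ := exists_rpow_bounds (a := 1) (b := 2) one_pos (by norm_num) α
  set K := 2 * Real.pi * (2 * B) with hK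
  have hK0 : 0 < K := by have := Real.pi_pos; positivity
  refine ⟨4 * C * (1 + K ^ 2), by positivity, fun M R w hM hR θ hθ ι J t ht ↦ ?_⟩
  have hM0 : 0 < M := by linarith
  set φ : ℕ × ℕ → ℝ := fun p ↦ monoFreq α M p.1 - monoFreq α M p.2 with hφ
  set s := dyadic M ×ˢ dyadic M with hs
  have hfreq : ∀ m ∈ dyadic M, |monoFreq α M m| ≤ B := by
    intro m hm
    rw [mem_dyadic hM0.le] at hm
    have h2 := hB (m / M) ⟨by rw [le_div_iff₀ hM0]; linarith, by rw [div_le_iff₀ hM0]; linarith⟩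
    rw [monoFreq, abs_of_nonneg (Real.rpow_nonneg (by positivity) _)]
    exact h2.2
  have hφB : ∀ p ∈ s, |φ p| ≤ 2 * B := by
    intro p hp
    rw [hs, Finset.mem_product] at hp
    have := abs_sub (monoFreq α M p.1) (monoFreq α M p.2)
    simp only [hφ]
    linarith [hfreq _ hp.1, hfreq _ hp.2]
  set n : ℕ := ⌊R⌋₊ + 1 with hn
  have hnR : (n : ℝ) ≤ 2 * R := by
    rw [hn]; push_cast
    linarith [Nat.floor_le (by linarith : (0 : ℝ) ≤ R)]
  have hRn : R < n := by rw [hn]; push_cast; exact Nat.lt_floor_add_one R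
  have key := sq_sum_norm_le J t (n := n) (fun j hj ↦ ⟨(ht j hj).1, (ht j hj).2.trans_lt hRn⟩)
    (hasDerivAt_expSum s θ φ) (by fun_prop)
  have half : ∀ g : ℝ → ℝ, Continuous g → (∀ x, 0 ≤ g x) →
      ∫ x in (0 : ℝ)..n, g x ≤ ∫ x in (-(n : ℝ))..n, g x := fun g hg h ↦
    intervalIntegral.integral_mono_interval (by simp) (by positivity) le_rfl
      (Filter.Eventually.of_forall h) (hg.intervalIntegrable _ _)
  have b1 := (half _ (by fun_prop) (fun x ↦ by positivity)).trans
    (HC M n w hM (by positivity) θ hθ)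
  have b2 := (half _ (by fun_prop) (fun x ↦ by positivity)).trans
    (HC M n (K * w) hM (by positivity) (fun p ↦ 2 * Real.pi * Complex.I * φ p * θ p) fun p hp ↦ by
      rw [norm_mul, norm_mul, norm_mul, norm_mul, Complex.norm_I, Complex.norm_real,
        Complex.norm_real, Real.norm_of_nonneg Real.pi_pos.le, Real.norm_eq_abs, mul_one,
        Complex.norm_two, hK]
      have := hφB p hp
      have := hθ p hp
      have := Real.pi_pos
      gcongr)
  refine key.trans ?_
  refine mul_le_mul_of_nonneg_left ?_ (by positivity)
  have hMη : 0 < M ^ (4 + η) := Real.rpow_pos_of_pos hM0 _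
  have b3 : (n : ℝ) / M ^ 2 + 1 ≤ 2 * (R / M ^ 2 + 1) := by
    have : (n : ℝ) / M ^ 2 ≤ 2 * R / M ^ 2 := by gcongr
    rw [mul_div_assoc] at this
    linarith
  calc _ ≤ 2 * (C * w ^ 2 * (n / M ^ 2 + 1) * M ^ (4 + η) +
        C * (K * w) ^ 2 * (n / M ^ 2 + 1) * M ^ (4 + η)) := by gcongr
    _ = 2 * C * (1 + K ^ 2) * w ^ 2 * (n / M ^ 2 + 1) * M ^ (4 + η) := by ring
    _ ≤ 2 * C * (1 + K ^ 2) * w ^ 2 * (2 * (R / M ^ 2 + 1)) * M ^ (4 + η) := by gcongr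
    _ = _ := by ring

/-! ### Mean values over a family of coefficient sequences -/

/-- A quasi-orthogonal family `P` of coefficient sequences at the points `t j`: the diagonal is
estimated trivially, the off-diagonal terms by the discrete mean value. -/
theorem exists_sq_sum_norm_family_le {α : ℝ} (h0 : α ≠ 0) (h1 : α ≠ 1) {η : ℝ} (hη : 0 < η) :
    ∃ C : ℝ, 0 < C ∧ ∀ M R w Y : ℝ, 1 ≤ M → 1 ≤ R → 0 ≤ w → 0 ≤ Y →
      ∀ {κ : Type} (P : Finset κ) (b : κ → ℕ → ℂ),
      (∀ p ∈ P, ∀ m ∈ dyadic M, ‖b p m‖ ≤ 1) →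
      (∀ m ∈ dyadic M, ∀ m' ∈ dyadic M, m ≠ m' →
        ‖∑ p ∈ P, b p m * starRingEnd ℂ (b p m')‖ ≤ w) →
      ∀ {ι : Type} (J : Finset ι) (t : ι → ℝ), (∀ j ∈ J, 0 ≤ t j ∧ t j ≤ R) →
      ((J ×ˢ J).filter fun p ↦ |t p.1 - t p.2| ≤ 1).card *
          (C * w ^ 2 * (R / M ^ 2 + 1) * M ^ (4 + η)) ≤ Y ^ 2 →
      (∑ p ∈ P, ∑ j ∈ J, ‖expSum (dyadic M) (b p) (monoFreq α M) (t j)‖) ^ 2 ≤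
        (P.card * J.card) * (P.card * J.card * (2 * M) + Y) := by
  classical
  obtain ⟨C, hC, HC⟩ := exists_sq_sum_norm_diff_le h0 h1 hη
  refine ⟨C, hC, fun M R w Y hM hR hw hY κ P b hb hoff ι J t ht hpairs ↦ ?_⟩
  have hM0 : 0 < M := by linarith
  set s := dyadic M with hs
  set θ : ℕ × ℕ → ℂ := fun q ↦
    if q.1 = q.2 then 0 else ∑ p ∈ P, b p q.1 * starRingEnd ℂ (b p q.2) with hθ
  set Z := expSum (s ×ˢ s) θ (fun p ↦ monoFreq α M p.1 - monoFreq α M p.2) with hZ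
  have hsq : ∀ x : ℝ, ∑ p ∈ P, ‖expSum s (b p) (monoFreq α M) x‖ ^ 2 ≤
      P.card * (2 * M) + ‖Z x‖ := by
    intro x
    have e1 : ((∑ p ∈ P, ‖expSum s (b p) (monoFreq α M) x‖ ^ 2 : ℝ) : ℂ) =
        ∑ p ∈ P, ∑ m ∈ s, b p m * starRingEnd ℂ (b p m) + Z x := by
      have e2 : ∀ p, ((‖expSum s (b p) (monoFreq α M) x‖ ^ 2 : ℝ) : ℂ) =
          expSum (s ×ˢ s) (fun q ↦ b p q.1 * starRingEnd ℂ (b p q.2))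
            (fun q ↦ monoFreq α M q.1 - monoFreq α M q.2) x := by
        intro p
        rw [Complex.ofReal_pow, ← Complex.mul_conj', conj_expSum, expSum_mul]
        rfl
      push_cast at e2 ⊢
      have e3 : ∑ p ∈ P, ∑ m ∈ s, b p m * starRingEnd ℂ (b p m) =
          ∑ q ∈ s ×ˢ s, if q.1 = q.2 then ∑ p ∈ P, b p q.1 * starRingEnd ℂ (b p q.2) else 0 := by
        rw [Finset.sum_comm, Finset.sum_product]
        refine Finset.sum_congr rfl fun m hm ↦ ?_
        simp only
        rw [Finset.sum_ite_eq, if_pos hm]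
      rw [Finset.sum_congr rfl fun p _ ↦ e2 p, e3]
      simp only [hZ, expSum]
      rw [Finset.sum_comm, ← Finset.sum_add_distrib]
      refine Finset.sum_congr rfl fun q _ ↦ ?_
      rw [← Finset.sum_mul]
      simp only [hθ]
      by_cases h : q.1 = q.2
      · simp [h]
      · simp [h]
    have e4 : ‖∑ p ∈ P, ∑ m ∈ s, b p m * starRingEnd ℂ (b p m)‖ ≤ P.card * (2 * M) := by
      refine (norm_sum_le_of_le P (f := fun p ↦ ∑ m ∈ s, b p m * starRingEnd ℂ (b p m))
        (n := fun _ ↦ 2 * M) fun p hp ↦ ?_).trans (by simp)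
      refine (norm_sum_le_of_le s (n := fun _ ↦ 1) fun m hm ↦ ?_).trans ?_
      · rw [norm_mul, RCLike.norm_conj]
        exact mul_le_one₀ (hb p hp m hm) (norm_nonneg _) (hb p hp m hm)
      · simpa using card_dyadic_le hM0.le
    have e5 : ∑ p ∈ P, ‖expSum s (b p) (monoFreq α M) x‖ ^ 2 =
        ‖((∑ p ∈ P, ‖expSum s (b p) (monoFreq α M) x‖ ^ 2 : ℝ) : ℂ)‖ := by
      rw [Complex.norm_real, Real.norm_of_nonneg (Finset.sum_nonneg fun _ _ ↦ by positivity)]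
    rw [e5, e1]
    exact (norm_add_le _ _).trans (add_le_add e4 le_rfl)
  have hZs : ∑ j ∈ J, ‖Z (t j)‖ ≤ Y := by
    refine abs_le_of_sq_le_sq' ((HC M R w hM hR θ (fun q hq ↦ ?_) J t ht).trans hpairs) hY |>.2
    simp only [hθ]
    rw [Finset.mem_product] at hq
    split_ifs with h
    · simpa using hw
    · exact hoff _ hq.1 _ hq.2 h
  calc (∑ p ∈ P, ∑ j ∈ J, ‖expSum s (b p) (monoFreq α M) (t j)‖) ^ 2
      = (∑ k ∈ P ×ˢ J, 1 * ‖expSum s (b k.1) (monoFreq α M) (t k.2)‖) ^ 2 := by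
        simp only [Finset.sum_product, one_mul]
    _ ≤ (∑ _k ∈ P ×ˢ J, (1 : ℝ) ^ 2) *
          ∑ k ∈ P ×ˢ J, ‖expSum s (b k.1) (monoFreq α M) (t k.2)‖ ^ 2 :=
        Finset.sum_mul_sq_le_sq_mul_sq _ _ _
    _ = (P.card * J.card) * ∑ j ∈ J, ∑ p ∈ P, ‖expSum s (b p) (monoFreq α M) (t j)‖ ^ 2 := by
        rw [Finset.sum_product_right (s := P) (t := J)
          (f := fun k ↦ ‖expSum s (b k.1) (monoFreq α M) (t k.2)‖ ^ 2)]
        simp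
    _ ≤ (P.card * J.card) * ∑ j ∈ J, (P.card * (2 * M) + ‖Z (t j)‖) := by
        gcongr with j hj
        exact hsq _
    _ ≤ _ := by
        rw [Finset.sum_add_distrib, Finset.sum_const, nsmul_eq_mul]
        refine mul_le_mul_of_nonneg_left (add_le_add (le_of_eq (by ring)) hZs) (by positivity)

/-! ### Dirichlet characters -/

theorem conj_dirichletCharacter {q : ℕ} (χ : DirichletCharacter ℂ q) {a : ZMod q}
    (ha : IsUnit a) : starRingEnd ℂ (χ a) = χ a⁻¹ := by
  have h1 : χ a⁻¹ * χ a = 1 := by rw [← map_mul, ZMod.inv_mul_of_unit a ha, map_one]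
  have h2 : ‖χ a‖ = 1 := by
    obtain ⟨u, rfl⟩ := ha
    exact DirichletCharacter.unit_norm_eq_one χ u
  have h3 : starRingEnd ℂ (χ a) * χ a = 1 := by
    rw [Complex.conj_mul', h2]; simp
  have h4 : χ a ≠ 0 := fun h ↦ by simp [h] at h2
  exact mul_right_cancel₀ h4 (h3.trans h1.symm)

/-- Orthogonality of characters, with the totient estimated by the modulus. -/
theorem norm_sum_dirichletCharacter_le {q : ℕ} (hq : q ≠ 0) [Fintype (DirichletCharacter ℂ q)]
    (m m' : ℕ) : ‖∑ χ : DirichletCharacter ℂ q, χ (m : ZMod q) * starRingEnd ℂ (χ (m' : ZMod q))‖ ≤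
      if (q : ℤ) ∣ (m : ℤ) - m' then (q : ℝ) else 0 := by
  have : NeZero q := ⟨hq⟩
  have hn : (0 : ℝ) ≤ if (q : ℤ) ∣ (m : ℤ) - m' then (q : ℝ) else 0 := by
    split_ifs <;> positivity
  by_cases ha : IsUnit (m' : ZMod q)
  · have e1 : ∑ χ : DirichletCharacter ℂ q, χ (m : ZMod q) * starRingEnd ℂ (χ (m' : ZMod q)) =
        if (m' : ZMod q) = m then (q.totient : ℂ) else 0 := by
      have e2 : ∀ χ : DirichletCharacter ℂ q, χ (m : ZMod q) * starRingEnd ℂ (χ (m' : ZMod q)) =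
          χ (m' : ZMod q)⁻¹ * χ m := fun χ ↦ by rw [conj_dirichletCharacter χ ha, mul_comm]
      simp only [e2]
      convert! DirichletCharacter.sum_char_inv_mul_char_eq ℂ ha (m : ZMod q)
    rw [e1]
    by_cases h : (m' : ZMod q) = m
    · have hd : (q : ℤ) ∣ (m : ℤ) - m' := by
        rw [← ZMod.intCast_eq_intCast_iff_dvd_sub]
        exact_mod_cast h
      rw [if_pos h, if_pos hd, Complex.norm_natCast]
      exact_mod_cast Nat.totient_le q
    · rw [if_neg h, norm_zero]; exact hn
  · have : ∀ χ : DirichletCharacter ℂ q, χ (m' : ZMod q) = 0 := fun χ ↦ χ.map_nonunit ha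
    simp only [this, map_zero, mul_zero, Finset.sum_const_zero, norm_zero]
    exact hn

theorem card_dirichletCharacter_le {q : ℕ} (hq : q ≠ 0) [Fintype (DirichletCharacter ℂ q)] :
    Fintype.card (DirichletCharacter ℂ q) ≤ q := by
  have : NeZero q := ⟨hq⟩
  rw [← Nat.card_eq_fintype_card, DirichletCharacter.card_eq_totient_of_hasEnoughRootsOfUnity]
  exact Nat.totient_le q

/-- The Dirichlet characters of all moduli up to `Q`. -/
noncomputable def charsUpTo (Q : ℝ) : Finset (Σ q : ℕ, DirichletCharacter ℂ q) :=
  haveI : ∀ q, Fintype (DirichletCharacter ℂ q) :=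
    fun q ↦ @Fintype.ofFinite _ (finite_dirichletCharacter q)
  (Finset.Icc 1 ⌊Q⌋₊).sigma fun _ ↦ Finset.univ

theorem mem_charsUpTo {Q : ℝ} {p : Σ q : ℕ, DirichletCharacter ℂ q} (hp : p ∈ charsUpTo Q) :
    p.1 ∈ Finset.Icc 1 ⌊Q⌋₊ := by
  rw [charsUpTo, Finset.mem_sigma] at hp
  exact hp.1

theorem sum_charsUpTo {E : Type*} [AddCommMonoid E] (Q : ℝ)
    (f : (q : ℕ) → DirichletCharacter ℂ q → E) :
    ∑ p ∈ charsUpTo Q, f p.1 p.2 =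
      ∑ q ∈ Finset.Icc 1 ⌊Q⌋₊, ∑ᶠ χ : DirichletCharacter ℂ q, f q χ := by
  rw [charsUpTo, Finset.sum_sigma]
  refine Finset.sum_congr rfl fun q _ ↦ ?_
  rw [finsum_eq_sum_of_fintype]

theorem card_charsUpTo_le {Q : ℝ} (hQ : 0 ≤ Q) : ((charsUpTo Q).card : ℝ) ≤ Q ^ 2 := by
  rw [charsUpTo, Finset.card_sigma]
  push_cast
  calc _ ≤ ∑ q ∈ Finset.Icc 1 ⌊Q⌋₊, Q := by
        refine Finset.sum_le_sum fun q hq ↦ ?_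
        rw [Finset.mem_Icc, Nat.le_floor_iff hQ] at hq
        rw [Finset.card_univ]
        exact le_trans (by exact_mod_cast card_dirichletCharacter_le (by omega)) hq.2
    _ ≤ Q ^ 2 := by
        rw [Finset.sum_const, nsmul_eq_mul, Nat.card_Icc, Nat.add_sub_cancel, sq]
        gcongr
        exact Nat.floor_le hQ

theorem norm_sum_charsUpTo_le {Q : ℝ} (hQ : 0 ≤ Q) {m m' : ℕ} (hmm : m ≠ m') :
    ‖∑ p ∈ charsUpTo Q, p.2 (m : ZMod p.1) * starRingEnd ℂ (p.2 (m' : ZMod p.1))‖ ≤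
      Q * ((m : ℤ) - m').natAbs.divisors.card := by
  rw [charsUpTo, Finset.sum_sigma]
  calc _ ≤ ∑ q ∈ Finset.Icc 1 ⌊Q⌋₊, if (q : ℤ) ∣ (m : ℤ) - m' then (q : ℝ) else 0 := by
        refine norm_sum_le_of_le _ fun q hq ↦ ?_
        exact norm_sum_dirichletCharacter_le (by have := Finset.mem_Icc.1 hq; omega) m m'
    _ = ∑ q ∈ (Finset.Icc 1 ⌊Q⌋₊).filter fun q : ℕ ↦ (q : ℤ) ∣ (m : ℤ) - m', (q : ℝ) :=
        (Finset.sum_filter _ _).symm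
    _ ≤ ∑ q ∈ (Finset.Icc 1 ⌊Q⌋₊).filter fun q : ℕ ↦ (q : ℤ) ∣ (m : ℤ) - m', Q := by
        refine Finset.sum_le_sum fun q hq ↦ ?_
        rw [Finset.mem_filter, Finset.mem_Icc, Nat.le_floor_iff hQ] at hq
        exact hq.1.2
    _ ≤ _ := by
        rw [Finset.sum_const, nsmul_eq_mul, mul_comm]
        gcongr
        intro q hq
        rw [Finset.mem_filter] at hq
        rw [Nat.mem_divisors]
        exact ⟨Int.natCast_dvd.1 hq.2, by omega⟩

/-! ### The points `X h ^ β n ^ γ / (H ^ β N ^ γ)` -/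

/-- The point `X h ^ β n ^ γ / (H ^ β N ^ γ)` attached to the pair `p = (h, n)`. -/
noncomputable def monoPoint (β γ H N X : ℝ) (p : ℕ × ℕ) : ℝ :=
  X * ((p.1 / H) ^ β * (p.2 / N) ^ γ)

theorem exists_monoPoint_bounds (β γ : ℝ) : ∃ c C : ℝ, 0 < c ∧ 0 < C ∧ ∀ H N X : ℝ, 0 < H → 0 < N →
    0 ≤ X → ∀ p ∈ dyadic H ×ˢ dyadic N,
      c * X ≤ monoPoint β γ H N X p ∧ monoPoint β γ H N X p ≤ C * X := by
  obtain ⟨c1, C1, hc1, hC1, h1⟩ := exists_rpow_bounds (a := 1) (b := 2) one_pos (by norm_num) β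
  obtain ⟨c2, C2, hc2, hC2, h2⟩ := exists_rpow_bounds (a := 1) (b := 2) one_pos (by norm_num) γ
  refine ⟨c1 * c2, C1 * C2, by positivity, by positivity, fun H N X hH hN hX p hp ↦ ?_⟩
  rw [Finset.mem_product, mem_dyadic hH.le, mem_dyadic hN.le] at hp
  have a1 := h1 (p.1 / H) ⟨by rw [le_div_iff₀ hH]; linarith, by rw [div_le_iff₀ hH]; linarith⟩
  have a2 := h2 (p.2 / N) ⟨by rw [le_div_iff₀ hN]; linarith, by rw [div_le_iff₀ hN]; linarith⟩
  rw [monoPoint, mul_comm X]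
  have := hc1.le.trans a1.1
  have := hc2.le.trans a2.1
  exact ⟨by gcongr; exacts [a1.1, a2.1], by gcongr; exacts [a1.2, a2.2]⟩

theorem log_monoPoint {β γ H N X : ℝ} (hH : 0 < H) (hN : 0 < N) (hX : 0 < X) {p : ℕ × ℕ}
    (hp : p ∈ dyadic H ×ˢ dyadic N) : Real.log (monoPoint β γ H N X p) =
      Real.log X + (β * (Real.log p.1 - Real.log H) + γ * (Real.log p.2 - Real.log N)) := by
  rw [Finset.mem_product, mem_dyadic hH.le, mem_dyadic hN.le] at hp
  have h1 : (0 : ℝ) < p.1 := by linarith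
  have h2 : (0 : ℝ) < p.2 := by linarith
  have h3 := Real.rpow_pos_of_pos (div_pos h1 hH) β
  have h4 := Real.rpow_pos_of_pos (div_pos h2 hN) γ
  rw [monoPoint, Real.log_mul hX.ne' (by positivity), Real.log_mul h3.ne' h4.ne',
    Real.log_rpow (by positivity), Real.log_rpow (by positivity), Real.log_div h1.ne' hH.ne',
    Real.log_div h2.ne' hN.ne']

theorem abs_log_sub_log_le {x y d : ℝ} (hd : 0 < d) (hx : d ≤ x) (hy : d ≤ y) :
    |Real.log x - Real.log y| ≤ |x - y| / d := by
  have key : ∀ x y : ℝ, d ≤ x → d ≤ y → Real.log x - Real.log y ≤ |x - y| / d := by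
    intro x y hx hy
    have hy0 : 0 < y := hd.trans_le hy
    have hx0 : 0 < x := hd.trans_le hx
    rw [← Real.log_div hx0.ne' hy0.ne']
    calc Real.log (x / y) ≤ x / y - 1 := Real.log_le_sub_one_of_pos (by positivity)
      _ = (x - y) / y := by field_simp
      _ ≤ |x - y| / y := by gcongr; exact le_abs_self _
      _ ≤ |x - y| / d := by gcongr
  rw [abs_le]
  have h1 := key x y hx hy
  have h2 := key y x hy hx
  rw [abs_sub_comm] at h2
  constructor <;> linarith

/-- Few pairs of the points are at distance at most `1`. -/
theorem exists_card_monoPoint_pairs_le {β γ : ℝ} (hβ : β ≠ 0) (hγ : γ ≠ 0) {ε c : ℝ} (hε : 0 < ε)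
    (hc : 0 < c) : ∃ C : ℝ, 0 < C ∧ ∀ H N X : ℝ, 1 ≤ H → 1 ≤ N → c * (H * N) ≤ X →
      ((((dyadic H ×ˢ dyadic N) ×ˢ (dyadic H ×ˢ dyadic N)).filter fun p ↦
        |monoPoint β γ H N X p.1 - monoPoint β γ H N X p.2| ≤ 1).card : ℝ) ≤
      C * ((H * N) * (H * N) ^ ε) := by
  obtain ⟨c1, C1, hc1, -, hb⟩ := exists_monoPoint_bounds β γ
  obtain ⟨C, hC, HC⟩ := exists_card_spacing_le hβ hγ hε (D := 1 / (c1 * c)) (by positivity)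
  refine ⟨C, hC, fun H N X hH hN hX ↦ (Nat.cast_le.2 ?_).trans (HC H N hH hN)⟩
  have hH0 : 0 < H := by linarith
  have hN0 : 0 < N := by linarith
  have hX0 : 0 < X := lt_of_lt_of_le (by positivity) hX
  refine Finset.card_le_card_of_injOn (fun p ↦ ((p.1.1, p.2.1), (p.1.2, p.2.2))) (fun p hp ↦ ?_)
    fun p _ q _ hpq ↦ ?_
  · rw [Finset.mem_coe, Finset.mem_filter, Finset.mem_product] at hp
    obtain ⟨⟨hp1, hp2⟩, hp3⟩ := hp
    have h1 := abs_log_sub_log_le (d := c1 * X) (by positivity) (hb H N X hH0 hN0 hX0.le _ hp1).1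
      (hb H N X hH0 hN0 hX0.le _ hp2).1
    rw [log_monoPoint hH0 hN0 hX0 hp1, log_monoPoint hH0 hN0 hX0 hp2] at h1
    rw [Finset.mem_product] at hp1 hp2
    rw [Finset.mem_coe, Finset.mem_filter, Finset.mem_product, Finset.mem_product,
      Finset.mem_product]
    refine ⟨⟨⟨hp1.1, hp2.1⟩, hp1.2, hp2.2⟩, ?_⟩
    have e : β * logRatio (p.1.1, p.2.1) + γ * logRatio (p.1.2, p.2.2) =
        Real.log X + (β * (Real.log p.1.1 - Real.log H) + γ * (Real.log p.1.2 - Real.log N)) -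
        (Real.log X + (β * (Real.log p.2.1 - Real.log H) + γ * (Real.log p.2.2 - Real.log N))) := by
      simp only [logRatio]; ring
    simp only
    rw [e]
    refine h1.trans ?_
    calc _ ≤ 1 / (c1 * X) := by gcongr
      _ ≤ 1 / (c1 * (c * (H * N))) := by gcongr
      _ = _ := by field_simp
  · simp only [Prod.mk.injEq] at hpq
    obtain ⟨⟨a1, a2⟩, a3, a4⟩ := hpq
    exact Prod.ext (Prod.ext a1 a3) (Prod.ext a2 a4)

/-! ### The trilinear sum -/

/-- The coefficients `a` are removed by the triangle inequality. -/
theorem norm_trilinearSum_le (α β γ : ℝ) {H N M : ℝ} (hH : 0 < H) (hN : 0 < N) (hM : 0 < M) (X : ℝ)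
    {a : ℕ → ℕ → (q : ℕ) → DirichletCharacter ℂ q → ℂ} (b : ℕ → ℂ) {q : ℕ}
    {χ : DirichletCharacter ℂ q} (ha : ∀ h ∈ dyadic H, ∀ n ∈ dyadic N, ‖a h n q χ‖ ≤ 1) :
    ‖trilinearSum α β γ H N M X a b q χ‖ ≤ ∑ j ∈ dyadic H ×ˢ dyadic N,
      ‖expSum (dyadic M) (fun m ↦ b m * χ (m : ZMod q)) (monoFreq α M)
        (monoPoint β γ H N X j)‖ := by
  rw [trilinearSum, Finset.sum_product]
  refine norm_sum_le_of_le _ fun h hh ↦ norm_sum_le_of_le _ fun n hn ↦ ?_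
  rw [norm_mul]
  have e : ∑ m ∈ dyadic M, b m * χ (m : ZMod q) *
      expTwoPiI (X * (h : ℝ) ^ β * (n : ℝ) ^ γ * (m : ℝ) ^ α / (H ^ β * N ^ γ * M ^ α)) =
      expSum (dyadic M) (fun m ↦ b m * χ (m : ZMod q)) (monoFreq α M)
        (monoPoint β γ H N X (h, n)) := by
    refine Finset.sum_congr rfl fun m _ ↦ ?_
    congr 2
    simp only [monoFreq, monoPoint]
    rw [Real.div_rpow (by positivity) hH.le, Real.div_rpow (by positivity) hN.le,
      Real.div_rpow (by positivity) hM.le]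
    ring
  rw [e]
  exact mul_le_of_le_one_left (norm_nonneg _) (ha h hh n hn)

/-- The off-diagonal character sums, with the divisor bound inserted. -/
theorem exists_norm_sum_charsUpTo_le {η : ℝ} (hη : 0 < η) : ∃ C : ℝ, 0 < C ∧
    ∀ M Q : ℝ, 0 ≤ M → 0 ≤ Q → ∀ m ∈ dyadic M, ∀ m' ∈ dyadic M, m ≠ m' →
      ‖∑ p ∈ charsUpTo Q, p.2 (m : ZMod p.1) * starRingEnd ℂ (p.2 (m' : ZMod p.1))‖ ≤
        C * (Q * M ^ η) := by
  obtain ⟨C, hC, HC⟩ := exists_card_divisors_le hη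
  refine ⟨C, hC, fun M Q hM hQ m hm m' hm' hne ↦ (norm_sum_charsUpTo_le hQ hne).trans ?_⟩
  rw [mem_dyadic hM] at hm hm'
  have h1 := HC ((m : ℤ) - m').natAbs (by omega)
  have h2 : (((m : ℤ) - m').natAbs : ℝ) ≤ M := by
    rw [Nat.cast_natAbs, Int.cast_abs]
    push_cast
    rw [abs_le]
    constructor <;> linarith
  calc Q * (((m : ℤ) - m').natAbs.divisors.card : ℝ) ≤ Q * (C * M ^ η) := by
        refine mul_le_mul_of_nonneg_left (h1.trans ?_) hQ
        gcongr
    _ = _ := by ring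

/-- The diagonal and the off-diagonal contribution compared with the two terms of the bound. -/
theorem mul_add_le_sq {r s u x E K : ℝ} (hr : 0 ≤ r) (hs : 0 ≤ s) (hu : 0 ≤ u) (hx : 0 ≤ x)
    (hE : 1 ≤ E) (hK : 0 ≤ K) :
    ((r ^ 2) ^ 2 * (4 * s ^ 4)) * ((r ^ 2) ^ 2 * (4 * s ^ 4) * (2 * u ^ 2) +
        K * (r ^ 2 * s ^ 2 * u ^ 4 * (x ^ 2 + 1) * E ^ 2)) ≤
      ((32 + 4 * K) * (E * (r ^ 4 * s ^ 4 * u + r ^ 3 * s ^ 3 * u ^ 2 * (x + 1)))) ^ 2 := by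
  set A := r ^ 4 * s ^ 4 * u with hA
  set D := r ^ 3 * s ^ 3 * u ^ 2 with hD
  have hA0 : 0 ≤ A := by positivity
  have hD0 : 0 ≤ D := by positivity
  have hB0 : 0 ≤ D * (x + 1) := by positivity
  set B := D * (x + 1) with hB
  have h2 : 1 ≤ E ^ 2 := one_le_pow₀ hE
  have h3 : A ^ 2 ≤ (A + B) ^ 2 := pow_le_pow_left₀ hA0 (by linarith) 2
  have h4 : B ^ 2 ≤ (A + B) ^ 2 := pow_le_pow_left₀ hB0 (by linarith) 2
  have h5 : A ^ 2 ≤ (A + B) ^ 2 * E ^ 2 := h3.trans (le_mul_of_one_le_right (sq_nonneg _) h2)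
  have h7 : D ^ 2 * (x ^ 2 + 1) ≤ B ^ 2 := by
    have := mul_le_mul_of_nonneg_left (show x ^ 2 + 1 ≤ (x + 1) ^ 2 by nlinarith) (sq_nonneg D)
    rwa [← mul_pow] at this
  have h8 : 4 * K * (D ^ 2 * (x ^ 2 + 1)) * E ^ 2 ≤ 4 * K * (A + B) ^ 2 * E ^ 2 :=
    mul_le_mul_of_nonneg_right (mul_le_mul_of_nonneg_left (h7.trans h4) (by positivity))
      (by positivity)
  calc _ = 32 * A ^ 2 + 4 * K * (D ^ 2 * (x ^ 2 + 1)) * E ^ 2 := by rw [hA, hD]; ring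
    _ ≤ 32 * ((A + B) ^ 2 * E ^ 2) + 4 * K * (A + B) ^ 2 * E ^ 2 := by linarith
    _ = (32 + 4 * K) * (E * (A + B)) ^ 2 := by ring
    _ ≤ (32 + 4 * K) ^ 2 * (E * (A + B)) ^ 2 :=
        mul_le_mul_of_nonneg_right (le_self_pow₀ (by linarith) (by norm_num)) (sq_nonneg _)
    _ = _ := by ring

/-- The product of the number of close pairs of points and the mean value of the off-diagonal
terms, as a square. -/
theorem mul_mul_le_sq {r s u x g m K Cp C1 Cd C2 : ℝ}
    (hg : 1 ≤ g) (hm : 1 ≤ m) (hC1 : 0 ≤ C1) (hCp : 0 ≤ Cp) (hC2 : 0 ≤ C2)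
    (hK : K ^ 2 = Cp * (C1 * Cd ^ 2 * (C2 + 1))) :
    Cp * (s ^ 4 * g) * (C1 * (Cd * (r ^ 2 * m)) ^ 2 * (C2 * x ^ 4 + 1) * (u ^ 8 * m)) ≤
      (K * (r ^ 2 * s ^ 2 * u ^ 4 * (x ^ 2 + 1) * (g * m) ^ 2)) ^ 2 := by
  have e2 : C2 * x ^ 4 + 1 ≤ (C2 + 1) * (x ^ 2 + 1) ^ 2 := by
    nlinarith [sq_nonneg x, sq_nonneg (x ^ 2), mul_nonneg hC2 (sq_nonneg x)]
  have e3 : g * m ^ 3 ≤ (g * m) ^ 4 := by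
    rw [mul_pow]
    exact mul_le_mul (le_self_pow₀ hg (by norm_num)) (pow_le_pow_right₀ hm (by norm_num))
      (by positivity) (by positivity)
  calc _ ≤ Cp * (s ^ 4 * g) * (C1 * (Cd * (r ^ 2 * m)) ^ 2 * ((C2 + 1) * (x ^ 2 + 1) ^ 2) *
        (u ^ 8 * m)) := by gcongr
    _ = K ^ 2 * (r ^ 4 * s ^ 4 * u ^ 8 * (x ^ 2 + 1) ^ 2) * (g * m ^ 3) := by rw [hK]; ring
    _ ≤ K ^ 2 * (r ^ 4 * s ^ 4 * u ^ 8 * (x ^ 2 + 1) ^ 2) * (g * m) ^ 4 := by gcongr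
    _ = _ := by ring

theorem lemma2 (α β γ : ℝ) (hαβγ : α * (α - 1) * β * γ ≠ 0)
    (ε : ℝ) (hε : 0 < ε) (c : ℝ) (hc : 0 < c) :
    ∃ C : ℝ, 0 < C ∧
      ∀ H N M Q X : ℝ, 1 ≤ H → 1 ≤ N → 1 ≤ M → 1 ≤ Q → c * (H * N) ≤ X →
      ∀ (a : ℕ → ℕ → (q : ℕ) → DirichletCharacter ℂ q → ℂ) (b : ℕ → ℂ),
        (∀ h ∈ dyadic H, ∀ n ∈ dyadic N, ∀ q ∈ Finset.Icc 1 ⌊Q⌋₊,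
          ∀ χ : DirichletCharacter ℂ q, ‖a h n q χ‖ ≤ 1) →
        (∀ m ∈ dyadic M, ‖b m‖ ≤ 1) →
        ∑ q ∈ Finset.Icc 1 ⌊Q⌋₊, ∑ᶠ χ : DirichletCharacter ℂ q,
            ‖trilinearSum α β γ H N M X a b q χ‖ ≤
          C * ((H * M * N) ^ ε *
            (Q ^ 2 * H * N * M ^ (1 / 2 : ℝ) +
              Q ^ (3 / 2 : ℝ) * H * N * M *
                (X ^ (1 / 4 : ℝ) / ((H * N) ^ (1 / 4 : ℝ) * M ^ (1 / 2 : ℝ)) +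
                  1 / (H * N) ^ (1 / 4 : ℝ)))) := by
  have hγ : γ ≠ 0 := right_ne_zero_of_mul hαβγ
  have hβ : β ≠ 0 := right_ne_zero_of_mul (left_ne_zero_of_mul hαβγ)
  have hα' := left_ne_zero_of_mul (left_ne_zero_of_mul hαβγ)
  have h0 : α ≠ 0 := left_ne_zero_of_mul hα'
  have h1 : α ≠ 1 := sub_ne_zero.1 (right_ne_zero_of_mul hα')
  obtain ⟨C1, hC1, HC1⟩ := exists_sq_sum_norm_family_le h0 h1 hε
  obtain ⟨Cp, hCp, HCp⟩ := exists_card_monoPoint_pairs_le hβ hγ hε hc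
  obtain ⟨Cd, hCd, HCd⟩ := exists_norm_sum_charsUpTo_le hε
  obtain ⟨c1, Cx, hc1, hCx, Hb⟩ := exists_monoPoint_bounds β γ
  set C2 := Cx + 1 / c with hC2
  have hC20 : 0 < C2 := by positivity
  set K := Real.sqrt (Cp * (C1 * Cd ^ 2 * (C2 + 1))) with hK
  have hK2 : K ^ 2 = Cp * (C1 * Cd ^ 2 * (C2 + 1)) := Real.sq_sqrt (by positivity)
  have hK0 : 0 ≤ K := Real.sqrt_nonneg _
  refine ⟨32 + 4 * K, by positivity, fun H N M Q X hH hN hM hQ hX a b ha hb ↦ ?_⟩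
  have hH0 : 0 < H := by linarith
  have hN0 : 0 < N := by linarith
  have hM0 : 0 < M := by linarith
  have hQ0 : 0 < Q := by linarith
  have hHN : 1 ≤ H * N := one_le_mul_of_one_le_of_one_le hH hN
  have hX0 : 0 < X := lt_of_lt_of_le (by positivity) hX
  rw [← sum_charsUpTo Q fun q χ ↦ ‖trilinearSum α β γ H N M X a b q χ‖]
  set P := charsUpTo Q with hP
  set J := dyadic H ×ˢ dyadic N with hJ
  have hPc : (P.card : ℝ) ≤ Q ^ 2 := card_charsUpTo_le hQ0.le
  have hJc : (J.card : ℝ) ≤ 4 * (H * N) := by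
    rw [hJ, Finset.card_product]
    push_cast
    calc _ ≤ (2 * H) * (2 * N) := mul_le_mul (card_dyadic_le hH0.le) (card_dyadic_le hN0.le)
          (by positivity) (by positivity)
      _ = _ := by ring
  have hPJ : (P.card * J.card : ℝ) ≤ Q ^ 2 * (4 * (H * N)) :=
    mul_le_mul hPc hJc (by positivity) (by positivity)
  -- square and fourth roots of the parameters
  set r := Q ^ (1 / 2 : ℝ) with hr
  set s := (H * N) ^ (1 / 4 : ℝ) with hs
  set u := M ^ (1 / 2 : ℝ) with hu
  set x := X ^ (1 / 4 : ℝ) / u with hx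
  have hr0 : 0 < r := Real.rpow_pos_of_pos hQ0 _
  have hs0 : 0 < s := Real.rpow_pos_of_pos (by positivity) _
  have hu0 : 0 < u := Real.rpow_pos_of_pos hM0 _
  have hx0 : 0 < x := div_pos (Real.rpow_pos_of_pos hX0 _) hu0
  have hr2 : r ^ 2 = Q := by
    rw [hr, ← Real.rpow_natCast, ← Real.rpow_mul hQ0.le]; norm_num
  have hr3 : Q ^ (3 / 2 : ℝ) = r ^ 3 := by
    rw [hr, ← Real.rpow_natCast, ← Real.rpow_mul hQ0.le]; norm_num
  have hs4 : s ^ 4 = H * N := by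
    rw [hs, ← Real.rpow_natCast, ← Real.rpow_mul (by positivity)]; norm_num
  have hu2 : u ^ 2 = M := by
    rw [hu, ← Real.rpow_natCast, ← Real.rpow_mul hM0.le]; norm_num
  have hx4 : x ^ 4 = X / M ^ 2 := by
    have : (X ^ (1 / 4 : ℝ)) ^ 4 = X := by
      rw [← Real.rpow_natCast, ← Real.rpow_mul hX0.le]; norm_num
    rw [hx, div_pow, this, ← hu2]; ring
  set g := (H * N) ^ ε with hg
  set m := M ^ ε with hm
  have hg1 : 1 ≤ g := Real.one_le_rpow hHN hε.le
  have hm1 : 1 ≤ m := Real.one_le_rpow hM hε.le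
  have hE : (H * M * N) ^ ε = g * m := by
    rw [hg, hm, ← Real.mul_rpow (by positivity) hM0.le]; congr 1; ring
  have hE1 : 1 ≤ g * m := one_le_mul_of_one_le_of_one_le hg1 hm1
  rw [hE]
  set E := g * m with hEdef
  -- the points lie in `[0, C2 * X]`, and `X ≥ c * (H * N)` makes this interval long
  have hR1 : 1 ≤ C2 * X := by
    calc (1 : ℝ) ≤ H * N := hHN
      _ = 1 / c * (c * (H * N)) := by field_simp
      _ ≤ 1 / c * X := by gcongr
      _ ≤ C2 * X := by rw [hC2]; gcongr; linarith
  -- `Y` bounds the contribution of the off-diagonal terms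
  set Y := K * (r ^ 2 * s ^ 2 * u ^ 4 * (x ^ 2 + 1) * E ^ 2) with hY
  have hpairs : ((J ×ˢ J).filter fun p ↦
        |monoPoint β γ H N X p.1 - monoPoint β γ H N X p.2| ≤ 1).card *
      (C1 * (Cd * (Q * m)) ^ 2 * (C2 * X / M ^ 2 + 1) * M ^ (4 + ε)) ≤ Y ^ 2 := by
    have e1 : M ^ (4 + ε) = u ^ 8 * m := by
      rw [Real.rpow_add hM0, ← hm, show (4 : ℝ) = (4 : ℕ) by norm_num, Real.rpow_natCast, ← hu2]
      ring
    rw [e1, ← hr2, mul_div_assoc, ← hx4]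
    have hp := HCp H N X hH hN hX
    rw [← hg, ← hs4] at hp
    refine (mul_le_mul_of_nonneg_right hp (by positivity)).trans ?_
    rw [hY]
    exact mul_mul_le_sq hg1 hm1 hC1.le hCp.le hC20.le hK2
  have hsq := HC1 M (C2 * X) (Cd * (Q * m)) Y hM hR1 (by positivity) (by positivity) P
    (fun p k ↦ b k * p.2 (k : ZMod p.1))
    (fun p _ k hk ↦ by
      rw [norm_mul]
      exact mul_le_one₀ (hb k hk) (norm_nonneg _) (DirichletCharacter.norm_le_one _ _))
    (fun k hk k' hk' hne ↦ by
      have e1 : ∑ p ∈ P, b k * p.2 (k : ZMod p.1) *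
          starRingEnd ℂ (b k' * p.2 (k' : ZMod p.1)) = b k * starRingEnd ℂ (b k') *
          ∑ p ∈ P, p.2 (k : ZMod p.1) * starRingEnd ℂ (p.2 (k' : ZMod p.1)) := by
        rw [Finset.mul_sum]
        refine Finset.sum_congr rfl fun p _ ↦ ?_
        rw [map_mul]; ring
      rw [e1, norm_mul, norm_mul, RCLike.norm_conj]
      refine (mul_le_of_le_one_left (norm_nonneg _) (mul_le_one₀ (hb k hk) (norm_nonneg _)
        (hb k' hk'))).trans (HCd M Q hM0.le hQ0.le k hk k' hk' hne))
    J (monoPoint β γ H N X)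
    (fun j hj ↦ by
      have := Hb H N X hH0 hN0 hX0.le j hj
      refine ⟨le_trans (by positivity) this.1, this.2.trans ?_⟩
      gcongr
      rw [hC2]
      exact le_add_of_nonneg_right (by positivity))
    hpairs
  have hle : ∑ p ∈ P, ‖trilinearSum α β γ H N M X a b p.1 p.2‖ ≤
      ∑ p ∈ P, ∑ j ∈ J, ‖expSum (dyadic M) (fun k ↦ b k * p.2 (k : ZMod p.1)) (monoFreq α M)
        (monoPoint β γ H N X j)‖ :=
    Finset.sum_le_sum fun p hp ↦ norm_trilinearSum_le α β γ hH0 hN0 hM0 X b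
      fun h hh n hn ↦ ha h hh n hn p.1 (mem_charsUpTo hp) p.2
  refine hle.trans ?_
  -- the two terms of the bound
  set A := Q ^ 2 * H * N * u with hA
  set B := Q ^ (3 / 2 : ℝ) * H * N * M * (X ^ (1 / 4 : ℝ) / (s * u) + 1 / s) with hB
  have hA' : A = r ^ 4 * s ^ 4 * u := by rw [hA, mul_assoc (Q ^ 2), ← hs4, ← hr2]; ring
  have hB' : B = r ^ 3 * s ^ 3 * u ^ 2 * (x + 1) := by
    have e : X ^ (1 / 4 : ℝ) = x * u := by rw [hx, div_mul_cancel₀ _ hu0.ne']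
    rw [hB, hr3, mul_assoc (r ^ 3), ← hs4, ← hu2, e]
    clear_value s u x r
    field_simp
  have hA0 : 0 ≤ A := by rw [hA']; positivity
  have hB0 : 0 ≤ B := by rw [hB']; positivity
  refine abs_le_of_sq_le_sq' ?_ (by positivity) |>.2
  calc _ ≤ (P.card * J.card : ℝ) * (P.card * J.card * (2 * M) + Y) := hsq
    _ ≤ (Q ^ 2 * (4 * (H * N))) * (Q ^ 2 * (4 * (H * N)) * (2 * M) + Y) :=
        mul_le_mul hPJ (add_le_add (mul_le_mul_of_nonneg_right hPJ (by positivity)) le_rfl)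
          (by positivity) (by positivity)
    _ ≤ ((32 + 4 * K) * (E * (A + B))) ^ 2 := by
        rw [hY, hA', hB', ← hr2, ← hs4, ← hu2]
        exact mul_add_le_sq hr0.le hs0.le hu0.le hx0.le hE1 hK0
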